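/- **Theorem (asymptotic charges).** Let $\Sigma$ be a spacelike hypersurface of a four-dimensional spacetime with smooth Lorentzian metric $g$ of signature $(-,+,+,+)$ which satisfies the vacuum Einstein equations with a cosmological constant, $R_{\mu\nu}-\tfrac12 R\,g_{\mu\nu}+\Lambda g_{\mu\nu}=0$, in a neighbourhood of $\Sigma$. Assume that near $\Sigma$ there are coordinates $(t,x^1,x^2,x^3)$ in which $\Sigma=\{t=0,\ r>R_0\}$, where $r=|x|$ is the Euclidean norm and $R_0>0$. Let $\gamma_{ij}$ be the induced Riemannian metric on $\Sigma$, $n$ the unit normal with $n_\mu=(-N,0,0,0)$, $N>0$, let $K_{ij}=-\nabla_i n_j$ be the extrinsic curvature, and let $$E_{ij}=W_{i\mu\nu j}n^\mu n^\nu,\qquad B_{ij}=W^*_{i\mu\nu j}n^\mu n^\nu,\qquad W^*_{\alpha\beta\mu\nu}=\tfrac12 W_{\alpha\beta\lambda\delta}\,\varepsilon^{\lambda\delta}{}_{\mu\nu},$$ be the electric and magnetic parts of the Weyl tensor $W$ on $\Sigma$. Assume that, with $\eta_{ij}=\delta_{ij}$ and some $M\in\mathbb R$, $$\gamma_{ij}=\Big(1+\frac{M}{2r}\Big)^4(\eta_{ij}+h_{ij}),$$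 and that for some $\varepsilon>0$ the components in the coordinates $x^i$ satisfy, as $r\to\infty$, $$h_{ij}=O(r^{-1-\varepsilon}),\quad (\Gamma_{\eta+h})^a{}_{ij}=O(r^{-2-\varepsilon}),\quad K_{ij}=O(r^{-3}),\quad E_{ij}=O(r^{-3}),\quad B_{ij}=O(r^{-3}),$$ where $\Gamma_{\eta+h}$ denotes the Christoffel symbols of the metric $\eta+h$. Then for every smooth conformal Killing field $X$ of the flat metric $\eta$ on $\{r>R_0\}$, i.e. $\partial_iX_j+\partial_jX_i=\lambda\,\eta_{ij}$ for some function $\lambda$, the limits $$\lim_{r\to\infty}\int_{S(r)}E^i{}_jX^j\,dS_i,\qquad \lim_{r\to\infty}\int_{S(r)}B^i{}_jX^j\,dS_i$$ exist and are finite. Here $S(r)=\{|x|=r\}$, indices are raised with $\gamma$, and $dS_i=\sqrt{\det\gamma}\,\tfrac{x_i}{r}\,d\sigma$ with $d\sigma$ the Euclidean area element of $S(r)$. In particular, with $\mathcal S=x^k\partial_k$, $\mathcal R_k=\varepsilon_k{}^{ij}x_i\partial_j$ (with $\varepsilon_{kij}$ the permutation symbol) and $\mathcal K_k=x_k\mathcal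 S-\tfrac12r^2\partial_k$, the asymptotic charges responsible for mass ($E$ with $\mathcal S$), center of mass ($E$ with $\mathcal K_k$), linear momentum ($B$ with $\mathcal R_k$) and angular momentum ($B$ with $\mathcal K_k$), $k=1,2,3$, exist and are finite. -/

import Mathlib

open MeasureTheory Filter Topology Asymptotics Bornology
open scoped ContDiff

noncomputable section

/-! ### Tensor calculus in coordinates

Tensor fields on (an open part of) the coordinate space are given by their components in the
coordinates `p 0, …, p (n-1)`; the norm of `EuclideanSpace` plays no role for the geometry.
A metric is a matrix-valued function, and the inverse metric is the inverse matrix. -/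

/-- The partial derivative `∂_i f`. -/
def pderiv {n : ℕ} (i : Fin n) (f : EuclideanSpace ℝ (Fin n) → ℝ)
    (p : EuclideanSpace ℝ (Fin n)) : ℝ :=
  fderiv ℝ f p (EuclideanSpace.single i 1)

/-- The Christoffel symbol `Γ^k_{ij}` of the Levi-Civita connection of `g`. -/
def christoffel {n : ℕ} (g : EuclideanSpace ℝ (Fin n) → Matrix (Fin n) (Fin n) ℝ)
    (p : EuclideanSpace ℝ (Fin n)) (k i j : Fin n) : ℝ :=
  (1 / 2) * ∑ m, (g p)⁻¹ k m *
    (pderiv i (fun q => g q m j) p + pderiv j (fun q => g q m i) p - pderiv m (fun q => g q i j) p)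

/-- The curvature `R^k_{lij}`, normalised by `(∇_i ∇_j - ∇_j ∇_i) v^k = R^k_{lij} v^l`. -/
def riemannUp {n : ℕ} (g : EuclideanSpace ℝ (Fin n) → Matrix (Fin n) (Fin n) ℝ)
    (p : EuclideanSpace ℝ (Fin n)) (k l i j : Fin n) : ℝ :=
  pderiv i (fun q => christoffel g q k j l) p - pderiv j (fun q => christoffel g q k i l) p
    + ∑ m, (christoffel g p k i m * christoffel g p m j l
      - christoffel g p k j m * christoffel g p m i l)

/-- The Riemann tensor with all indices down, `R_{klij}`. -/
def riemann {n : ℕ} (g : EuclideanSpace ℝ (Fin n) → Matrix (Fin n) (Fin n) ℝ)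
    (p : EuclideanSpace ℝ (Fin n)) (k l i j : Fin n) : ℝ :=
  ∑ m, g p k m * riemannUp g p m l i j

/-- The Ricci tensor `R_{lj} = R^k_{lkj}`. -/
def ricci {n : ℕ} (g : EuclideanSpace ℝ (Fin n) → Matrix (Fin n) (Fin n) ℝ)
    (p : EuclideanSpace ℝ (Fin n)) (l j : Fin n) : ℝ :=
  ∑ k, riemannUp g p k l k j

/-- The curvature scalar. -/
def scalarCurv {n : ℕ} (g : EuclideanSpace ℝ (Fin n) → Matrix (Fin n) (Fin n) ℝ)
    (p : EuclideanSpace ℝ (Fin n)) : ℝ :=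
  ∑ i, ∑ j, (g p)⁻¹ i j * ricci g p i j

/-- The permutation symbol: the sign of `f` if `f` is a permutation, and `0` otherwise. -/
def permSymbol {n : ℕ} (f : Fin n → Fin n) : ℝ :=
  Matrix.det (Matrix.of fun i j : Fin n => if f i = j then (1 : ℝ) else 0)

/-! ### Spacetime

The coordinates on spacetime are `p 0 = t` and `p 1, p 2, p 3 = x¹, x², x³`. -/

/-- The matrix `g p` has signature `(-,+,+,+)`: in some basis it is `diag(-1,1,1,1)`. -/
def IsLorentzian (G : Matrix (Fin 4) (Fin 4) ℝ) : Prop :=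
  ∃ P : Matrix (Fin 4) (Fin 4) ℝ, IsUnit P.det ∧
    P.transpose * G * P = Matrix.diagonal ![-1, 1, 1, 1]

/-- `g` is a smooth Lorentzian metric on the open set `U`. -/
structure IsLorentzianMetricOn (g : EuclideanSpace ℝ (Fin 4) → Matrix (Fin 4) (Fin 4) ℝ)
    (U : Set (EuclideanSpace ℝ (Fin 4))) : Prop where
  isOpen : IsOpen U
  smooth : ∀ μ ν, ContDiffOn ℝ ∞ (fun p => g p μ ν) U
  symm : ∀ p ∈ U, (g p).IsSymm
  lorentzian : ∀ p ∈ U, IsLorentzian (g p)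

/-- The vacuum Einstein equations with cosmological constant `Λ`,
`R_{μν} - (1/2) R g_{μν} + Λ g_{μν} = 0`, on `U`. -/
def IsEinsteinVacuumOn (Λ : ℝ) (g : EuclideanSpace ℝ (Fin 4) → Matrix (Fin 4) (Fin 4) ℝ)
    (U : Set (EuclideanSpace ℝ (Fin 4))) : Prop :=
  ∀ p ∈ U, ∀ μ ν, ricci g p μ ν - (1 / 2) * scalarCurv g p * g p μ ν + Λ * g p μ ν = 0

/-- The Weyl tensor
`W_{αβμν} = R_{αβμν} - (g_{α[μ} R_{ν]β} - g_{β[μ} R_{ν]α}) + (1/3) R g_{α[μ} g_{ν]β}`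
of a four-dimensional metric (`[..]` contains the factor `1/2`). -/
def weyl (g : EuclideanSpace ℝ (Fin 4) → Matrix (Fin 4) (Fin 4) ℝ)
    (p : EuclideanSpace ℝ (Fin 4)) (α β μ ν : Fin 4) : ℝ :=
  riemann g p α β μ ν
    - ((1 / 2) * (g p α μ * ricci g p ν β - g p α ν * ricci g p μ β)
      - (1 / 2) * (g p β μ * ricci g p ν α - g p β ν * ricci g p μ α))
    + (1 / 3) * scalarCurv g p * ((1 / 2) * (g p α μ * g p ν β - g p α ν * g p μ β))

/-- The volume form `ε_{αβμν}`, with `ε_{0123} = √|det g|` (equivalently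
`√|det g| ε^{1230} = 1`). -/
def volForm (g : EuclideanSpace ℝ (Fin 4) → Matrix (Fin 4) (Fin 4) ℝ)
    (p : EuclideanSpace ℝ (Fin 4)) (α β μ ν : Fin 4) : ℝ :=
  Real.sqrt |(g p).det| * permSymbol ![α, β, μ, ν]

/-- The dual Weyl tensor `W*_{αβμν} = (1/2) W_{αβλδ} ε^{λδ}_{μν}`. -/
def dualWeyl (g : EuclideanSpace ℝ (Fin 4) → Matrix (Fin 4) (Fin 4) ℝ)
    (p : EuclideanSpace ℝ (Fin 4)) (α β μ ν : Fin 4) : ℝ :=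
  (1 / 2) * ∑ l, ∑ d, weyl g p α β l d *
    ∑ ρ, ∑ σ, (g p)⁻¹ l ρ * (g p)⁻¹ d σ * volForm g p ρ σ μ ν

/-! ### The spacelike hypersurface `t = 0` -/

/-- The lapse function `N = (-g^{00})^{-1/2}` of the foliation by `t = const`. -/
def lapse (g : EuclideanSpace ℝ (Fin 4) → Matrix (Fin 4) (Fin 4) ℝ)
    (p : EuclideanSpace ℝ (Fin 4)) : ℝ :=
  1 / Real.sqrt (-(g p)⁻¹ 0 0)

/-- The unit normal of the foliation by `t = const`, index down: `n_μ = (-N, 0, 0, 0)`. -/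
def normalDown (g : EuclideanSpace ℝ (Fin 4) → Matrix (Fin 4) (Fin 4) ℝ)
    (p : EuclideanSpace ℝ (Fin 4)) (μ : Fin 4) : ℝ :=
  if μ = 0 then -lapse g p else 0

/-- The unit normal, index up: `n^μ = g^{μν} n_ν`. -/
def normalUp (g : EuclideanSpace ℝ (Fin 4) → Matrix (Fin 4) (Fin 4) ℝ)
    (p : EuclideanSpace ℝ (Fin 4)) (μ : Fin 4) : ℝ :=
  ∑ ν, (g p)⁻¹ μ ν * normalDown g p ν

/-- The point `(0, x)` of the hypersurface `t = 0`. -/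
def slicePt (x : EuclideanSpace ℝ (Fin 3)) : EuclideanSpace ℝ (Fin 4) :=
  WithLp.toLp 2 (Fin.cons 0 (fun i => x i))

/-- The induced metric `γ_{ij}` on the hypersurface `t = 0`. -/
def inducedMetric (g : EuclideanSpace ℝ (Fin 4) → Matrix (Fin 4) (Fin 4) ℝ)
    (x : EuclideanSpace ℝ (Fin 3)) : Matrix (Fin 3) (Fin 3) ℝ :=
  Matrix.of fun i j => g (slicePt x) i.succ j.succ

/-- The extrinsic curvature `K_{ij} = -∇_i n_j = -(∂_i n_j - Γ^μ_{ij} n_μ)` of the hypersurface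
`t = 0`. Since `n_i = 0`, no projection is needed for the spatial components. -/
def extrinsicCurv (g : EuclideanSpace ℝ (Fin 4) → Matrix (Fin 4) (Fin 4) ℝ)
    (x : EuclideanSpace ℝ (Fin 3)) : Matrix (Fin 3) (Fin 3) ℝ :=
  Matrix.of fun i j =>
    -(pderiv i.succ (fun q => normalDown g q j.succ) (slicePt x)
      - ∑ μ, christoffel g (slicePt x) μ i.succ j.succ * normalDown g (slicePt x) μ)

/-- The electric part `E_{ij} = W_{iμνj} n^μ n^ν` of the Weyl tensor on the hypersurface
`t = 0`. -/
def electricPart (g : EuclideanSpace ℝ (Fin 4) → Matrix (Fin 4) (Fin 4) ℝ)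
    (x : EuclideanSpace ℝ (Fin 3)) : Matrix (Fin 3) (Fin 3) ℝ :=
  Matrix.of fun i j => ∑ μ, ∑ ν, weyl g (slicePt x) i.succ μ ν j.succ
    * normalUp g (slicePt x) μ * normalUp g (slicePt x) ν

/-- The magnetic part `B_{ij} = W*_{iμνj} n^μ n^ν` of the Weyl tensor on the hypersurface
`t = 0`. -/
def magneticPart (g : EuclideanSpace ℝ (Fin 4) → Matrix (Fin 4) (Fin 4) ℝ)
    (x : EuclideanSpace ℝ (Fin 3)) : Matrix (Fin 3) (Fin 3) ℝ :=
  Matrix.of fun i j => ∑ μ, ∑ ν, dualWeyl g (slicePt x) i.succ μ ν j.succ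
    * normalUp g (slicePt x) μ * normalUp g (slicePt x) ν

/-! ### Conformal Killing fields of flat space -/

/-- The smooth vector field `X` satisfies the conformal Killing equation
`∂_i X_j + ∂_j X_i = λ δ_{ij}` of the Euclidean metric on the open set `V`,
for some function `λ`. -/
def IsFlatConformalKillingOn (X : EuclideanSpace ℝ (Fin 3) → EuclideanSpace ℝ (Fin 3))
    (V : Set (EuclideanSpace ℝ (Fin 3))) : Prop :=
  ContDiffOn ℝ ∞ X V ∧ ∃ lam : EuclideanSpace ℝ (Fin 3) → ℝ, ∀ x ∈ V, ∀ i j,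
    pderiv i (fun y => X y j) x + pderiv j (fun y => X y i) x = if i = j then lam x else 0

/-- The generator of scalings, `S = x^k ∂_k`. -/
def scalingField (x : EuclideanSpace ℝ (Fin 3)) : EuclideanSpace ℝ (Fin 3) := x

/-- The generator of rotations around the `k`-th axis, `R_k = ε_k^{ij} x_i ∂_j`. -/
def rotationField (k : Fin 3) (x : EuclideanSpace ℝ (Fin 3)) : EuclideanSpace ℝ (Fin 3) :=
  WithLp.toLp 2 fun j => ∑ i, permSymbol ![k, i, j] * x i

/-- The generator of proper conformal transformations, `K_k = x_k S - (1/2) r² ∂_k`. -/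
def properConformalField (k : Fin 3) (x : EuclideanSpace ℝ (Fin 3)) :
    EuclideanSpace ℝ (Fin 3) :=
  x k • scalingField x - ((1 / 2) * ‖x‖ ^ 2) • EuclideanSpace.single k (1 : ℝ)

/-! ### Asymptotic charges -/

/-- The integrand of `∫_{S(r)} T^i_j X^j dS_i` at the point `r u` of the coordinate sphere `S(r)`,
with respect to the surface measure of the unit sphere. Here `T^i_j = γ^{ik} T_{kj}`, and the
surface element of `γ` is `dS_i = √(det γ) u_i r² du`, i.e. the unit conormal of `S(r)` times the
area element of `S(r)`, both with respect to `γ`. -/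
def chargeIntegrand (γ T : EuclideanSpace ℝ (Fin 3) → Matrix (Fin 3) (Fin 3) ℝ)
    (X : EuclideanSpace ℝ (Fin 3) → EuclideanSpace ℝ (Fin 3)) (r : ℝ)
    (u : Metric.sphere (0 : EuclideanSpace ℝ (Fin 3)) 1) : ℝ :=
  (∑ i, ∑ j, (∑ k, (γ (r • u.1))⁻¹ i k * T (r • u.1) k j) * X (r • u.1) j * u.1 i)
    * Real.sqrt (γ (r • u.1)).det * r ^ 2

/-- The charge `∫_{S(r)} T^i_j X^j dS_i`. -/
def sphereCharge (γ T : EuclideanSpace ℝ (Fin 3) → Matrix (Fin 3) (Fin 3) ℝ)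
    (X : EuclideanSpace ℝ (Fin 3) → EuclideanSpace ℝ (Fin 3)) (r : ℝ) : ℝ :=
  ∫ u, chargeIntegrand γ T X r u ∂(volume : Measure (EuclideanSpace ℝ (Fin 3))).toSphere

/-- The asymptotic charge `lim_{r → ∞} ∫_{S(r)} T^i_j X^j dS_i` exists and is finite (and the
integrals over `S(r)`, `r > R₀`, make sense). -/
def HasAsymptoticCharge (R₀ : ℝ) (γ T : EuclideanSpace ℝ (Fin 3) → Matrix (Fin 3) (Fin 3) ℝ)
    (X : EuclideanSpace ℝ (Fin 3) → EuclideanSpace ℝ (Fin 3)) : Prop :=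
  (∀ r, R₀ < r → Integrable (chargeIntegrand γ T X r)
    (volume : Measure (EuclideanSpace ℝ (Fin 3))).toSphere) ∧
  ∃ q : ℝ, Tendsto (sphereCharge γ T X) atTop (𝓝 q)

end

/-! On the slice the Bianchi identity becomes a pair of Maxwell-like constraints: the divergence of
E is quadratic of type K × B, that of B of type K × E. Both E and B are symmetric and trace-free.
Let T be either of them and S = √γ T^{ij} its raised density. In coordinates the constraint reads
∂_c S^c_j = (1/2) S^{ck} ∂_j γ_{ck} + J_j, where J = O(r⁻⁶) because K, E and B are all O(r⁻³).

The charge is the Euclidean flux of the current S^c_j X^j, whose coordinate divergence is (1/2)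
S^{ck} (L_X γ)_{ck} + J·X. Were γ a multiple of η, L_X γ would be a multiple of γ and would pair to
zero with the trace-free S, whatever the conformal factor. This removes the mass term M/r, which by
its size alone, O(r⁻³), would allow a logarithmic divergence. Only h survives. A conformal Killing
field of flat 3-space has vanishing third derivatives, so X = O(r²) and ∂X = O(r); the terms S X ∂h
and S h ∂X are then O(r^{-3-ε}), and J·X is O(r⁻⁴). With the volume factor r² the divergence is
integrable near infinity, and the divergence theorem on annuli gives the limit.

The constraints come from differential forms in disguise. For an Einstein metric the Weyl tensor is
the curvature minus a parallel tensor, so it satisfies the full second Bianchi identity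
(`IsLorentzianMetricOn.isWeylFieldAt`). Splitting its first index pair with the normal gives
`mixed_bianchi` and `tangential_bianchi`. Three spatial indices leave one independent cyclic sum on
the second pair, and this sum is a divergence after dualising that pair. The identities
`magneticPart_density` and `electricPart_density` recognise the duals as the densities of B and E,
which yields `magnetic_constraint` and `electric_constraint`. The cancellation of the conformally
flat part is `div_charge_eq`, the growth of X is `IsFlatConformalKillingOn.isBigO`, and the
convergence of the flux is `tendsto_sphereFlux`. -/

section CoordinateCalculus

/-! ### Partial derivatives, smooth metrics and Christoffel symbols in coordinates. -/

variable {n : ℕ} {f f' : EuclideanSpace ℝ (Fin n) → ℝ} {p : EuclideanSpace ℝ (Fin n)}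

theorem pderiv_congr (i : Fin n) (h : f =ᶠ[𝓝 p] f') : pderiv i f p = pderiv i f' p := by
  simp only [pderiv, h.fderiv_eq]

theorem pderiv_const (i : Fin n) (c : ℝ) : pderiv i (fun _ => c) p = 0 := by
  simp [pderiv]

theorem pderiv_add (i : Fin n) (hf : DifferentiableAt ℝ f p) (hf' : DifferentiableAt ℝ f' p) :
    pderiv i (fun q => f q + f' q) p = pderiv i f p + pderiv i f' p := by
  simp [pderiv, fderiv_fun_add hf hf']

theorem pderiv_sub (i : Fin n) (hf : DifferentiableAt ℝ f p) (hf' : DifferentiableAt ℝ f' p) :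
    pderiv i (fun q => f q - f' q) p = pderiv i f p - pderiv i f' p := by
  simp [pderiv, fderiv_fun_sub hf hf']

theorem pderiv_mul (i : Fin n) (hf : DifferentiableAt ℝ f p) (hf' : DifferentiableAt ℝ f' p) :
    pderiv i (fun q => f q * f' q) p = pderiv i f p * f' p + f p * pderiv i f' p := by
  simp [pderiv, fderiv_fun_mul hf hf']; ring

theorem pderiv_const_mul (i : Fin n) (c : ℝ) (hf : DifferentiableAt ℝ f p) :
    pderiv i (fun q => c * f q) p = c * pderiv i f p := by
  rw [pderiv_mul i (differentiableAt_const c) hf, pderiv_const, zero_mul, zero_add]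

theorem pderiv_sum {ι : Type*} (s : Finset ι) (i : Fin n) {F : ι → EuclideanSpace ℝ (Fin n) → ℝ}
    (hF : ∀ a ∈ s, DifferentiableAt ℝ (F a) p) :
    pderiv i (fun q => ∑ a ∈ s, F a q) p = ∑ a ∈ s, pderiv i (F a) p := by
  simp [pderiv, fderiv_fun_sum hF]

theorem ContDiffAt.differentiableAt_infty (hf : ContDiffAt ℝ ∞ f p) : DifferentiableAt ℝ f p :=
  hf.differentiableAt (by simp)

theorem ContDiffAt.pderiv (hf : ContDiffAt ℝ ∞ f p) (i : Fin n) :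
    ContDiffAt ℝ ∞ (pderiv i f) p :=
  (hf.fderiv_right (m := ∞) (by simp)).clm_apply contDiffAt_const

theorem pderiv_comm (hf : ContDiffAt ℝ ∞ f p) (i j : Fin n) :
    pderiv i (pderiv j f) p = pderiv j (pderiv i f) p := by
  have hs : IsSymmSndFDerivAt ℝ f p := hf.isSymmSndFDerivAt (by
    rw [minSmoothness_of_isRCLikeNormedField]
    exact WithTop.coe_le_coe.2 le_top)
  have hd : DifferentiableAt ℝ (fderiv ℝ f) p :=
    (hf.fderiv_right (m := ∞) (by simp)).differentiableAt (by simp)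
  have key : ∀ a b : Fin n, _root_.pderiv a (_root_.pderiv b f) p =
      fderiv ℝ (fderiv ℝ f) p (EuclideanSpace.single a 1) (EuclideanSpace.single b 1) := by
    intro a b
    unfold _root_.pderiv
    rw [fderiv_clm_apply hd (differentiableAt_const _)]
    simp
  rw [key, key]
  exact hs _ _

/-- The entries of the matrix-valued function `g` are smooth at `p`. -/
def SmoothEntriesAt (g : EuclideanSpace ℝ (Fin n) → Matrix (Fin n) (Fin n) ℝ)
    (p : EuclideanSpace ℝ (Fin n)) : Prop :=
  ∀ i j, ContDiffAt ℝ ∞ (fun q => g q i j) p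

/-- Near `p`, `g` is a smooth field of symmetric invertible matrices. -/
structure IsMetricAt (g : EuclideanSpace ℝ (Fin n) → Matrix (Fin n) (Fin n) ℝ)
    (p : EuclideanSpace ℝ (Fin n)) : Prop where
  smooth : ∀ᶠ q in 𝓝 p, SmoothEntriesAt g q
  symm : ∀ᶠ q in 𝓝 p, (g q).IsSymm
  det_ne : ∀ᶠ q in 𝓝 p, (g q).det ≠ 0

theorem contDiffAt_matrix_det {E : Type*} [NormedAddCommGroup E] [NormedSpace ℝ E] {m : ℕ}
    {k : WithTop ℕ∞} {g : E → Matrix (Fin m) (Fin m) ℝ} {p : E}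
    (hg : ∀ i j, ContDiffAt ℝ k (fun q => g q i j) p) :
    ContDiffAt ℝ k (fun q => (g q).det) p := by
  simp only [Matrix.det_apply']
  refine ContDiffAt.sum fun σ _ => contDiffAt_const.mul ?_
  exact contDiffAt_prod fun i _ => hg _ _

theorem contDiffAt_matrix_inv {E : Type*} [NormedAddCommGroup E] [NormedSpace ℝ E] {m : ℕ}
    {k : WithTop ℕ∞} {g : E → Matrix (Fin m) (Fin m) ℝ} {p : E}
    (hg : ∀ i j, ContDiffAt ℝ k (fun q => g q i j) p) (hdet : (g p).det ≠ 0) (i j : Fin m) :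
    ContDiffAt ℝ k (fun q => (g q)⁻¹ i j) p := by
  simp only [Matrix.inv_def, Matrix.smul_apply, smul_eq_mul, Ring.inverse_eq_inv']
  refine ((contDiffAt_matrix_det hg).inv hdet).mul ?_
  simp only [Matrix.adjugate_apply]
  refine contDiffAt_matrix_det fun a b => ?_
  simp only [Matrix.updateRow_apply]
  split_ifs
  · exact contDiffAt_const
  · exact hg _ _

variable {g : EuclideanSpace ℝ (Fin n) → Matrix (Fin n) (Fin n) ℝ}

namespace IsMetricAt

/-- The conditions hold on a neighbourhood, so identities proved at one point hold at all nearby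
points and may be differentiated. -/
theorem eventually (hg : IsMetricAt g p) : ∀ᶠ q in 𝓝 p, IsMetricAt g q := by
  filter_upwards [hg.smooth.eventually_nhds, hg.symm.eventually_nhds, hg.det_ne.eventually_nhds]
    with q h1 h2 h3 using ⟨h1, h2, h3⟩

theorem contDiffAt (hg : IsMetricAt g p) (i j : Fin n) : ContDiffAt ℝ ∞ (fun q => g q i j) p :=
  hg.smooth.self_of_nhds i j

theorem inv_contDiffAt (hg : IsMetricAt g p) (i j : Fin n) :
    ContDiffAt ℝ ∞ (fun q => (g q)⁻¹ i j) p :=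
  contDiffAt_matrix_inv hg.contDiffAt hg.det_ne.self_of_nhds i j

theorem christoffel_contDiffAt (hg : IsMetricAt g p) (k i j : Fin n) :
    ContDiffAt ℝ ∞ (fun q => christoffel g q k i j) p := by
  unfold christoffel
  refine contDiffAt_const.mul (ContDiffAt.sum fun m _ => (hg.inv_contDiffAt k m).mul ?_)
  exact (((hg.contDiffAt _ _).pderiv _).add ((hg.contDiffAt _ _).pderiv _)).sub
    ((hg.contDiffAt _ _).pderiv _)

theorem riemannUp_contDiffAt (hg : IsMetricAt g p) (k l i j : Fin n) :
    ContDiffAt ℝ ∞ (fun q => riemannUp g q k l i j) p := by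
  unfold riemannUp
  refine (((hg.christoffel_contDiffAt _ _ _).pderiv _).sub
    ((hg.christoffel_contDiffAt _ _ _).pderiv _)).add (ContDiffAt.sum fun m _ => ?_)
  exact ((hg.christoffel_contDiffAt _ _ _).mul (hg.christoffel_contDiffAt _ _ _)).sub
    ((hg.christoffel_contDiffAt _ _ _).mul (hg.christoffel_contDiffAt _ _ _))

theorem riemann_contDiffAt (hg : IsMetricAt g p) (k l i j : Fin n) :
    ContDiffAt ℝ ∞ (fun q => riemann g q k l i j) p := by
  unfold riemann
  exact ContDiffAt.sum fun m _ => (hg.contDiffAt _ _).mul (hg.riemannUp_contDiffAt _ _ _ _)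

theorem pderiv_symm (hg : IsMetricAt g p) (m i j : Fin n) :
    pderiv m (fun q => g q i j) p = pderiv m (fun q => g q j i) p :=
  pderiv_congr m (hg.symm.mono fun _ h => h.apply _ _)

theorem christoffel_symm (hg : IsMetricAt g p) (k i j : Fin n) :
    christoffel g p k i j = christoffel g p k j i := by
  unfold christoffel
  congr 1
  refine Finset.sum_congr rfl fun m _ => ?_
  rw [hg.pderiv_symm m i j]
  ring

/-- Lowering the upper index of the Christoffel symbols. -/
theorem sum_mul_christoffel (hg : IsMetricAt g p) (l i j : Fin n) :
    ∑ k, g p l k * christoffel g p k i j = (1 / 2) * (pderiv i (fun q => g q l j) p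
      + pderiv j (fun q => g q l i) p - pderiv l (fun q => g q i j) p) := by
  unfold christoffel
  have hu : IsUnit (g p).det := hg.det_ne.self_of_nhds.isUnit
  set v : Fin n → ℝ := fun m =>
    pderiv i (fun q => g q m j) p + pderiv j (fun q => g q m i) p - pderiv m (fun q => g q i j) p
  have : (g p).mulVec ((g p)⁻¹.mulVec v) = v := by
    rw [Matrix.mulVec_mulVec, Matrix.mul_nonsing_inv _ hu, Matrix.one_mulVec]
  have h2 := congrFun this l
  simp only [Matrix.mulVec, dotProduct] at h2
  calc _ = (1 / 2) * ∑ k, g p l k * ∑ m, (g p)⁻¹ k m * v m := by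
        rw [Finset.mul_sum]; refine Finset.sum_congr rfl fun k _ => ?_; ring
    _ = _ := by rw [h2]

/-- The Levi-Civita connection is metric. -/
theorem pderiv_eq (hg : IsMetricAt g p) (m i j : Fin n) :
    pderiv m (fun q => g q i j) p =
      ∑ k, g p i k * christoffel g p k m j + ∑ k, g p j k * christoffel g p k m i := by
  rw [hg.sum_mul_christoffel, hg.sum_mul_christoffel, hg.pderiv_symm m j i,
    hg.pderiv_symm i j m, hg.pderiv_symm j m i]
  ring

end IsMetricAt

/-- The matrix `(Γ_i)^k_l = Γ^k_{il}`. -/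
noncomputable def christoffelMatrix (g : EuclideanSpace ℝ (Fin n) → Matrix (Fin n) (Fin n) ℝ)
    (i : Fin n) (p : EuclideanSpace ℝ (Fin n)) : Matrix (Fin n) (Fin n) ℝ :=
  Matrix.of fun k l => christoffel g p k i l

/-- The matrix `(R_{ij})^k_l = R^k_{lij}`. -/
noncomputable def riemannUpMatrix (g : EuclideanSpace ℝ (Fin n) → Matrix (Fin n) (Fin n) ℝ)
    (i j : Fin n) (p : EuclideanSpace ℝ (Fin n)) : Matrix (Fin n) (Fin n) ℝ :=
  Matrix.of fun k l => riemannUp g p k l i j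

/-- The matrix `(R_{ij})_{kl} = R_{klij}`. -/
noncomputable def riemannMatrix (g : EuclideanSpace ℝ (Fin n) → Matrix (Fin n) (Fin n) ℝ)
    (i j : Fin n) (p : EuclideanSpace ℝ (Fin n)) : Matrix (Fin n) (Fin n) ℝ :=
  Matrix.of fun k l => riemann g p k l i j

/-- The entrywise partial derivative of a matrix-valued function. -/
noncomputable def pderivMatrix (i : Fin n) (A : EuclideanSpace ℝ (Fin n) → Matrix (Fin n) (Fin n) ℝ)
    (p : EuclideanSpace ℝ (Fin n)) : Matrix (Fin n) (Fin n) ℝ :=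
  Matrix.of fun k l => pderiv i (fun q => A q k l) p

section Matrix

variable {A B : EuclideanSpace ℝ (Fin n) → Matrix (Fin n) (Fin n) ℝ}

theorem pderivMatrix_congr (i : Fin n) (h : A =ᶠ[𝓝 p] B) :
    pderivMatrix i A p = pderivMatrix i B p := by
  ext k l
  exact pderiv_congr i (h.mono fun q hq => by simp only [hq])

theorem pderivMatrix_add (i : Fin n) (hA : SmoothEntriesAt A p) (hB : SmoothEntriesAt B p) :
    pderivMatrix i (fun q => A q + B q) p = pderivMatrix i A p + pderivMatrix i B p := by
  ext k l
  exact pderiv_add i (hA k l).differentiableAt_infty (hB k l).differentiableAt_infty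

theorem pderivMatrix_sub (i : Fin n) (hA : SmoothEntriesAt A p) (hB : SmoothEntriesAt B p) :
    pderivMatrix i (fun q => A q - B q) p = pderivMatrix i A p - pderivMatrix i B p := by
  ext k l
  exact pderiv_sub i (hA k l).differentiableAt_infty (hB k l).differentiableAt_infty

theorem pderivMatrix_mul (i : Fin n) (hA : SmoothEntriesAt A p) (hB : SmoothEntriesAt B p) :
    pderivMatrix i (fun q => A q * B q) p =
      pderivMatrix i A p * B p + A p * pderivMatrix i B p := by
  ext k l
  simp only [pderivMatrix, Matrix.of_apply, Matrix.add_apply, Matrix.mul_apply]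
  rw [pderiv_sum _ _ fun a _ =>
    (hA k a).differentiableAt_infty.fun_mul (hB a l).differentiableAt_infty,
    ← Finset.sum_add_distrib]
  exact Finset.sum_congr rfl fun a _ =>
    pderiv_mul i (hA k a).differentiableAt_infty (hB a l).differentiableAt_infty

theorem pderivMatrix_transpose (i : Fin n) :
    pderivMatrix i (fun q => (A q).transpose) p = (pderivMatrix i A p).transpose := rfl

theorem SmoothEntriesAt.sub (hA : SmoothEntriesAt A p) (hB : SmoothEntriesAt B p) :
    SmoothEntriesAt (fun q => A q - B q) p := fun k l => (hA k l).sub (hB k l)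

theorem SmoothEntriesAt.mul (hA : SmoothEntriesAt A p) (hB : SmoothEntriesAt B p) :
    SmoothEntriesAt (fun q => A q * B q) p := fun k l => by
  simp only [Matrix.mul_apply]
  exact ContDiffAt.sum fun a _ => (hA k a).mul (hB a l)

theorem SmoothEntriesAt.transpose (hA : SmoothEntriesAt A p) :
    SmoothEntriesAt (fun q => (A q).transpose) p := fun k l => hA l k

theorem SmoothEntriesAt.pderivMatrix (hA : SmoothEntriesAt A p) (i : Fin n) :
    SmoothEntriesAt (pderivMatrix i A) p := fun k l => (hA k l).pderiv i

theorem pderivMatrix_comm (hA : SmoothEntriesAt A p) (i j : Fin n) :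
    pderivMatrix i (pderivMatrix j A) p = pderivMatrix j (pderivMatrix i A) p := by
  ext k l
  exact pderiv_comm (hA k l) i j

end Matrix

/-! ### Symmetries of the curvature tensor and the Bianchi identities, in matrix form. -/

namespace IsMetricAt

theorem smooth_christoffelMatrix (hg : IsMetricAt g p) (i : Fin n) :
    SmoothEntriesAt (christoffelMatrix g i) p := fun k l => hg.christoffel_contDiffAt k i l

theorem smooth_riemannUpMatrix (hg : IsMetricAt g p) (i j : Fin n) :
    SmoothEntriesAt (riemannUpMatrix g i j) p := fun k l => hg.riemannUp_contDiffAt k l i j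

/-- Curvature as dΓ + Γ ∧ Γ for the matrix-valued connection form: it reduces the identities below
to noncommutative algebra. -/
theorem riemannUpMatrix_eq (i j : Fin n) (p : EuclideanSpace ℝ (Fin n)) :
    riemannUpMatrix g i j p = pderivMatrix i (christoffelMatrix g j) p
      - pderivMatrix j (christoffelMatrix g i) p
      + (christoffelMatrix g i p * christoffelMatrix g j p
        - christoffelMatrix g j p * christoffelMatrix g i p) := by
  ext k l
  simp [riemannUpMatrix, riemannUp, pderivMatrix, christoffelMatrix, Matrix.mul_apply]

theorem riemannMatrix_eq (i j : Fin n) (p : EuclideanSpace ℝ (Fin n)) :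
    riemannMatrix g i j p = g p * riemannUpMatrix g i j p := by
  ext k l
  simp [riemannMatrix, riemann, riemannUpMatrix, Matrix.mul_apply]

theorem pderivMatrix_eq (hg : IsMetricAt g p) (m : Fin n) :
    pderivMatrix m g p =
      g p * christoffelMatrix g m p + (christoffelMatrix g m p).transpose * g p := by
  ext i j
  simp only [pderivMatrix, Matrix.of_apply, hg.pderiv_eq, Matrix.add_apply, Matrix.mul_apply,
    christoffelMatrix, Matrix.transpose_apply]
  congr 1
  refine Finset.sum_congr rfl fun k _ => ?_
  rw [hg.symm.self_of_nhds.apply j k, mul_comm]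

/-- The second Bianchi identity for the curvature operator. -/
theorem bianchi_up (hg : IsMetricAt g p) (m i j : Fin n) :
    (pderivMatrix m (riemannUpMatrix g i j) p + (christoffelMatrix g m p * riemannUpMatrix g i j p
        - riemannUpMatrix g i j p * christoffelMatrix g m p))
    + (pderivMatrix i (riemannUpMatrix g j m) p + (christoffelMatrix g i p * riemannUpMatrix g j m p
        - riemannUpMatrix g j m p * christoffelMatrix g i p))
    + (pderivMatrix j (riemannUpMatrix g m i) p + (christoffelMatrix g j p * riemannUpMatrix g m i p
        - riemannUpMatrix g m i p * christoffelMatrix g j p)) = 0 := by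
  have hG := hg.smooth_christoffelMatrix
  have hd : ∀ m i j : Fin n, pderivMatrix m (riemannUpMatrix g i j) p =
      pderivMatrix m (pderivMatrix i (christoffelMatrix g j)) p
      - pderivMatrix m (pderivMatrix j (christoffelMatrix g i)) p
      + ((pderivMatrix m (christoffelMatrix g i) p * christoffelMatrix g j p
          + christoffelMatrix g i p * pderivMatrix m (christoffelMatrix g j) p)
        - (pderivMatrix m (christoffelMatrix g j) p * christoffelMatrix g i p
          + christoffelMatrix g j p * pderivMatrix m (christoffelMatrix g i) p)) := by
    intro m i j
    have hfun : riemannUpMatrix g i j = fun q => (pderivMatrix i (christoffelMatrix g j) q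
      - pderivMatrix j (christoffelMatrix g i) q)
      + (christoffelMatrix g i q * christoffelMatrix g j q
        - christoffelMatrix g j q * christoffelMatrix g i q) :=
      funext fun q => riemannUpMatrix_eq i j q
    rw [hfun, pderivMatrix_add m (((hG j).pderivMatrix i).sub ((hG i).pderivMatrix j))
        (((hG i).mul (hG j)).sub ((hG j).mul (hG i))),
      pderivMatrix_sub m ((hG j).pderivMatrix i) ((hG i).pderivMatrix j),
      pderivMatrix_sub m ((hG i).mul (hG j)) ((hG j).mul (hG i)),
      pderivMatrix_mul m (hG i) (hG j), pderivMatrix_mul m (hG j) (hG i)]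
  -- Once the second derivatives of Γ are commuted they cancel in pairs; the cubic terms cancel by
  -- the Jacobi identity for matrix commutators.
  rw [hd m i j, hd i j m, hd j m i, riemannUpMatrix_eq i j, riemannUpMatrix_eq j m,
    riemannUpMatrix_eq m i, pderivMatrix_comm (hG j) m i, pderivMatrix_comm (hG m) i j,
    pderivMatrix_comm (hG i) j m]
  noncomm_ring

/-- The second Bianchi identity for the curvature tensor with all indices down; the covariant
derivatives act on the first pair of indices only. -/
theorem bianchi (hg : IsMetricAt g p) (m i j : Fin n) :
    pderivMatrix m (riemannMatrix g i j) p + pderivMatrix i (riemannMatrix g j m) p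
      + pderivMatrix j (riemannMatrix g m i) p
    = ((christoffelMatrix g m p).transpose * riemannMatrix g i j p
        + riemannMatrix g i j p * christoffelMatrix g m p)
      + ((christoffelMatrix g i p).transpose * riemannMatrix g j m p
        + riemannMatrix g j m p * christoffelMatrix g i p)
      + ((christoffelMatrix g j p).transpose * riemannMatrix g m i p
        + riemannMatrix g m i p * christoffelMatrix g j p) := by
  have hd : ∀ m i j : Fin n, pderivMatrix m (riemannMatrix g i j) p =
      (g p * christoffelMatrix g m p + (christoffelMatrix g m p).transpose * g p)
        * riemannUpMatrix g i j p + g p * pderivMatrix m (riemannUpMatrix g i j) p := by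
    intro m i j
    have hfun : riemannMatrix g i j = fun q => g q * riemannUpMatrix g i j q :=
      funext fun q => riemannMatrix_eq i j q
    rw [hfun, pderivMatrix_mul m hg.contDiffAt (hg.smooth_riemannUpMatrix i j), hg.pderivMatrix_eq]
  have hb := congrArg (fun A => g p * A) (hg.bianchi_up m i j)
  simp only [mul_zero] at hb
  rw [hd, hd, hd, riemannMatrix_eq, riemannMatrix_eq, riemannMatrix_eq, ← sub_eq_zero, ← hb]
  noncomm_ring

theorem riemann_antisymm_right (k l i j : Fin n) :
    riemann g p k l i j = - riemann g p k l j i := by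
  simp only [riemann, riemannUp, ← Finset.sum_neg_distrib]
  refine Finset.sum_congr rfl fun m _ => ?_
  rw [← mul_neg, neg_add, ← Finset.sum_neg_distrib]
  congr 2
  · ring
  · exact Finset.sum_congr rfl fun a _ => by ring

/-- The commutator of second derivatives annihilates g: inserting ∂g = gΓ + Γᵀg twice into ∂_i∂_j g
= ∂_j∂_i g leaves gR + (gR)ᵀ = 0. -/
theorem riemann_antisymm_left (hg : IsMetricAt g p) (k l i j : Fin n) :
    riemann g p k l i j = - riemann g p l k i j := by
  have hG := hg.smooth_christoffelMatrix
  have hd : ∀ i j : Fin n, pderivMatrix i (pderivMatrix j g) p =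
      ((g p * christoffelMatrix g i p + (christoffelMatrix g i p).transpose * g p)
          * christoffelMatrix g j p + g p * pderivMatrix i (christoffelMatrix g j) p)
        + ((pderivMatrix i (christoffelMatrix g j) p).transpose * g p
          + (christoffelMatrix g j p).transpose *
            (g p * christoffelMatrix g i p + (christoffelMatrix g i p).transpose * g p)) := by
    intro i j
    rw [pderivMatrix_congr i (hg.eventually.mono fun q hq => hq.pderivMatrix_eq j),
      pderivMatrix_add i (SmoothEntriesAt.mul hg.contDiffAt (hG j))
        ((hG j).transpose.mul hg.contDiffAt),
      pderivMatrix_mul i hg.contDiffAt (hG j),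
      pderivMatrix_mul i (hG j).transpose hg.contDiffAt, pderivMatrix_transpose,
      hg.pderivMatrix_eq]
  have hc := pderivMatrix_comm hg.contDiffAt i j
  rw [hd, hd] at hc
  have hs : (g p).transpose = g p := hg.symm.self_of_nhds
  have key : riemannMatrix g i j p + (riemannMatrix g i j p).transpose = 0 := by
    rw [riemannMatrix_eq, riemannUpMatrix_eq]
    simp only [Matrix.transpose_mul, Matrix.transpose_add, Matrix.transpose_sub, hs]
    rw [← sub_eq_zero] at hc
    rw [← hc]
    noncomm_ring
  have := congrFun (congrFun key k) l
  simp only [riemannMatrix, Matrix.add_apply, Matrix.transpose_apply, Matrix.of_apply,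
    Matrix.zero_apply] at this
  linarith

/-- The first Bianchi identity. -/
theorem riemann_cyclic (hg : IsMetricAt g p) (k l i j : Fin n) :
    riemann g p k l i j + riemann g p k i j l + riemann g p k j l i = 0 := by
  simp only [riemann, ← Finset.sum_add_distrib, ← mul_add]
  refine Finset.sum_eq_zero fun m _ => ?_
  have hs : ∀ a b c : Fin n, pderiv a (fun q => christoffel g q m b c) p =
      pderiv a (fun q => christoffel g q m c b) p := fun a b c =>
    pderiv_congr a (hg.eventually.mono fun q hq => hq.christoffel_symm m b c)
  have : riemannUp g p m l i j + riemannUp g p m i j l + riemannUp g p m j l i = 0 := by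
    unfold riemannUp
    rw [hs i j l, hs j i l, hs l i j]
    refine (show ∀ a b c s t u : ℝ, s + t + u = 0 →
        (a - b + s) + (b - c + t) + (c - a + u) = 0 from
        fun a b c s t u h => by linarith) _ _ _ _ _ _ ?_
    rw [← Finset.sum_add_distrib, ← Finset.sum_add_distrib]
    refine Finset.sum_eq_zero fun a _ => ?_
    rw [hg.christoffel_symm a j l, hg.christoffel_symm a i l, hg.christoffel_symm a i j]
    ring
  rw [this, mul_zero]

/-- The octahedron argument: the four cyclic identities, one for each choice of first index, combine
linearly modulo the antisymmetries. -/
theorem riemann_pair_symm (hg : IsMetricAt g p) (k l i j : Fin n) :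
    riemann g p k l i j = riemann g p i j k l := by
  have a := hg.riemann_antisymm_left
  have b := fun k l i j => riemann_antisymm_right (g := g) (p := p) k l i j
  have c := hg.riemann_cyclic
  linarith [c k l i j, c l i j k, c i j k l, c j k l i, a l i j k, a l j k i, a l k i j, a i j k l,
    a i k l j, a j k l i, a j l i k, a j i k l, a k i j l, a j l k i, b i l j k, b k i l j,
    b k j l i, b l j i k, b k i j l, b i k j l, b j l k i, b l j k i]

end IsMetricAt

end CoordinateCalculus

/-! ### The Weyl tensor of an Einstein spacetime. -/

section Spacetime

variable {g : EuclideanSpace ℝ (Fin 4) → Matrix (Fin 4) (Fin 4) ℝ}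
  {U : Set (EuclideanSpace ℝ (Fin 4))} {Λ : ℝ} {p : EuclideanSpace ℝ (Fin 4)}

theorem IsLorentzian.det_neg {G : Matrix (Fin 4) (Fin 4) ℝ} (h : IsLorentzian G) : G.det < 0 := by
  obtain ⟨P, hP, h⟩ := h
  have h1 := congrArg Matrix.det h
  rw [Matrix.det_mul, Matrix.det_mul, Matrix.det_transpose, Matrix.det_diagonal] at h1
  simp [Fin.prod_univ_four] at h1
  have h2 : 0 < P.det ^ 2 := by have := hP.ne_zero; positivity
  nlinarith

theorem IsLorentzianMetricOn.isMetricAt (hg : IsLorentzianMetricOn g U) (hp : p ∈ U) :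
    IsMetricAt g p where
  smooth := by
    filter_upwards [hg.isOpen.mem_nhds hp] with q hq i j
    exact (hg.smooth i j).contDiffAt (hg.isOpen.mem_nhds hq)
  symm := by filter_upwards [hg.isOpen.mem_nhds hp] with q hq using hg.symm q hq
  det_ne := by
    filter_upwards [hg.isOpen.mem_nhds hp] with q hq using (hg.lorentzian q hq).det_neg.ne

theorem sum_inv_mul_self {n : ℕ} {G : Matrix (Fin n) (Fin n) ℝ} (hd : G.det ≠ 0) (hs : G.IsSymm) :
    ∑ i, ∑ j, G⁻¹ i j * G i j = n := by
  have : ∀ i, ∑ j, G⁻¹ i j * G i j = 1 := fun i => by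
    calc _ = (G⁻¹ * G) i i := by
          rw [Matrix.mul_apply]
          exact Finset.sum_congr rfl fun j _ => by rw [hs.apply j i]
      _ = 1 := by rw [Matrix.nonsing_inv_mul _ hd.isUnit, Matrix.one_apply_eq]
  simp [this]

/-- Trace of the field equations in dimension four: R - 2R + 4Λ = 0. -/
theorem IsEinsteinVacuumOn.scalarCurv_eq (hg : IsLorentzianMetricOn g U)
    (hE : IsEinsteinVacuumOn Λ g U) (hp : p ∈ U) : scalarCurv g p = 4 * Λ := by
  have h := hE p hp
  have hm := hg.isMetricAt hp
  have ht := sum_inv_mul_self hm.det_ne.self_of_nhds hm.symm.self_of_nhds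
  have hR : scalarCurv g p = ∑ i, ∑ j, (g p)⁻¹ i j * ricci g p i j := rfl
  have h2 : ∑ i, ∑ j, (g p)⁻¹ i j * ricci g p i j =
      ((1 / 2) * scalarCurv g p - Λ) * ∑ i, ∑ j, (g p)⁻¹ i j * g p i j := by
    rw [Finset.mul_sum]
    refine Finset.sum_congr rfl fun i _ => ?_
    rw [Finset.mul_sum]
    refine Finset.sum_congr rfl fun j _ => ?_
    linear_combination (g p)⁻¹ i j * h i j
  rw [← hR, ht] at h2
  push_cast at h2
  linarith

theorem IsEinsteinVacuumOn.ricci_eq (hg : IsLorentzianMetricOn g U)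
    (hE : IsEinsteinVacuumOn Λ g U) (hp : p ∈ U) (μ ν : Fin 4) :
    ricci g p μ ν = Λ * g p μ ν := by
  have h := hE p hp μ ν
  rw [hE.scalarCurv_eq hg hp] at h
  linarith

/-- For Ric = Λg and R = 4Λ every trace term is a multiple of one tensor built from g alone, which
is parallel. Hence the Weyl tensor inherits the differential Bianchi identity of the curvature. -/
theorem weyl_eq (hg : IsLorentzianMetricOn g U) (hE : IsEinsteinVacuumOn Λ g U) (hp : p ∈ U)
    (α β μ ν : Fin 4) : weyl g p α β μ ν =
      riemann g p α β μ ν - Λ / 3 * (g p α μ * g p β ν - g p α ν * g p β μ) := by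
  have hs := (hg.symm p hp).apply
  unfold weyl
  simp only [hE.ricci_eq hg hp, hE.scalarCurv_eq hg hp]
  rw [hs ν β, hs μ β, hs ν α, hs μ α]
  ring

/-- The algebraic and differential properties of the Weyl tensor of a vacuum spacetime. -/
structure IsWeylFieldAt (g : EuclideanSpace ℝ (Fin 4) → Matrix (Fin 4) (Fin 4) ℝ)
    (p : EuclideanSpace ℝ (Fin 4)) : Prop where
  smooth : ∀ α β μ ν, ContDiffAt ℝ ∞ (fun q => weyl g q α β μ ν) p
  antisymm_left : ∀ α β μ ν, weyl g p α β μ ν = - weyl g p β α μ ν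
  antisymm_right : ∀ α β μ ν, weyl g p α β μ ν = - weyl g p α β ν μ
  pair_symm : ∀ α β μ ν, weyl g p α β μ ν = weyl g p μ ν α β
  cyclic : ∀ α β μ ν, weyl g p α β μ ν + weyl g p α μ ν β + weyl g p α ν β μ = 0
  trace : ∀ β δ, ∑ α, ∑ γ, (g p)⁻¹ α γ * weyl g p α β γ δ = 0
  bianchi : ∀ k l m i j, pderiv m (fun q => weyl g q k l i j) p
      + pderiv i (fun q => weyl g q k l j m) p + pderiv j (fun q => weyl g q k l m i) p
    = (∑ a, christoffel g p a m k * weyl g p a l i j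
        + ∑ a, weyl g p k a i j * christoffel g p a m l)
      + (∑ a, christoffel g p a i k * weyl g p a l j m
        + ∑ a, weyl g p k a j m * christoffel g p a i l)
      + (∑ a, christoffel g p a j k * weyl g p a l m i
        + ∑ a, weyl g p k a m i * christoffel g p a j l)

theorem sum_inv_mul_riemann (hg : IsMetricAt g p) (β δ : Fin 4) :
    ∑ α, ∑ γ, (g p)⁻¹ α γ * riemann g p α β γ δ = ricci g p β δ := by
  unfold riemann ricci
  rw [Finset.sum_comm]
  refine Finset.sum_congr rfl fun γ _ => ?_
  have hs := hg.symm.self_of_nhds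
  have hi : ((g p)⁻¹).IsSymm := by
    rw [Matrix.IsSymm, Matrix.transpose_nonsing_inv, hs]
  have : (g p)⁻¹.mulVec ((g p).mulVec fun m => riemannUp g p m β γ δ) =
      fun m => riemannUp g p m β γ δ := by
    rw [Matrix.mulVec_mulVec, Matrix.nonsing_inv_mul _ hg.det_ne.self_of_nhds.isUnit,
      Matrix.one_mulVec]
  have h2 := congrFun this γ
  simp only [Matrix.mulVec, dotProduct] at h2
  rw [← h2]
  exact Finset.sum_congr rfl fun α _ => by rw [hi.apply γ α]

/-- Each property holds for the Riemann tensor and for the parallel tensor g ∧ g separately, except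
tracelessness, where Λg cancels (Λ/3)(4g - g). -/
theorem IsLorentzianMetricOn.isWeylFieldAt (hg : IsLorentzianMetricOn g U)
    (hE : IsEinsteinVacuumOn Λ g U) (hp : p ∈ U) : IsWeylFieldAt g p := by
  have hm := hg.isMetricAt hp
  have hs := (hg.symm p hp).apply
  have hev : ∀ α β μ ν, (fun q => weyl g q α β μ ν) =ᶠ[𝓝 p] fun q =>
      riemann g q α β μ ν - Λ / 3 * (g q α μ * g q β ν - g q α ν * g q β μ) := by
    intro α β μ ν
    filter_upwards [hg.isOpen.mem_nhds hp] with q hq using weyl_eq hg hE hq α β μ ν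
  have hC : ∀ α β μ ν, ContDiffAt ℝ ∞ (fun q => g q α μ * g q β ν - g q α ν * g q β μ) p :=
    fun α β μ ν => ((hm.contDiffAt _ _).mul (hm.contDiffAt _ _)).sub
      ((hm.contDiffAt _ _).mul (hm.contDiffAt _ _))
  refine ⟨?_, ?_, ?_, ?_, ?_, ?_, ?_⟩
  · intro α β μ ν
    exact ((hm.riemann_contDiffAt _ _ _ _).sub (contDiffAt_const.mul (hC α β μ ν))).congr_of_eventuallyEq
      (hev α β μ ν)
  · intro α β μ ν
    rw [weyl_eq hg hE hp, weyl_eq hg hE hp, hm.riemann_antisymm_left α β]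
    ring
  · intro α β μ ν
    rw [weyl_eq hg hE hp, weyl_eq hg hE hp, IsMetricAt.riemann_antisymm_right α β]
    ring
  · intro α β μ ν
    rw [weyl_eq hg hE hp, weyl_eq hg hE hp, hm.riemann_pair_symm α β, hs μ α, hs ν β, hs μ β, hs ν α]
    ring
  · intro α β μ ν
    rw [weyl_eq hg hE hp, weyl_eq hg hE hp, weyl_eq hg hE hp]
    linear_combination hm.riemann_cyclic α β μ ν + Λ / 3 * (g p α μ * hs β ν
      + g p α ν * hs μ β + g p α β * hs ν μ)
  · intro β δ
    have hdu := hm.det_ne.self_of_nhds.isUnit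
    have hI : ∀ i j, ∑ k, (g p)⁻¹ i k * g p k j = if i = j then 1 else 0 := fun i j => by
      have := congrFun (congrFun (Matrix.nonsing_inv_mul _ hdu) i) j
      rwa [Matrix.mul_apply, Matrix.one_apply] at this
    have h1 : ∑ α, ∑ γ, (g p)⁻¹ α γ * (g p α γ * g p β δ) = 4 * g p β δ := by
      have := sum_inv_mul_self hm.det_ne.self_of_nhds hm.symm.self_of_nhds
      rw [show (4 : ℝ) = ((4 : ℕ) : ℝ) by norm_num, ← this]
      simp only [Finset.sum_mul, mul_assoc]
    have h2 : ∑ α, ∑ γ, (g p)⁻¹ α γ * (g p α δ * g p β γ) = g p β δ := by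
      have : ∀ α, ∑ γ, (g p)⁻¹ α γ * (g p α δ * g p β γ) = g p α δ * if α = β then 1 else 0 := by
        intro α
        rw [← hI, Finset.mul_sum]
        exact Finset.sum_congr rfl fun γ _ => by rw [hs γ β]; ring
      simp [this]
    calc _ = ∑ α, ∑ γ, (g p)⁻¹ α γ * riemann g p α β γ δ
          - Λ / 3 * (∑ α, ∑ γ, (g p)⁻¹ α γ * (g p α γ * g p β δ)
            - ∑ α, ∑ γ, (g p)⁻¹ α γ * (g p α δ * g p β γ)) := by
          simp only [Finset.mul_sum, ← Finset.sum_sub_distrib]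
          refine Finset.sum_congr rfl fun α _ => Finset.sum_congr rfl fun γ _ => ?_
          rw [weyl_eq hg hE hp]
          ring
      _ = 0 := by
          rw [sum_inv_mul_riemann hm, hE.ricci_eq hg hp, h1, h2]
          ring
  · intro k l m i j
    have hR := congrFun (congrFun (hm.bianchi m i j) k) l
    simp only [Matrix.add_apply, Matrix.mul_apply, pderivMatrix, riemannMatrix, Matrix.of_apply,
      christoffelMatrix, Matrix.transpose_apply] at hR
    -- The Christoffel symbols with upper index lowered, Γ_{i,mk}. Derivatives of g and all
    -- Christoffel terms on the metric part are expressed through them, and the metric part then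
    -- cancels by their symmetry in m and k.
    set a : Fin 4 → Fin 4 → Fin 4 → ℝ := fun m k i => ∑ b, g p i b * christoffel g p b m k with ha
    have hasymm : ∀ m k i, a m k i = a k m i := fun m k i =>
      Finset.sum_congr rfl fun b _ => by rw [hm.christoffel_symm]
    have hdg : ∀ m i j, pderiv m (fun q => g q i j) p = a m j i + a m i j := hm.pderiv_eq
    have hdC : ∀ m α β μ ν, pderiv m (fun q => weyl g q α β μ ν) p =
        pderiv m (fun q => riemann g q α β μ ν) p - Λ / 3 *
          (((a m μ α + a m α μ) * g p β ν + g p α μ * (a m ν β + a m β ν))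
          - ((a m ν α + a m α ν) * g p β μ + g p α ν * (a m μ β + a m β μ))) := by
      intro m α β μ ν
      have d := fun i j => (hm.contDiffAt i j).differentiableAt_infty
      rw [pderiv_congr m (hev α β μ ν), pderiv_sub m
        (hm.riemann_contDiffAt _ _ _ _).differentiableAt_infty
        ((hC α β μ ν).differentiableAt_infty.const_mul _),
        pderiv_const_mul m _ (hC α β μ ν).differentiableAt_infty,
        pderiv_sub m ((d _ _).fun_mul (d _ _)) ((d _ _).fun_mul (d _ _)),
        pderiv_mul m (d _ _) (d _ _), pderiv_mul m (d _ _) (d _ _)]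
      simp only [hdg]
    have hL : ∀ m i j, ∑ b, christoffel g p b m k * weyl g p b l i j =
        ∑ b, christoffel g p b m k * riemann g p b l i j
          - Λ / 3 * (a m k i * g p l j - a m k j * g p l i) := by
      intro m i j
      simp only [ha, Finset.sum_mul, ← Finset.sum_sub_distrib, Finset.mul_sum]
      refine Finset.sum_congr rfl fun b _ => ?_
      rw [weyl_eq hg hE hp, hs b i, hs b j]
      ring
    have hRt : ∀ m i j, ∑ b, weyl g p k b i j * christoffel g p b m l =
        ∑ b, riemann g p k b i j * christoffel g p b m l
          - Λ / 3 * (g p k i * a m l j - g p k j * a m l i) := by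
      intro m i j
      simp only [ha, Finset.mul_sum, ← Finset.sum_sub_distrib]
      refine Finset.sum_congr rfl fun b _ => ?_
      rw [weyl_eq hg hE hp, hs b i, hs b j]
      ring
    simp only [hdC, hL, hRt]
    rw [hasymm i j k, hasymm i j l, hasymm j m k, hasymm j m l, hasymm m i k, hasymm m i l]
    linear_combination hR

end Spacetime

/-! ### Geometry of the slice: unit normal, second fundamental form, Gauss formula. -/

section Slice

/-- The embedding of the slice `t = 0`, as a continuous linear map. -/
noncomputable def slicePtL : EuclideanSpace ℝ (Fin 3) →L[ℝ] EuclideanSpace ℝ (Fin 4) :=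
  LinearMap.toContinuousLinearMap
    { toFun := slicePt
      map_add' := fun x y => by
        ext i
        refine Fin.cases ?_ (fun j => ?_) i <;> simp [slicePt]
      map_smul' := fun c x => by
        ext i
        refine Fin.cases ?_ (fun j => ?_) i <;> simp [slicePt] }

theorem slicePtL_apply (x : EuclideanSpace ℝ (Fin 3)) : slicePtL x = slicePt x := rfl

theorem slicePt_single (i : Fin 3) :
    slicePt (EuclideanSpace.single i 1) = EuclideanSpace.single i.succ 1 := by
  ext j
  refine Fin.cases ?_ (fun k => ?_) j <;> simp [slicePt]

theorem contDiff_slicePt : ContDiff ℝ ∞ slicePt := slicePtL.contDiff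

theorem continuous_slicePt : Continuous slicePt := slicePtL.continuous

theorem pderiv_comp_slicePt {f : EuclideanSpace ℝ (Fin 4) → ℝ} {x : EuclideanSpace ℝ (Fin 3)}
    (hf : DifferentiableAt ℝ f (slicePt x)) (i : Fin 3) :
    pderiv i (fun y => f (slicePt y)) x = pderiv i.succ f (slicePt x) := by
  have h : HasFDerivAt (fun y => f (slicePt y)) ((fderiv ℝ f (slicePt x)).comp slicePtL) x :=
    hf.hasFDerivAt.comp x slicePtL.hasFDerivAt
  unfold pderiv
  rw [h.fderiv, ContinuousLinearMap.comp_apply, slicePtL_apply, slicePt_single]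

variable {g : EuclideanSpace ℝ (Fin 4) → Matrix (Fin 4) (Fin 4) ℝ}
  {p : EuclideanSpace ℝ (Fin 4)} {x : EuclideanSpace ℝ (Fin 3)}

/-- `g` is a smooth metric near the point `(0, x)` of the slice, with `det g < 0` there, and the
slice is spacelike near `x`. -/
structure IsSpacelikeAt (g : EuclideanSpace ℝ (Fin 4) → Matrix (Fin 4) (Fin 4) ℝ)
    (x : EuclideanSpace ℝ (Fin 3)) : Prop where
  metric : IsMetricAt g (slicePt x)
  det_neg : (g (slicePt x)).det < 0
  posDef : ∀ᶠ y in 𝓝 x, (inducedMetric g y).PosDef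

/-- The components `(∇_i n)_μ` of the derivative of the unit normal. -/
noncomputable def nablaNormal (g : EuclideanSpace ℝ (Fin 4) → Matrix (Fin 4) (Fin 4) ℝ)
    (p : EuclideanSpace ℝ (Fin 4)) (i μ : Fin 4) : ℝ :=
  pderiv i (fun q => normalDown g q μ) p - ∑ κ, christoffel g p κ i μ * normalDown g p κ

namespace IsSpacelikeAt

/-- Cramer's rule: the (0,0) cofactor of g is det γ. As det g < 0 this makes g^{00} negative, so
that the square root in the lapse is the genuine one and not the default value 0. -/
theorem inv_zero_zero (x : EuclideanSpace ℝ (Fin 3)) :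
    (g (slicePt x))⁻¹ 0 0 = (inducedMetric g x).det / (g (slicePt x)).det := by
  rw [Matrix.inv_def, Matrix.smul_apply, Matrix.adjugate_fin_succ_eq_det_submatrix]
  simp only [Ring.inverse_eq_inv', smul_eq_mul, Fin.succAbove_zero, Fin.val_zero, add_zero,
    pow_zero, one_mul, div_eq_inv_mul]
  rfl

theorem det_induced_pos (h : IsSpacelikeAt g x) : 0 < (inducedMetric g x).det :=
  h.posDef.self_of_nhds.det_pos

theorem inv_zero_zero_neg (h : IsSpacelikeAt g x) : (g (slicePt x))⁻¹ 0 0 < 0 := by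
  rw [inv_zero_zero]
  exact div_neg_of_pos_of_neg h.det_induced_pos h.det_neg

theorem eventually_inv_zero_zero_neg (h : IsSpacelikeAt g x) :
    ∀ᶠ q in 𝓝 (slicePt x), (g q)⁻¹ 0 0 < 0 :=
  (h.metric.inv_contDiffAt 0 0).continuousAt.eventually_lt continuousAt_const h.inv_zero_zero_neg

theorem lapse_sq_mul {q : EuclideanSpace ℝ (Fin 4)} (hq : (g q)⁻¹ 0 0 < 0) :
    lapse g q ^ 2 * (g q)⁻¹ 0 0 = -1 := by
  unfold lapse
  rw [div_pow, one_pow, Real.sq_sqrt (by linarith)]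
  have := hq.ne
  field_simp

theorem lapse_contDiffAt (h : IsSpacelikeAt g x) : ContDiffAt ℝ ∞ (lapse g) (slicePt x) := by
  unfold lapse
  have h0 := h.inv_zero_zero_neg
  exact contDiffAt_const.div (((h.metric.inv_contDiffAt 0 0).neg).sqrt (by linarith))
    (Real.sqrt_pos.2 (by linarith)).ne'

theorem normalDown_contDiffAt (h : IsSpacelikeAt g x) (μ : Fin 4) :
    ContDiffAt ℝ ∞ (fun q => normalDown g q μ) (slicePt x) := by
  unfold normalDown
  split_ifs
  · exact h.lapse_contDiffAt.neg
  · exact contDiffAt_const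

theorem normalUp_contDiffAt (h : IsSpacelikeAt g x) (μ : Fin 4) :
    ContDiffAt ℝ ∞ (fun q => normalUp g q μ) (slicePt x) := by
  unfold normalUp
  exact ContDiffAt.sum fun ν _ => (h.metric.inv_contDiffAt _ _).mul (h.normalDown_contDiffAt _)

theorem normalUp_eq (q : EuclideanSpace ℝ (Fin 4)) (μ : Fin 4) :
    normalUp g q μ = - lapse g q * (g q)⁻¹ μ 0 := by
  simp [normalUp, normalDown, mul_comm]

theorem inv_symm (hg : IsMetricAt g p) (μ ν : Fin 4) : (g p)⁻¹ μ ν = (g p)⁻¹ ν μ := by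
  have : ((g p)⁻¹).IsSymm := by
    rw [Matrix.IsSymm, Matrix.transpose_nonsing_inv, hg.symm.self_of_nhds]
  exact this.apply _ _

theorem sum_mul_normalUp (hg : IsMetricAt g p) (ν : Fin 4) :
    ∑ μ, g p ν μ * normalUp g p μ = normalDown g p ν := by
  have : (g p).mulVec ((g p)⁻¹.mulVec (normalDown g p)) = normalDown g p := by
    rw [Matrix.mulVec_mulVec, Matrix.mul_nonsing_inv _ hg.det_ne.self_of_nhds.isUnit,
      Matrix.one_mulVec]
  exact congrFun this ν

theorem sum_normalUp_mul_normalDown {q : EuclideanSpace ℝ (Fin 4)} (hq : (g q)⁻¹ 0 0 < 0) :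
    ∑ μ, normalUp g q μ * normalDown g q μ = -1 := by
  have := lapse_sq_mul hq
  simp only [normalUp_eq, normalDown, mul_ite, mul_zero, Finset.sum_ite_eq', Finset.mem_univ,
    if_true]
  linarith

/-- The decomposition `g^{μν} = γ^{μν} - n^μ n^ν` of the inverse metric: the `0`-components of
`g^{μν} + n^μ n^ν` vanish. -/
theorem inv_add_normal_zero (h : IsSpacelikeAt g x) (ν : Fin 4) :
    (g (slicePt x))⁻¹ 0 ν + normalUp g (slicePt x) 0 * normalUp g (slicePt x) ν = 0 := by
  rw [normalUp_eq, normalUp_eq, inv_symm h.metric ν 0]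
  linear_combination (g (slicePt x))⁻¹ 0 ν * lapse_sq_mul h.inv_zero_zero_neg

/-- The decomposition `g^{μν} = γ^{μν} - n^μ n^ν` of the inverse metric, spatial components. -/
theorem inv_induced (h : IsSpacelikeAt g x) (i j : Fin 3) :
    (inducedMetric g x)⁻¹ i j = (g (slicePt x))⁻¹ i.succ j.succ
      + normalUp g (slicePt x) i.succ * normalUp g (slicePt x) j.succ := by
  have hs := h.metric.symm.self_of_nhds.apply
  set H : Matrix (Fin 3) (Fin 3) ℝ := Matrix.of fun i j =>
    (g (slicePt x))⁻¹ i.succ j.succ + normalUp g (slicePt x) i.succ * normalUp g (slicePt x) j.succ with hH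
  have key : H * inducedMetric g x = 1 := by
    ext i j
    have h0 : ∀ μ : Fin 4, (g (slicePt x))⁻¹ μ 0 + normalUp g (slicePt x) μ * normalUp g (slicePt x) 0 = 0 := fun μ => by
      rw [inv_symm h.metric, mul_comm]; exact h.inv_add_normal_zero μ
    have e1 : ∑ μ, ((g (slicePt x))⁻¹ i.succ μ + normalUp g (slicePt x) i.succ * normalUp g (slicePt x) μ) * g (slicePt x) μ j.succ
        = (H * inducedMetric g x) i j := by
      rw [Fin.sum_univ_succ, h0, zero_mul, zero_add, Matrix.mul_apply]
      rfl
    have e2 : ∑ μ, (g (slicePt x))⁻¹ i.succ μ * g (slicePt x) μ j.succ = (1 : Matrix (Fin 4) (Fin 4) ℝ) i.succ j.succ := by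
      rw [← Matrix.mul_apply, Matrix.nonsing_inv_mul _ h.metric.det_ne.self_of_nhds.isUnit]
    have e3 : ∑ μ, normalUp g (slicePt x) μ * g (slicePt x) μ j.succ = 0 := by
      have := sum_mul_normalUp h.metric j.succ
      rw [show normalDown g (slicePt x) j.succ = 0 by simp [normalDown]] at this
      rw [← this]
      exact Finset.sum_congr rfl fun μ _ => by rw [mul_comm, hs j.succ μ]
    rw [← e1]
    simp only [add_mul, mul_assoc, Finset.sum_add_distrib, ← Finset.mul_sum]
    rw [e2, e3, mul_zero, add_zero, Matrix.one_apply, Matrix.one_apply]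
    simp
  rw [Matrix.inv_eq_left_inv key]
  rfl

/-- Every spacetime trace splits into a trace over the slice and a contraction with n, since the
projector g^{μν} + n^μ n^ν has only spatial components. -/
theorem sum_inv_mul (h : IsSpacelikeAt g x) (F : Fin 4 → Fin 4 → ℝ) :
    ∑ μ, ∑ ν, (g (slicePt x))⁻¹ μ ν * F μ ν =
      ∑ i, ∑ j, (inducedMetric g x)⁻¹ i j * F i.succ j.succ
      - ∑ μ, ∑ ν, normalUp g (slicePt x) μ * normalUp g (slicePt x) ν * F μ ν := by
  have h0 := h.inv_add_normal_zero
  have h0' : ∀ μ : Fin 4, (g (slicePt x))⁻¹ μ 0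
      + normalUp g (slicePt x) μ * normalUp g (slicePt x) 0 = 0 := fun μ => by
    rw [inv_symm h.metric, mul_comm]; exact h0 μ
  rw [eq_sub_iff_add_eq]
  simp only [← Finset.sum_add_distrib, ← add_mul]
  rw [Fin.sum_univ_succ]
  simp only [h0, zero_mul, Finset.sum_const_zero, zero_add]
  refine Finset.sum_congr rfl fun i _ => ?_
  rw [Fin.sum_univ_succ, h0', zero_mul, zero_add]
  exact Finset.sum_congr rfl fun j _ => by rw [h.inv_induced]

theorem extrinsicCurv_eq (x : EuclideanSpace ℝ (Fin 3)) (i j : Fin 3) :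
    extrinsicCurv g x i j = - nablaNormal g (slicePt x) i.succ j.succ := rfl

theorem extrinsicCurv_eq_sum (x : EuclideanSpace ℝ (Fin 3)) (i j : Fin 3) :
    extrinsicCurv g x i j =
      ∑ κ, christoffel g (slicePt x) κ i.succ j.succ * normalDown g (slicePt x) κ := by
  have : (fun q => normalDown g q j.succ) = fun _ => 0 := by
    funext q; simp [normalDown]
  rw [extrinsicCurv_eq, nablaNormal, this, pderiv_const]
  ring

/-- Lowering an index commutes with ∇: differentiate n_ν = g_{νμ} n^μ and use that the connection is
metric. -/
theorem lower_nablaNormal (h : IsSpacelikeAt g x) (i ν : Fin 4) :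
    ∑ μ, g (slicePt x) ν μ * (pderiv i (fun q => normalUp g q μ) (slicePt x)
      + ∑ κ, christoffel g (slicePt x) μ i κ * normalUp g (slicePt x) κ)
      = nablaNormal g (slicePt x) i ν := by
  have hs := h.metric.symm.self_of_nhds.apply
  have hn := fun μ => (h.normalUp_contDiffAt μ).differentiableAt_infty
  have hgd := fun a b => (h.metric.contDiffAt a b).differentiableAt_infty
  have h1 : pderiv i (fun q => normalDown g q ν) (slicePt x) =
      ∑ μ, (pderiv i (fun q => g q ν μ) (slicePt x) * normalUp g (slicePt x) μ
        + g (slicePt x) ν μ * pderiv i (fun q => normalUp g q μ) (slicePt x)) := by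
    rw [pderiv_congr i (h.metric.eventually.mono fun q hq => (sum_mul_normalUp hq ν).symm),
      pderiv_sum _ _ fun μ _ => (hgd ν μ).fun_mul (hn μ)]
    exact Finset.sum_congr rfl fun μ _ => pderiv_mul i (hgd ν μ) (hn μ)
  have h2 : ∑ μ, pderiv i (fun q => g q ν μ) (slicePt x) * normalUp g (slicePt x) μ =
      ∑ μ, g (slicePt x) ν μ * ∑ κ, christoffel g (slicePt x) μ i κ * normalUp g (slicePt x) κ
        + ∑ κ, christoffel g (slicePt x) κ i ν * normalDown g (slicePt x) κ := by
    simp only [h.metric.pderiv_eq, add_mul, Finset.sum_add_distrib]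
    congr 1
    · simp only [Finset.sum_mul, Finset.mul_sum]
      rw [Finset.sum_comm]
      exact Finset.sum_congr rfl fun μ _ => Finset.sum_congr rfl fun κ _ => by ring
    · simp only [← sum_mul_normalUp h.metric, Finset.sum_mul, Finset.mul_sum]
      rw [Finset.sum_comm]
      exact Finset.sum_congr rfl fun μ _ => Finset.sum_congr rfl fun κ _ => by
        rw [hs κ μ]; ring
  simp only [nablaNormal, mul_add, Finset.sum_add_distrib]
  rw [h1, Finset.sum_add_distrib, h2]
  ring

theorem nablaNormal_up (h : IsSpacelikeAt g x) (i μ : Fin 4) :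
    pderiv i (fun q => normalUp g q μ) (slicePt x)
      + ∑ κ, christoffel g (slicePt x) μ i κ * normalUp g (slicePt x) κ
      = ∑ ν, (g (slicePt x))⁻¹ μ ν * nablaNormal g (slicePt x) i ν := by
  set v : Fin 4 → ℝ := fun μ => pderiv i (fun q => normalUp g q μ) (slicePt x)
      + ∑ κ, christoffel g (slicePt x) μ i κ * normalUp g (slicePt x) κ with hv
  have h1 : (g (slicePt x)).mulVec v = nablaNormal g (slicePt x) i :=
    funext fun ν => h.lower_nablaNormal i ν
  have h2 : v = (g (slicePt x))⁻¹.mulVec (nablaNormal g (slicePt x) i) := by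
    rw [← h1, Matrix.mulVec_mulVec,
      Matrix.nonsing_inv_mul _ h.metric.det_ne.self_of_nhds.isUnit, Matrix.one_mulVec]
  exact congrFun h2 μ

/-- The derivative of n·n = -1, so ∇n has no normal component. -/
theorem normal_nablaNormal (h : IsSpacelikeAt g x) (i : Fin 4) :
    ∑ ν, normalUp g (slicePt x) ν * nablaNormal g (slicePt x) i ν = 0 := by
  have hs := h.metric.symm.self_of_nhds.apply
  have hn := fun μ => (h.normalUp_contDiffAt μ).differentiableAt_infty
  have hd := fun μ => (h.normalDown_contDiffAt μ).differentiableAt_infty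
  have h1 : ∑ μ, (pderiv i (fun q => normalUp g q μ) (slicePt x) * normalDown g (slicePt x) μ
      + normalUp g (slicePt x) μ * pderiv i (fun q => normalDown g q μ) (slicePt x)) = 0 := by
    have := pderiv_congr i (h.eventually_inv_zero_zero_neg.mono
      fun q hq => sum_normalUp_mul_normalDown hq)
    rw [pderiv_const, pderiv_sum _ _ fun μ _ => (hn μ).fun_mul (hd μ)] at this
    rw [← this]
    exact Finset.sum_congr rfl fun μ _ => (pderiv_mul i (hn μ) (hd μ)).symm
  have h2 : ∑ μ, (pderiv i (fun q => normalUp g q μ) (slicePt x)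
      + ∑ κ, christoffel g (slicePt x) μ i κ * normalUp g (slicePt x) κ) * normalDown g (slicePt x) μ =
      ∑ ν, normalUp g (slicePt x) ν * nablaNormal g (slicePt x) i ν := by
    simp only [← sum_mul_normalUp h.metric, ← h.lower_nablaNormal, Finset.mul_sum]
    rw [Finset.sum_comm]
    refine Finset.sum_congr rfl fun μ _ => Finset.sum_congr rfl fun κ _ => ?_
    rw [hs μ κ]; ring
  have h3 : ∑ ν, normalUp g (slicePt x) ν * nablaNormal g (slicePt x) i ν =
      ∑ ν, normalUp g (slicePt x) ν * pderiv i (fun q => normalDown g q ν) (slicePt x)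
      - ∑ μ, (∑ κ, christoffel g (slicePt x) μ i κ * normalUp g (slicePt x) κ) * normalDown g (slicePt x) μ := by
    simp only [nablaNormal, mul_sub, Finset.sum_sub_distrib, Finset.mul_sum, Finset.sum_mul]
    congr 1
    rw [Finset.sum_comm]
    exact Finset.sum_congr rfl fun μ _ => Finset.sum_congr rfl fun κ _ => by ring
  simp only [add_mul, Finset.sum_add_distrib] at h1 h2
  linarith

/-- The derivative of the unit normal is tangential and given by the extrinsic curvature. -/
theorem sum_nablaNormal_mul (h : IsSpacelikeAt g x) (i : Fin 3) (F : Fin 4 → ℝ) :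
    ∑ μ, (pderiv i.succ (fun q => normalUp g q μ) (slicePt x)
      + ∑ κ, christoffel g (slicePt x) μ i.succ κ * normalUp g (slicePt x) κ) * F μ =
    - ∑ l, ∑ k, (inducedMetric g x)⁻¹ l k * extrinsicCurv g x i k * F l.succ := by
  have hn : ∑ μ, ∑ ν, normalUp g (slicePt x) μ * normalUp g (slicePt x) ν *
      (nablaNormal g (slicePt x) i.succ ν * F μ) = 0 := by
    refine Finset.sum_eq_zero fun μ _ => ?_
    calc _ = normalUp g (slicePt x) μ * F μ * ∑ ν, normalUp g (slicePt x) ν *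
          nablaNormal g (slicePt x) i.succ ν := by
          rw [Finset.mul_sum]; exact Finset.sum_congr rfl fun ν _ => by ring
      _ = 0 := by rw [h.normal_nablaNormal, mul_zero]
  have := h.sum_inv_mul fun μ ν => nablaNormal g (slicePt x) i.succ ν * F μ
  rw [hn, sub_zero] at this
  simp only [h.nablaNormal_up, Finset.sum_mul, extrinsicCurv_eq, mul_assoc, this]
  simp only [← Finset.sum_neg_distrib]
  exact Finset.sum_congr rfl fun l _ => Finset.sum_congr rfl fun k _ => by ring

theorem induced_isMetricAt (h : IsSpacelikeAt g x) : IsMetricAt (inducedMetric g) x where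
  smooth := by
    filter_upwards [continuous_slicePt.continuousAt.eventually h.metric.smooth] with y hy i j
    exact (hy i.succ j.succ).comp y contDiff_slicePt.contDiffAt
  symm := by
    filter_upwards [continuous_slicePt.continuousAt.eventually h.metric.symm] with y hy
    exact Matrix.IsSymm.ext fun i j => hy.apply _ _
  det_ne := h.posDef.mono fun y hy => hy.det_pos.ne'

theorem pderiv_inducedMetric (h : IsSpacelikeAt g x) (i j k : Fin 3) :
    pderiv i (fun y => inducedMetric g y j k) x =
      pderiv i.succ (fun q => g q j.succ k.succ) (slicePt x) :=
  pderiv_comp_slicePt (f := fun q => g q j.succ k.succ)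
    (h.metric.contDiffAt _ _).differentiableAt_infty i

/-- The Gauss formula `∇_i e_j = Γ^l_{ij} e_l - K_{ij} n`. -/
theorem sum_christoffel_mul (h : IsSpacelikeAt g x) (i j : Fin 3) (F : Fin 4 → ℝ) :
    ∑ κ, christoffel g (slicePt x) κ i.succ j.succ * F κ =
      ∑ l, christoffel (inducedMetric g) x l i j * F l.succ
      - extrinsicCurv g x i j * ∑ κ, normalUp g (slicePt x) κ * F κ := by
  set v : Fin 4 → ℝ := fun ν => ∑ κ, g (slicePt x) ν κ * christoffel g (slicePt x) κ i.succ j.succ with hv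
  have h1 : ∀ κ, christoffel g (slicePt x) κ i.succ j.succ = ∑ ν, (g (slicePt x))⁻¹ κ ν * v ν := fun κ => by
    have : (g (slicePt x))⁻¹.mulVec ((g (slicePt x)).mulVec fun κ => christoffel g (slicePt x) κ i.succ j.succ) =
        fun κ => christoffel g (slicePt x) κ i.succ j.succ := by
      rw [Matrix.mulVec_mulVec, Matrix.nonsing_inv_mul _ h.metric.det_ne.self_of_nhds.isUnit,
        Matrix.one_mulVec]
    exact (congrFun this κ).symm
  -- With three spatial indices the lowered Christoffel symbols of g involve only tangential
  -- derivatives of the g_{ij}, so they agree with those of γ. The remaining lowered symbol is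
  -- contracted with n and gives K in `h3`.
  have h2 : ∀ l : Fin 3, christoffel (inducedMetric g) x l i j =
      ∑ m, (inducedMetric g x)⁻¹ l m * v m.succ := fun l => by
    have hv' : ∀ m : Fin 3, v m.succ = _ := fun m => h.metric.sum_mul_christoffel m.succ i.succ j.succ
    simp only [hv', ← h.pderiv_inducedMetric, christoffel, Finset.mul_sum]
    exact Finset.sum_congr rfl fun m _ => by ring
  have h3 : extrinsicCurv g x i j = ∑ ν, normalUp g (slicePt x) ν * v ν := by
    rw [extrinsicCurv_eq_sum]
    simp only [← sum_mul_normalUp h.metric, hv, Finset.mul_sum]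
    rw [Finset.sum_comm]
    refine Finset.sum_congr rfl fun ν _ => Finset.sum_congr rfl fun κ _ => ?_
    rw [h.metric.symm.self_of_nhds.apply]
    ring
  have h4 := h.sum_inv_mul fun κ ν => v ν * F κ
  simp only [h1, h2, h3, Finset.sum_mul, Finset.mul_sum]
  simp only [← mul_assoc] at h4
  rw [h4]
  congr 1
  exact Finset.sum_congr rfl fun ν _ => Finset.sum_congr rfl fun κ _ => by ring

end IsSpacelikeAt

end Slice

/-! ### Normal and tangential components of the Weyl tensor and their Bianchi identities. -/

section SliceWeyl

variable {g : EuclideanSpace ℝ (Fin 4) → Matrix (Fin 4) (Fin 4) ℝ}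
  {x : EuclideanSpace ℝ (Fin 3)}

/-- The components `W(e_j, n, e_a, e_b)` of the Weyl tensor on the slice. -/
noncomputable def weylMixed (g : EuclideanSpace ℝ (Fin 4) → Matrix (Fin 4) (Fin 4) ℝ)
    (x : EuclideanSpace ℝ (Fin 3)) (j a b : Fin 3) : ℝ :=
  ∑ μ, normalUp g (slicePt x) μ * weyl g (slicePt x) j.succ μ a.succ b.succ

/-- The tangential components `W(e_j, e_l, e_a, e_b)` of the Weyl tensor on the slice. -/
noncomputable def weylTangential (g : EuclideanSpace ℝ (Fin 4) → Matrix (Fin 4) (Fin 4) ℝ)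
    (x : EuclideanSpace ℝ (Fin 3)) (j l a b : Fin 3) : ℝ :=
  weyl g (slicePt x) j.succ l.succ a.succ b.succ

namespace IsWeylFieldAt

theorem antisymm_sum {n : ℕ} (v : Fin n → ℝ) (F : Fin n → Fin n → ℝ) (hF : ∀ i j, F i j = - F j i) :
    ∑ i, ∑ j, v i * v j * F i j = 0 := by
  have h : ∑ i, ∑ j, v i * v j * F i j = - ∑ i, ∑ j, v i * v j * F i j := by
    conv_lhs => rw [Finset.sum_comm]
    rw [← Finset.sum_neg_distrib]
    refine Finset.sum_congr rfl fun i _ => ?_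
    rw [← Finset.sum_neg_distrib]
    refine Finset.sum_congr rfl fun j _ => ?_
    rw [hF i j]; ring
  linarith

theorem mixed_contDiffAt (hW : IsWeylFieldAt g (slicePt x)) (h : IsSpacelikeAt g x) (j a b : Fin 3) :
    ContDiffAt ℝ ∞ (fun y => weylMixed g y j a b) x := by
  have : ContDiffAt ℝ ∞ (fun q => ∑ μ, normalUp g q μ * weyl g q j.succ μ a.succ b.succ)
      (slicePt x) :=
    ContDiffAt.sum fun μ _ => (h.normalUp_contDiffAt μ).mul (hW.smooth _ _ _ _)
  exact this.comp x contDiff_slicePt.contDiffAt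

theorem tangential_contDiffAt (hW : IsWeylFieldAt g (slicePt x)) (j l a b : Fin 3) :
    ContDiffAt ℝ ∞ (fun y => weylTangential g y j l a b) x :=
  (hW.smooth j.succ l.succ a.succ b.succ).comp x contDiff_slicePt.contDiffAt

theorem mixed_antisymm (hW : IsWeylFieldAt g (slicePt x)) (j a b : Fin 3) :
    weylMixed g x j a b = - weylMixed g x j b a := by
  unfold weylMixed
  rw [← Finset.sum_neg_distrib]
  exact Finset.sum_congr rfl fun μ _ => by rw [hW.antisymm_right]; ring

/-- The first Bianchi identity with n moved to the first slot; after dualisation it says that B is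
trace-free. -/
theorem mixed_cyclic (hW : IsWeylFieldAt g (slicePt x)) (j a b : Fin 3) :
    weylMixed g x j a b + weylMixed g x a b j + weylMixed g x b j a = 0 := by
  unfold weylMixed
  simp only [← Finset.sum_add_distrib]
  refine Finset.sum_eq_zero fun μ _ => ?_
  have h1 := hW.cyclic μ j.succ a.succ b.succ
  rw [hW.antisymm_left j.succ μ, hW.antisymm_left a.succ μ, hW.antisymm_left b.succ μ]
  linear_combination - normalUp g (slicePt x) μ * h1

/-- The Bianchi identity for the mixed components. -/
theorem mixed_bianchi (hW : IsWeylFieldAt g (slicePt x)) (h : IsSpacelikeAt g x) (j i a b : Fin 3) :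
    pderiv i (fun y => weylMixed g y j a b) x + pderiv a (fun y => weylMixed g y j b i) x
      + pderiv b (fun y => weylMixed g y j i a) x =
    (∑ l, christoffel (inducedMetric g) x l i j * weylMixed g x l a b
      - ∑ l, ∑ k, (inducedMetric g x)⁻¹ l k * extrinsicCurv g x i k * weylTangential g x j l a b)
    + (∑ l, christoffel (inducedMetric g) x l a j * weylMixed g x l b i
      - ∑ l, ∑ k, (inducedMetric g x)⁻¹ l k * extrinsicCurv g x a k * weylTangential g x j l b i)
    + (∑ l, christoffel (inducedMetric g) x l b j * weylMixed g x l i a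
      - ∑ l, ∑ k, (inducedMetric g x)⁻¹ l k * extrinsicCurv g x b k
        * weylTangential g x j l i a) := by
  have hn := fun μ => (h.normalUp_contDiffAt μ).differentiableAt_infty
  have hw := fun α β μ ν => (hW.smooth α β μ ν).differentiableAt_infty
  have hd : ∀ i a b : Fin 3, pderiv i (fun y => weylMixed g y j a b) x =
      ∑ μ, normalUp g (slicePt x) μ *
          pderiv i.succ (fun q => weyl g q j.succ μ a.succ b.succ) (slicePt x)
        + ∑ μ, pderiv i.succ (fun q => normalUp g q μ) (slicePt x) *
          weyl g (slicePt x) j.succ μ a.succ b.succ := by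
    intro i a b
    have e := pderiv_comp_slicePt (x := x)
      (f := fun q => ∑ μ, normalUp g q μ * weyl g q j.succ μ a.succ b.succ)
      (DifferentiableAt.fun_sum fun μ _ => (hn μ).fun_mul (hw _ _ _ _)) i
    refine e.trans ?_
    rw [pderiv_sum _ _ fun μ _ => (hn μ).fun_mul (hw _ _ _ _), ← Finset.sum_add_distrib]
    refine Finset.sum_congr rfl fun μ _ => ?_
    rw [pderiv_mul _ (hn μ) (hw _ _ _ _), add_comm]
  have hS : ∀ i a b : Fin 3,
      ∑ μ, pderiv i.succ (fun q => normalUp g q μ) (slicePt x) *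
          weyl g (slicePt x) j.succ μ a.succ b.succ
        + ∑ μ, normalUp g (slicePt x) μ * (∑ c, christoffel g (slicePt x) c i.succ j.succ
            * weyl g (slicePt x) c μ a.succ b.succ
          + ∑ c, weyl g (slicePt x) j.succ c a.succ b.succ
            * christoffel g (slicePt x) c i.succ μ)
      = ∑ l, christoffel (inducedMetric g) x l i j * weylMixed g x l a b
      - ∑ l, ∑ k, (inducedMetric g x)⁻¹ l k * extrinsicCurv g x i k
        * weylTangential g x j l a b := by
    intro i a b
    have h1 := h.sum_nablaNormal_mul i fun μ => weyl g (slicePt x) j.succ μ a.succ b.succ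
    have h2 := h.sum_christoffel_mul i j fun c => ∑ μ, normalUp g (slicePt x) μ *
      weyl g (slicePt x) c μ a.succ b.succ
    -- The normal part of ∇_i e_j would contribute W(n, n, ·, ·), which is zero; K enters only
    -- through the derivative of n.
    have h3 : ∑ κ, normalUp g (slicePt x) κ * ∑ μ, normalUp g (slicePt x) μ *
        weyl g (slicePt x) κ μ a.succ b.succ = 0 := by
      rw [← antisymm_sum (normalUp g (slicePt x))
        (fun κ μ => weyl g (slicePt x) κ μ a.succ b.succ) fun κ μ => hW.antisymm_left _ _ _ _]
      simp only [Finset.mul_sum, mul_assoc]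
    rw [h3, mul_zero, sub_zero] at h2
    change _ = ∑ l, christoffel (inducedMetric g) x l i j * weylMixed g x l a b at h2
    change _ = - ∑ l, ∑ k, (inducedMetric g x)⁻¹ l k * extrinsicCurv g x i k
        * weylTangential g x j l a b at h1
    rw [← h2, sub_eq_add_neg, ← h1]
    simp only [add_mul, mul_add, Finset.sum_add_distrib, Finset.mul_sum, Finset.sum_mul]
    have c1 : ∑ μ, ∑ c, normalUp g (slicePt x) μ * (christoffel g (slicePt x) c i.succ j.succ
        * weyl g (slicePt x) c μ a.succ b.succ) = ∑ c, ∑ μ, christoffel g (slicePt x) c i.succ j.succ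
        * (normalUp g (slicePt x) μ * weyl g (slicePt x) c μ a.succ b.succ) := by
      rw [Finset.sum_comm]
      exact Finset.sum_congr rfl fun μ _ => Finset.sum_congr rfl fun κ _ => by ring
    have c2 : ∑ μ, ∑ c, normalUp g (slicePt x) μ * (weyl g (slicePt x) j.succ c a.succ b.succ
        * christoffel g (slicePt x) c i.succ μ) = ∑ c, ∑ μ, christoffel g (slicePt x) c i.succ μ
        * normalUp g (slicePt x) μ * weyl g (slicePt x) j.succ c a.succ b.succ := by
      rw [Finset.sum_comm]
      exact Finset.sum_congr rfl fun μ _ => Finset.sum_congr rfl fun κ _ => by ring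
    rw [c1, c2]
    ring
  rw [hd, hd, hd, ← hS i a b, ← hS a b i, ← hS b i a]
  have hB : ∑ μ, normalUp g (slicePt x) μ * _ = ∑ μ, normalUp g (slicePt x) μ * _ :=
    Finset.sum_congr rfl fun μ _ =>
      congrArg (normalUp g (slicePt x) μ * ·) (hW.bianchi j.succ μ i.succ a.succ b.succ)
  simp only [mul_add, Finset.sum_add_distrib] at hB ⊢
  linear_combination hB

/-- The Bianchi identity for the tangential components. -/
theorem tangential_bianchi (hW : IsWeylFieldAt g (slicePt x)) (h : IsSpacelikeAt g x)
    (j l i a b : Fin 3) :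
    pderiv i (fun y => weylTangential g y j l a b) x
      + pderiv a (fun y => weylTangential g y j l b i) x
      + pderiv b (fun y => weylTangential g y j l i a) x =
    (∑ m, christoffel (inducedMetric g) x m i j * weylTangential g x m l a b
      + ∑ m, christoffel (inducedMetric g) x m i l * weylTangential g x j m a b
      + (extrinsicCurv g x i j * weylMixed g x l a b - extrinsicCurv g x i l * weylMixed g x j a b))
    + (∑ m, christoffel (inducedMetric g) x m a j * weylTangential g x m l b i
      + ∑ m, christoffel (inducedMetric g) x m a l * weylTangential g x j m b i
      + (extrinsicCurv g x a j * weylMixed g x l b i - extrinsicCurv g x a l * weylMixed g x j b i))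
    + (∑ m, christoffel (inducedMetric g) x m b j * weylTangential g x m l i a
      + ∑ m, christoffel (inducedMetric g) x m b l * weylTangential g x j m i a
      + (extrinsicCurv g x b j * weylMixed g x l i a
        - extrinsicCurv g x b l * weylMixed g x j i a)) := by
  have hd : ∀ i a b : Fin 3, pderiv i (fun y => weylTangential g y j l a b) x =
      pderiv i.succ (fun q => weyl g q j.succ l.succ a.succ b.succ) (slicePt x) := fun i a b =>
    pderiv_comp_slicePt (f := fun q => weyl g q j.succ l.succ a.succ b.succ)
      (hW.smooth _ _ _ _).differentiableAt_infty i
  have hS : ∀ i a b : Fin 3,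
      ∑ c, christoffel g (slicePt x) c i.succ j.succ * weyl g (slicePt x) c l.succ a.succ b.succ
        + ∑ c, weyl g (slicePt x) j.succ c a.succ b.succ * christoffel g (slicePt x) c i.succ l.succ
      = ∑ m, christoffel (inducedMetric g) x m i j * weylTangential g x m l a b
      + ∑ m, christoffel (inducedMetric g) x m i l * weylTangential g x j m a b
      + (extrinsicCurv g x i j * weylMixed g x l a b
        - extrinsicCurv g x i l * weylMixed g x j a b) := by
    intro i a b
    have h1 := h.sum_christoffel_mul i j fun c => weyl g (slicePt x) c l.succ a.succ b.succ
    have h2 := h.sum_christoffel_mul i l fun c => weyl g (slicePt x) j.succ c a.succ b.succ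
    -- Here the normal part of the Gauss formula does not drop out: it turns a tangential component
    -- into a mixed one, which is the origin of the source K × B.
    have h3 : ∑ κ, normalUp g (slicePt x) κ * weyl g (slicePt x) κ l.succ a.succ b.succ =
        - weylMixed g x l a b := by
      unfold weylMixed
      rw [← Finset.sum_neg_distrib]
      exact Finset.sum_congr rfl fun κ _ => by rw [hW.antisymm_left κ]; ring
    rw [h3] at h1
    change _ = ∑ m, christoffel (inducedMetric g) x m i j * weylTangential g x m l a b - _ at h1
    change _ = ∑ m, christoffel (inducedMetric g) x m i l * weylTangential g x j m a b
      - extrinsicCurv g x i l * weylMixed g x j a b at h2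
    simp only [mul_comm (weyl _ _ _ _ _ _)]
    rw [h1, h2]
    ring
  rw [hd, hd, hd, ← hS i a b, ← hS a b i, ← hS b i a]
  exact hW.bianchi j.succ l.succ i.succ a.succ b.succ

/-- The electric part as the trace of the tangential components. -/
theorem electricPart_eq (hW : IsWeylFieldAt g (slicePt x)) (h : IsSpacelikeAt g x) (l b : Fin 3) :
    electricPart g x l b =
      - ∑ j, ∑ a, (inducedMetric g x)⁻¹ j a * weylTangential g x j l a b := by
  have h1 := h.sum_inv_mul fun α γ => weyl g (slicePt x) α l.succ γ b.succ
  rw [hW.trace] at h1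
  have h2 : electricPart g x l b = - ∑ μ, ∑ ν, normalUp g (slicePt x) μ * normalUp g (slicePt x) ν
      * weyl g (slicePt x) μ l.succ ν b.succ := by
    simp only [electricPart, Matrix.of_apply, ← Finset.sum_neg_distrib]
    exact Finset.sum_congr rfl fun μ _ => Finset.sum_congr rfl fun ν _ => by
      rw [hW.antisymm_left μ]; ring
  simp only [weylTangential]
  linarith

theorem sum_comm_three {ι : Type*} [Fintype ι] (F : ι → ι → ι → ℝ) :
    ∑ a, ∑ b, ∑ c, F a b c = ∑ c, ∑ a, ∑ b, F a b c := by
  calc _ = ∑ a, ∑ c, ∑ b, F a b c := Finset.sum_congr rfl fun a _ => Finset.sum_comm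
    _ = _ := Finset.sum_comm

theorem sum_comm_four {ι : Type*} [Fintype ι] (F : ι → ι → ι → ι → ℝ) :
    ∑ a, ∑ b, ∑ c, ∑ d, F a b c d = ∑ c, ∑ d, ∑ a, ∑ b, F a b c d := by
  rw [sum_comm_three]
  exact Finset.sum_congr rfl fun c _ => sum_comm_three fun a b d => F a b c d

/-- The electric part is trace free. -/
theorem electricPart_trace (hW : IsWeylFieldAt g (slicePt x)) (h : IsSpacelikeAt g x) :
    ∑ l, ∑ b, (inducedMetric g x)⁻¹ l b * electricPart g x l b = 0 := by
  have h1 := h.sum_inv_mul fun β δ => ∑ μ, ∑ ν, weyl g (slicePt x) β μ ν δ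
    * normalUp g (slicePt x) μ * normalUp g (slicePt x) ν
  change _ = ∑ l, ∑ b, (inducedMetric g x)⁻¹ l b * electricPart g x l b - _ at h1
  have h2 : ∑ β, ∑ δ, (g (slicePt x))⁻¹ β δ * ∑ μ, ∑ ν, weyl g (slicePt x) β μ ν δ
      * normalUp g (slicePt x) μ * normalUp g (slicePt x) ν = 0 := by
    calc _ = ∑ μ, ∑ ν, - (normalUp g (slicePt x) μ * normalUp g (slicePt x) ν) *
          ∑ β, ∑ δ, (g (slicePt x))⁻¹ β δ * weyl g (slicePt x) β μ δ ν := by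
          simp only [Finset.mul_sum]
          rw [sum_comm_four]
          refine Finset.sum_congr rfl fun μ _ => Finset.sum_congr rfl fun ν _ =>
            Finset.sum_congr rfl fun β _ => Finset.sum_congr rfl fun δ _ => ?_
          rw [hW.antisymm_right β μ δ ν]
          ring
      _ = 0 := by simp [hW.trace]
  have h3 : ∑ β, ∑ δ, normalUp g (slicePt x) β * normalUp g (slicePt x) δ *
      ∑ μ, ∑ ν, weyl g (slicePt x) β μ ν δ
      * normalUp g (slicePt x) μ * normalUp g (slicePt x) ν = 0 := by
    calc _ = ∑ δ, ∑ ν, normalUp g (slicePt x) δ * normalUp g (slicePt x) ν * ∑ β, ∑ μ,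
          normalUp g (slicePt x) β * normalUp g (slicePt x) μ * weyl g (slicePt x) β μ ν δ := by
          simp only [Finset.mul_sum]
          rw [Finset.sum_comm]
          refine Finset.sum_congr rfl fun δ _ => ?_
          rw [sum_comm_three]
          exact Finset.sum_congr rfl fun ν _ => Finset.sum_congr rfl fun β _ =>
            Finset.sum_congr rfl fun μ _ => by ring
      _ = 0 := by
          refine Finset.sum_eq_zero fun δ _ => Finset.sum_eq_zero fun ν _ => ?_
          rw [antisymm_sum (normalUp g (slicePt x)) (fun β μ => weyl g (slicePt x) β μ ν δ)
            fun β μ => hW.antisymm_left _ _ _ _, mul_zero]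
  linarith

theorem electricPart_symm (hW : IsWeylFieldAt g (slicePt x)) (l b : Fin 3) :
    electricPart g x l b = electricPart g x b l := by
  simp only [electricPart, Matrix.of_apply]
  rw [Finset.sum_comm]
  refine Finset.sum_congr rfl fun μ _ => Finset.sum_congr rfl fun ν _ => ?_
  rw [hW.pair_symm, hW.antisymm_left, hW.antisymm_right]
  ring

/-- The mixed components are trace free. -/
theorem mixed_trace (hW : IsWeylFieldAt g (slicePt x)) (h : IsSpacelikeAt g x) (b : Fin 3) :
    ∑ j, ∑ a, (inducedMetric g x)⁻¹ j a * weylMixed g x j a b = 0 := by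
  have h1 := h.sum_inv_mul fun α γ => ∑ μ, normalUp g (slicePt x) μ *
    weyl g (slicePt x) α μ γ b.succ
  have h2 : ∑ α, ∑ γ, (g (slicePt x))⁻¹ α γ * ∑ μ, normalUp g (slicePt x) μ *
      weyl g (slicePt x) α μ γ b.succ = 0 := by
    calc _ = ∑ μ, normalUp g (slicePt x) μ *
          ∑ α, ∑ γ, (g (slicePt x))⁻¹ α γ * weyl g (slicePt x) α μ γ b.succ := by
          simp only [Finset.mul_sum]
          rw [sum_comm_three]
          exact Finset.sum_congr rfl fun μ _ => Finset.sum_congr rfl fun α _ =>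
            Finset.sum_congr rfl fun γ _ => by ring
      _ = 0 := by simp [hW.trace]
  have h3 : ∑ α, ∑ γ, normalUp g (slicePt x) α * normalUp g (slicePt x) γ *
      ∑ μ, normalUp g (slicePt x) μ * weyl g (slicePt x) α μ γ b.succ = 0 := by
    rw [Finset.sum_comm]
    refine Finset.sum_eq_zero fun γ _ => ?_
    have := antisymm_sum (normalUp g (slicePt x))
      (fun α μ => weyl g (slicePt x) α μ γ b.succ) fun α μ => hW.antisymm_left _ _ _ _
    rw [← mul_zero (normalUp g (slicePt x) γ), ← this]
    simp only [Finset.mul_sum]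
    exact Finset.sum_congr rfl fun α _ => Finset.sum_congr rfl fun μ _ => by ring
  rw [h2, h3, sub_zero] at h1
  exact h1.symm

end IsWeylFieldAt

end SliceWeyl

/-! ### Dualisation: the magnetic part in terms of the mixed components. -/

section Dual

theorem det_rows_expand {m : ℕ} (A : Matrix (Fin m) (Fin m) ℝ) (i : Fin m) (v : Fin m → ℝ) :
    (A.updateRow i v).det =
      ∑ ρ, v ρ * (A.updateRow i fun k => if ρ = k then (1 : ℝ) else 0).det :=
  LinearMap.pi_apply_eq_sum_univ
    ((Matrix.detRowAlternating (R := ℝ) (n := Fin m)).toMultilinearMap.toLinearMap A i) v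

/-- Multilinearity of the determinant in its first three rows: contracting the permutation symbol
with three vectors is a determinant. -/
theorem det_four_rows (a b c : Fin 4 → ℝ) (j : Fin 4) :
    ∑ ρ, ∑ σ, ∑ ν, a ρ * b σ * c ν * permSymbol ![ρ, σ, ν, j] =
      (Matrix.of ![a, b, c, fun k => if j = k then (1 : ℝ) else 0]).det := by
  have ea : ∀ b c d : Fin 4 → ℝ, (Matrix.of ![a, b, c, d]).det = ∑ ρ, a ρ *
      (Matrix.of ![fun k => if ρ = k then (1 : ℝ) else 0, b, c, d]).det := by
    intro b c d
    have := det_rows_expand (Matrix.of ![a, b, c, d]) 0 a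
    convert this using 3
    · ext i k; fin_cases i <;> simp [Matrix.updateRow_apply]
    · congr 1; ext i k; fin_cases i <;> simp [Matrix.updateRow_apply]
  have eb : ∀ a c d : Fin 4 → ℝ, (Matrix.of ![a, b, c, d]).det = ∑ ρ, b ρ *
      (Matrix.of ![a, fun k => if ρ = k then (1 : ℝ) else 0, c, d]).det := by
    intro a c d
    have := det_rows_expand (Matrix.of ![a, b, c, d]) 1 b
    convert this using 3
    · ext i k; fin_cases i <;> simp [Matrix.updateRow_apply]
    · congr 1; ext i k; fin_cases i <;> simp [Matrix.updateRow_apply]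
  have ec : ∀ a b d : Fin 4 → ℝ, (Matrix.of ![a, b, c, d]).det = ∑ ρ, c ρ *
      (Matrix.of ![a, b, fun k => if ρ = k then (1 : ℝ) else 0, d]).det := by
    intro a b d
    have := det_rows_expand (Matrix.of ![a, b, c, d]) 2 c
    convert this using 3
    · ext i k; fin_cases i <;> simp [Matrix.updateRow_apply]
    · congr 1; ext i k; fin_cases i <;> simp [Matrix.updateRow_apply]
  have hp : ∀ ρ σ ν : Fin 4, permSymbol ![ρ, σ, ν, j] =
      (Matrix.of ![fun k => if ρ = k then (1 : ℝ) else 0, fun k => if σ = k then (1 : ℝ) else 0,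
        fun k => if ν = k then (1 : ℝ) else 0, fun k => if j = k then (1 : ℝ) else 0]).det := by
    intro ρ σ ν
    unfold permSymbol
    congr 1; ext i k; fin_cases i <;> rfl
  rw [ea]
  refine Finset.sum_congr rfl fun ρ _ => ?_
  rw [eb, Finset.mul_sum]
  refine Finset.sum_congr rfl fun σ _ => ?_
  rw [ec, Finset.mul_sum, Finset.mul_sum]
  refine Finset.sum_congr rfl fun ν _ => ?_
  rw [hp]; ring

/-- Factor G⁻¹ out on the right. Raising three indices of the volume form thus amounts to lowering
the fourth and dividing by the determinant. -/
theorem det_inv_rows {G : Matrix (Fin 4) (Fin 4) ℝ} (hG : G.det ≠ 0) (l d e j : Fin 4) :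
    (Matrix.of ![G⁻¹ l, G⁻¹ d, G⁻¹ e, fun k => if j = k then (1 : ℝ) else 0]).det =
      (Matrix.of ![fun k => if l = k then (1 : ℝ) else 0, fun k => if d = k then (1 : ℝ) else 0,
        fun k => if e = k then (1 : ℝ) else 0, G j]).det * G.det⁻¹ := by
  rw [← Ring.inverse_eq_inv', ← Matrix.det_nonsing_inv, ← Matrix.det_mul]
  congr 1
  have h1 : ∀ a k, G⁻¹ a k = ∑ m, (if a = m then (1 : ℝ) else 0) * G⁻¹ m k := by simp
  have h2 : ∀ k, (if j = k then (1 : ℝ) else 0) = ∑ m, G j m * G⁻¹ m k := fun k => by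
    rw [← Matrix.mul_apply, Matrix.mul_nonsing_inv _ hG.isUnit, Matrix.one_apply]
  ext i k
  rw [Matrix.mul_apply]
  fin_cases i
  · exact h1 l k
  · exact h1 d k
  · exact h1 e k
  · exact h2 k

/-- A basis vector e₀ in the third row leaves the three-dimensional permutation symbol. The pairs
(c+1, c+2), taken modulo 3, are the even ones; the factor 2 counts both orders and will cancel the
1/2 in the definition of the dual. -/
theorem sum_antisymm_mul_det (Y : Fin 4 → Fin 4 → ℝ) (hY : ∀ l d, Y l d = - Y d l)
    (v : Fin 4 → ℝ) :
    ∑ l, ∑ d, Y l d * (Matrix.of ![fun k => if l = k then (1 : ℝ) else 0,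
      fun k => if d = k then (1 : ℝ) else 0, fun k => if 0 = k then (1 : ℝ) else 0, v]).det =
    2 * ∑ c : Fin 3, Y (c + 1).succ (c + 2).succ * v c.succ := by
  have h12 := hY 2 1
  have h13 := hY 3 1
  have h23 := hY 3 2
  have e : ∀ l d : Fin 4, (Matrix.of ![fun k => if l = k then (1 : ℝ) else 0,
      fun k => if d = k then (1 : ℝ) else 0, fun k => if 0 = k then (1 : ℝ) else 0, v]).det =
      !![0, 0, 0, 0; 0, 0, v 3, - v 2; 0, - v 3, 0, v 1; 0, v 2, - v 1, 0] l d := by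
    intro l d
    fin_cases l <;> fin_cases d <;>
      simp [Fin.sum_univ_succ, Matrix.det_succ_row_zero, Fin.succAbove]
    · ring
    · ring
  simp only [e, Fin.sum_univ_four, Fin.sum_univ_three]
  simp [h12, h13, h23]
  ring_nf

variable {g : EuclideanSpace ℝ (Fin 4) → Matrix (Fin 4) (Fin 4) ℝ}
  {x : EuclideanSpace ℝ (Fin 3)}

/-- This is √|det g| = N √(det γ), in the form needed for the volume form; the minus sign is that of
det g. -/
theorem IsSpacelikeAt.sqrt_det (h : IsSpacelikeAt g x) :
    lapse g (slicePt x) * Real.sqrt |(g (slicePt x)).det| * ((g (slicePt x)).det)⁻¹ =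
      - (Real.sqrt (inducedMetric g x).det)⁻¹ := by
  have h1 := h.det_neg
  have h2 := h.det_induced_pos
  unfold lapse
  rw [IsSpacelikeAt.inv_zero_zero, abs_of_neg h1]
  have e : -((inducedMetric g x).det / (g (slicePt x)).det) =
    (inducedMetric g x).det / (-(g (slicePt x)).det) := by rw [div_neg]
  rw [e, Real.sqrt_div h2.le]
  have h3 : 0 < Real.sqrt (-(g (slicePt x)).det) := Real.sqrt_pos.2 (by linarith)
  have h4 : 0 < Real.sqrt (inducedMetric g x).det := Real.sqrt_pos.2 h2
  have h5 : Real.sqrt (-(g (slicePt x)).det) ^ 2 = -(g (slicePt x)).det :=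
    Real.sq_sqrt (by linarith)
  have h6 := h1.ne
  field_simp
  linarith

/-- The magnetic part in terms of the dual of the mixed components. -/
theorem IsWeylFieldAt.magneticPart_eq (hW : IsWeylFieldAt g (slicePt x)) (h : IsSpacelikeAt g x)
    (i j : Fin 3) : magneticPart g x i j = (Real.sqrt (inducedMetric g x).det)⁻¹ *
      ∑ c, weylMixed g x i (c + 1) (c + 2) * inducedMetric g x c j := by
  set Y : Fin 4 → Fin 4 → ℝ := fun l d =>
    ∑ μ, normalUp g (slicePt x) μ * weyl g (slicePt x) i.succ μ l d with hYdef
  have hY : ∀ l d, Y l d = - Y d l := fun l d => by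
    simp only [hYdef, ← Finset.sum_neg_distrib]
    exact Finset.sum_congr rfl fun μ _ => by rw [hW.antisymm_right]; ring
  set D : Fin 4 → Fin 4 → ℝ := fun l d => (Matrix.of ![fun k => if l = k then (1 : ℝ) else 0,
      fun k => if d = k then (1 : ℝ) else 0, fun k => if 0 = k then (1 : ℝ) else 0,
      g (slicePt x) j.succ]).det with hD
  set C : Fin 4 → Fin 4 → Fin 4 → ℝ := fun l d ν => ∑ ρ, ∑ σ, (g (slicePt x))⁻¹ l ρ
    * (g (slicePt x))⁻¹ d σ * volForm g (slicePt x) ρ σ ν j.succ with hC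
  -- Since n^ν = -N g^{ν0}, contracting with n raises the third index of ε and sets it to 0. All
  -- three raised indices are then removed together by `det_inv_rows`.
  have hT : ∀ l d : Fin 4, ∑ ν, C l d ν * normalUp g (slicePt x) ν =
      (Real.sqrt (inducedMetric g x).det)⁻¹ * D l d := by
    intro l d
    have e1 := det_four_rows ((g (slicePt x))⁻¹ l) ((g (slicePt x))⁻¹ d) ((g (slicePt x))⁻¹ 0) j.succ
    rw [det_inv_rows h.det_neg.ne] at e1
    have e2 := h.sqrt_det
    calc _ = - (lapse g (slicePt x) * Real.sqrt |(g (slicePt x)).det|) * ∑ ρ, ∑ σ, ∑ ν,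
          (g (slicePt x))⁻¹ l ρ * (g (slicePt x))⁻¹ d σ * (g (slicePt x))⁻¹ 0 ν
            * permSymbol ![ρ, σ, ν, j.succ] := by
          simp only [hC, Finset.mul_sum, Finset.sum_mul, volForm]
          refine (sum_comm_three fun ρ σ ν => _).symm.trans ?_
          refine Finset.sum_congr rfl fun ρ _ => Finset.sum_congr rfl fun σ _ =>
            Finset.sum_congr rfl fun ν _ => ?_
          rw [IsSpacelikeAt.normalUp_eq, IsSpacelikeAt.inv_symm h.metric ν 0]
          ring
      _ = _ := by rw [e1]; linear_combination (-1) * D l d * e2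
  calc magneticPart g x i j = (1 / 2) * ∑ l, ∑ d, Y l d *
        ∑ ν, C l d ν * normalUp g (slicePt x) ν := by
        have e : magneticPart g x i j = ∑ μ, ∑ ν, ((1 / 2) * ∑ l, ∑ d,
          weyl g (slicePt x) i.succ μ l d * C l d ν) * normalUp g (slicePt x) μ
            * normalUp g (slicePt x) ν := rfl
        rw [e]
        clear_value C
        simp only [hYdef, Finset.mul_sum, Finset.sum_mul]
        rw [sum_comm_four]
        refine Finset.sum_congr rfl fun l _ => Finset.sum_congr rfl fun d _ => ?_
        rw [Finset.sum_comm]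
        exact Finset.sum_congr rfl fun μ _ => Finset.sum_congr rfl fun ν _ => by ring
    _ = (1 / 2) * ((Real.sqrt (inducedMetric g x).det)⁻¹ * ∑ l, ∑ d, Y l d * D l d) := by
        simp only [hT, Finset.mul_sum]
        exact Finset.sum_congr rfl fun μ _ => Finset.sum_congr rfl fun ν _ => by ring
    _ = _ := by
        rw [hD, sum_antisymm_mul_det Y hY]
        have e : ∀ c : Fin 3, g (slicePt x) j.succ c.succ = inducedMetric g x c j := fun c =>
          h.metric.symm.self_of_nhds.apply _ _
        simp only [e]
        change (1 / 2) * (_ * (2 * ∑ c, weylMixed g x i (c + 1) (c + 2) * inducedMetric g x c j)) = _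
        ring

end Dual

/-! ### Algebraic identities for three-dimensional metrics. -/

section Constraint

/-- Jacobi's formula, ∂_c log det γ = 2 Γ^m_{cm}, by expanding the 3 × 3 determinant. -/
theorem pderiv_det {γ : EuclideanSpace ℝ (Fin 3) → Matrix (Fin 3) (Fin 3) ℝ}
    {x : EuclideanSpace ℝ (Fin 3)} (hγ : IsMetricAt γ x) (c : Fin 3) :
    pderiv c (fun y => (γ y).det) x = 2 * (γ x).det * ∑ m, christoffel γ x m c m := by
  have d := fun i j => (hγ.contDiffAt i j).differentiableAt_infty
  have d2 := fun i j k l => (d i j).fun_mul (d k l)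
  have d3 := fun i j k l m n => (d2 i j k l).fun_mul (d m n)
  have t : ∀ i j k l m n, pderiv c (fun y => γ y i j * γ y k l * γ y m n) x =
      (pderiv c (fun y => γ y i j) x * γ x k l + γ x i j * pderiv c (fun y => γ y k l) x) * γ x m n
        + γ x i j * γ x k l * pderiv c (fun y => γ y m n) x := fun i j k l m n => by
    rw [pderiv_mul c (d2 i j k l) (d m n), pderiv_mul c (d i j) (d k l)]
  have hs := hγ.symm.self_of_nhds.apply
  simp only [Matrix.det_fin_three]
  rw [pderiv_sub c (((((d3 _ _ _ _ _ _).fun_sub (d3 _ _ _ _ _ _)).fun_sub (d3 _ _ _ _ _ _)).fun_add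
      (d3 _ _ _ _ _ _)).fun_add (d3 _ _ _ _ _ _)) (d3 _ _ _ _ _ _),
    pderiv_add c ((((d3 _ _ _ _ _ _).fun_sub (d3 _ _ _ _ _ _)).fun_sub (d3 _ _ _ _ _ _)).fun_add
      (d3 _ _ _ _ _ _)) (d3 _ _ _ _ _ _),
    pderiv_add c (((d3 _ _ _ _ _ _).fun_sub (d3 _ _ _ _ _ _)).fun_sub (d3 _ _ _ _ _ _))
      (d3 _ _ _ _ _ _),
    pderiv_sub c ((d3 _ _ _ _ _ _).fun_sub (d3 _ _ _ _ _ _)) (d3 _ _ _ _ _ _),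
    pderiv_sub c (d3 _ _ _ _ _ _) (d3 _ _ _ _ _ _)]
  simp only [t, hγ.pderiv_eq, Fin.sum_univ_three]
  rw [hs 0 1, hs 0 2, hs 1 2]
  ring

/-- For a symmetric tensor density `S`, `Γ^l_{cj} S^c_l = (1/2) S^{ck} ∂_j γ_{ck}`. -/
theorem sum_christoffel_mul_symm {γ : EuclideanSpace ℝ (Fin 3) → Matrix (Fin 3) (Fin 3) ℝ}
    {x : EuclideanSpace ℝ (Fin 3)} (hγ : IsMetricAt γ x) {S : Matrix (Fin 3) (Fin 3) ℝ}
    (hS : S.IsSymm) (j : Fin 3) :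
    ∑ c, ∑ l, christoffel γ x l c j * (S * γ x) c l =
      (1 / 2) * ∑ c, ∑ k, S c k * pderiv j (fun y => γ y c k) x := by
  have h1 : ∀ c, ∑ l, christoffel γ x l c j * (S * γ x) c l =
      ∑ k, S c k * ((1 / 2) * (pderiv c (fun q => γ q k j) x
      + pderiv j (fun q => γ q k c) x - pderiv k (fun q => γ q c j) x)) := by
    intro c
    simp only [← hγ.sum_mul_christoffel, Matrix.mul_apply, Finset.mul_sum]
    rw [Finset.sum_comm]
    exact Finset.sum_congr rfl fun k _ => Finset.sum_congr rfl fun l _ => by ring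
  have h2 : ∑ c, ∑ k, S c k * pderiv k (fun q => γ q c j) x =
      ∑ c, ∑ k, S c k * pderiv c (fun q => γ q k j) x := by
    rw [Finset.sum_comm]
    exact Finset.sum_congr rfl fun k _ => Finset.sum_congr rfl fun l _ => by rw [hS.apply k l]
  simp only [h1]
  calc _ = (1 / 2) * (∑ c, ∑ k, S c k * pderiv c (fun q => γ q k j) x
        + ∑ c, ∑ k, S c k * pderiv j (fun q => γ q k c) x
        - ∑ c, ∑ k, S c k * pderiv k (fun q => γ q c j) x) := by
        simp only [← Finset.sum_add_distrib, ← Finset.sum_sub_distrib, Finset.mul_sum]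
        exact Finset.sum_congr rfl fun k _ => Finset.sum_congr rfl fun l _ => by ring
    _ = _ := by
        rw [h2, add_sub_cancel_left]
        congr 1
        exact Finset.sum_congr rfl fun k _ => Finset.sum_congr rfl fun l _ => by
          rw [hγ.pderiv_symm]

/-- In dimension three W_{jlab} = ε_{jld} ε_{abc} G^{cd}, and the adjugate satisfies adj(γ)^{ja}
ε_{jld} ε_{abc} = γ_{lb} γ_{dc} - γ_{lc} γ_{db}. This expresses the trace of W, hence the electric
part, by the double dual G. -/
theorem sum_adjugate_mul {γ : Matrix (Fin 3) (Fin 3) ℝ} (hγ : γ.IsSymm)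
    {W : Fin 3 → Fin 3 → Fin 3 → Fin 3 → ℝ} (hl : ∀ j l a b, W j l a b = - W l j a b)
    (hr : ∀ j l a b, W j l a b = - W j l b a) (l b : Fin 3) :
    ∑ j, ∑ a, γ.adjugate j a * W j l a b =
      γ l b * ∑ c, ∑ d, γ c d * W (d + 1) (d + 2) (c + 1) (c + 2)
      - ∑ c, ∑ d, γ l c * W (d + 1) (d + 2) (c + 1) (c + 2) * γ d b := by
  have l0 : ∀ j a b, W j j a b = 0 := fun j a b => by linarith [hl j j a b]
  have r0 : ∀ j l a, W j l a a = 0 := fun j l a => by linarith [hr j l a a]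
  have l1 := hl 1 0
  have l2 := hl 2 0
  have l3 := hl 2 1
  have r1 := fun j l => hr j l 1 0
  have r2 := fun j l => hr j l 2 0
  have r3 := fun j l => hr j l 2 1
  have s1 := hγ.apply 0 1
  have s2 := hγ.apply 0 2
  have s3 := hγ.apply 1 2
  rw [Matrix.adjugate_fin_three]
  simp only [Fin.sum_univ_three]
  have e1 : (1 : Fin 3) + 1 = 2 := rfl
  have e2 : (2 : Fin 3) + 1 = 0 := rfl
  have e3 : (1 : Fin 3) + 2 = 0 := rfl
  have e4 : (2 : Fin 3) + 2 = 1 := rfl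
  fin_cases l <;> fin_cases b <;>
    simp [e1, e2, e3, e4, l0, r0, l1, l2, l3, r1, r2, r3, s1, s2, s3] <;> ring

end Constraint

/-! ### Densities of E and B, and the constraint equations. -/

section ConstraintEquations

/-- The tensor density `√γ T^{ij}` of a tensor `T_{ij}`. -/
noncomputable def raisedDensity (γ T : Matrix (Fin 3) (Fin 3) ℝ) : Matrix (Fin 3) (Fin 3) ℝ :=
  Real.sqrt γ.det • (γ⁻¹ * T * γ⁻¹)

theorem raisedDensity_mul {γ T : Matrix (Fin 3) (Fin 3) ℝ} (hγ : γ.det ≠ 0) :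
    raisedDensity γ T * γ = Real.sqrt γ.det • (γ⁻¹ * T) := by
  rw [raisedDensity, Matrix.smul_mul, Matrix.mul_assoc, Matrix.nonsing_inv_mul _ hγ.isUnit,
    Matrix.mul_one]

theorem inv_isSymm {n : ℕ} {γ : Matrix (Fin n) (Fin n) ℝ} (hγ : γ.IsSymm) : (γ⁻¹).IsSymm := by
  rw [Matrix.IsSymm, Matrix.transpose_nonsing_inv, hγ]

theorem raisedDensity_isSymm {γ T : Matrix (Fin 3) (Fin 3) ℝ} (hγ : γ.IsSymm) (hT : T.IsSymm) :
    (raisedDensity γ T).IsSymm := by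
  have h := inv_isSymm hγ
  unfold Matrix.IsSymm at *
  rw [raisedDensity, Matrix.transpose_smul, Matrix.transpose_mul, Matrix.transpose_mul, h, hT,
    Matrix.mul_assoc]

theorem sum_sum_mul_eq_trace {n : ℕ} {A B : Matrix (Fin n) (Fin n) ℝ} (hB : B.IsSymm) :
    ∑ i, ∑ j, A i j * B i j = (A * B).trace := by
  simp only [Matrix.trace, Matrix.diag_apply, Matrix.mul_apply]
  exact Finset.sum_congr rfl fun i _ => Finset.sum_congr rfl fun j _ => by rw [hB.apply]

theorem sum_raisedDensity_mul {γ T : Matrix (Fin 3) (Fin 3) ℝ} (hγ : γ.IsSymm) (hd : γ.det ≠ 0)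
    (hT : T.IsSymm) (h : ∑ i, ∑ j, γ⁻¹ i j * T i j = 0) :
    ∑ i, ∑ j, raisedDensity γ T i j * γ i j = 0 := by
  rw [sum_sum_mul_eq_trace hγ, raisedDensity_mul hd, Matrix.trace_smul, ← sum_sum_mul_eq_trace hT,
    h, smul_zero]

variable {g : EuclideanSpace ℝ (Fin 4) → Matrix (Fin 4) (Fin 4) ℝ}
  {x : EuclideanSpace ℝ (Fin 3)}

/-- The dual `(1/2) ε^{cab} W(e_i, n, e_a, e_b)` of the mixed components. -/
noncomputable def mixedDual (g : EuclideanSpace ℝ (Fin 4) → Matrix (Fin 4) (Fin 4) ℝ)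
    (x : EuclideanSpace ℝ (Fin 3)) : Matrix (Fin 3) (Fin 3) ℝ :=
  Matrix.of fun i c => weylMixed g x i (c + 1) (c + 2)

/-- The double dual `(1/4) ε^{cab} ε^{djl} W(e_j, e_l, e_a, e_b)` of the tangential components. -/
noncomputable def tangentialDual (g : EuclideanSpace ℝ (Fin 4) → Matrix (Fin 4) (Fin 4) ℝ)
    (x : EuclideanSpace ℝ (Fin 3)) : Matrix (Fin 3) (Fin 3) ℝ :=
  Matrix.of fun c d => weylTangential g x (d + 1) (d + 2) (c + 1) (c + 2)

namespace IsWeylFieldAt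

/-- The trace of W(e_j, n, e_a, e_b) over j and a is dual to the antisymmetric part of this matrix.
Tracelessness of the mixed components therefore means symmetry of B. -/
theorem inv_mul_mixedDual_isSymm (hW : IsWeylFieldAt g (slicePt x)) (h : IsSpacelikeAt g x) :
    ((inducedMetric g x)⁻¹ * mixedDual g x).IsSymm := by
  have hs := (inv_isSymm h.induced_isMetricAt.symm.self_of_nhds).apply
  have t0 := hW.mixed_trace h 0
  have t1 := hW.mixed_trace h 1
  have t2 := hW.mixed_trace h 2
  have a0 : ∀ j a, weylMixed g x j a a = 0 := fun j a => by linarith [hW.mixed_antisymm j a a]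
  have a1 := fun j => hW.mixed_antisymm j 1 0
  have a2 := fun j => hW.mixed_antisymm j 0 2
  have a3 := fun j => hW.mixed_antisymm j 2 1
  have s1 := hs 0 1
  have s2 := hs 0 2
  have s3 := hs 1 2
  have e1 : (1 : Fin 3) + 1 = 2 := rfl
  have e2 : (2 : Fin 3) + 1 = 0 := rfl
  have e3 : (1 : Fin 3) + 2 = 0 := rfl
  have e4 : (2 : Fin 3) + 2 = 1 := rfl
  simp only [Fin.sum_univ_three, a0, a1, a2, a3, s1, s2, s3] at t0 t1 t2
  refine Matrix.IsSymm.ext fun i j => ?_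
  fin_cases i <;> fin_cases j <;>
    simp [Matrix.mul_apply, Fin.sum_univ_three, mixedDual, e1, e2, e3, e4, s1, s2, s3] <;> linarith

theorem magneticPart_eq_mul (hW : IsWeylFieldAt g (slicePt x)) (h : IsSpacelikeAt g x) :
    magneticPart g x =
      (Real.sqrt (inducedMetric g x).det)⁻¹ • (mixedDual g x * inducedMetric g x) := by
  ext i j
  rw [hW.magneticPart_eq h, Matrix.smul_apply, Matrix.mul_apply, smul_eq_mul]
  rfl

theorem magneticPart_isSymm (hW : IsWeylFieldAt g (slicePt x)) (h : IsSpacelikeAt g x) :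
    (magneticPart g x).IsSymm := by
  have h1 := hW.inv_mul_mixedDual_isSymm h
  have h2 := h.induced_isMetricAt.symm.self_of_nhds
  have h3 : mixedDual g x * inducedMetric g x = inducedMetric g x *
      ((inducedMetric g x)⁻¹ * mixedDual g x) * inducedMetric g x := by
    rw [← Matrix.mul_assoc, Matrix.mul_nonsing_inv _ h.det_induced_pos.ne'.isUnit, Matrix.one_mul]
  rw [hW.magneticPart_eq_mul h, h3]
  unfold Matrix.IsSymm at *
  rw [Matrix.transpose_smul, Matrix.transpose_mul, Matrix.transpose_mul, h1, h2]
  simp only [Matrix.mul_assoc]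

theorem sqrt_det_ne (h : IsSpacelikeAt g x) : Real.sqrt (inducedMetric g x).det ≠ 0 :=
  (Real.sqrt_pos.2 h.det_induced_pos).ne'

/-- The density √γ B^c_j is a bare Weyl component, with no factor of the metric, so its coordinate
divergence is a cyclic sum of Bianchi type. The transpose comes from the symmetry of B. -/
theorem magneticPart_density (hW : IsWeylFieldAt g (slicePt x)) (h : IsSpacelikeAt g x) :
    raisedDensity (inducedMetric g x) (magneticPart g x) * inducedMetric g x =
      (mixedDual g x).transpose := by
  have h0 : (magneticPart g x).transpose = magneticPart g x := hW.magneticPart_isSymm h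
  have h2 : (inducedMetric g x).transpose = inducedMetric g x :=
    h.induced_isMetricAt.symm.self_of_nhds
  rw [raisedDensity_mul h.det_induced_pos.ne', ← h0, hW.magneticPart_eq_mul h,
    Matrix.transpose_smul, Matrix.transpose_mul, h2, Matrix.mul_smul, smul_smul,
    mul_inv_cancel₀ (sqrt_det_ne h), one_smul, ← Matrix.mul_assoc,
    Matrix.nonsing_inv_mul _ h.det_induced_pos.ne'.isUnit, Matrix.one_mul]

theorem magneticPart_trace (hW : IsWeylFieldAt g (slicePt x)) (h : IsSpacelikeAt g x) :
    ∑ i, ∑ j, (inducedMetric g x)⁻¹ i j * magneticPart g x i j = 0 := by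
  have hs := inv_isSymm h.induced_isMetricAt.symm.self_of_nhds
  have hc := hW.mixed_cyclic 0 1 2
  have e1 : (1 : Fin 3) + 1 = 2 := rfl
  have e2 : (2 : Fin 3) + 1 = 0 := rfl
  have e3 : (1 : Fin 3) + 2 = 0 := rfl
  have e4 : (2 : Fin 3) + 2 = 1 := rfl
  rw [sum_sum_mul_eq_trace (hW.magneticPart_isSymm h), Matrix.trace_mul_comm,
    hW.magneticPart_eq_mul h, Matrix.smul_mul, Matrix.mul_assoc,
    Matrix.mul_nonsing_inv _ h.det_induced_pos.ne'.isUnit, Matrix.mul_one, Matrix.trace_smul]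
  have : (mixedDual g x).trace = 0 := by
    rw [Matrix.trace_fin_three]
    simpa [mixedDual, e1, e2, e3, e4] using hc
  rw [this, smul_zero]

theorem electricPart_isSymm (hW : IsWeylFieldAt g (slicePt x)) : (electricPart g x).IsSymm :=
  Matrix.IsSymm.ext fun i j => hW.electricPart_symm j i

/-- By `sum_adjugate_mul`, det γ · E = γGγ - tγ with t the γ-trace of G. Tracelessness of E forces t
= 0, so E is the double dual of the tangential part up to powers of det γ. -/
theorem electricPart_density (hW : IsWeylFieldAt g (slicePt x)) (h : IsSpacelikeAt g x) :
    raisedDensity (inducedMetric g x) (electricPart g x) =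
      (Real.sqrt (inducedMetric g x).det)⁻¹ • tangentialDual g x := by
  have hd := h.det_induced_pos
  have hs := h.induced_isMetricAt.symm.self_of_nhds
  set γ := inducedMetric g x
  set G := tangentialDual g x
  have hu := hd.ne'.isUnit
  set t := ∑ c, ∑ d, γ c d * G c d with ht
  have h1 : γ.det • electricPart g x = γ * G * γ - t • γ := by
    ext l b
    have e := sum_adjugate_mul hs (fun j l a b => hW.antisymm_left j.succ l.succ a.succ b.succ)
      (fun j l a b => hW.antisymm_right j.succ l.succ a.succ b.succ) l b
    have e2 : ∑ c, ∑ d, γ l c * weyl g (slicePt x) (d + 1).succ (d + 2).succ (c + 1).succ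
        (c + 2).succ * γ d b = (γ * G * γ) l b := by
      simp only [Matrix.mul_apply, Finset.sum_mul]
      rw [Finset.sum_comm]
      rfl
    rw [e2] at e
    change _ = γ l b * t - _ at e
    simp only [Matrix.smul_apply, Matrix.sub_apply, smul_eq_mul]
    rw [hW.electricPart_eq h]
    have e3 : γ.det * ∑ j, ∑ a, γ⁻¹ j a * weylTangential g x j l a b =
        ∑ j, ∑ a, γ.adjugate j a * weylTangential g x j l a b := by
      simp only [Finset.mul_sum, Matrix.inv_def, Ring.inverse_eq_inv', Matrix.smul_apply,
        smul_eq_mul]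
      refine Finset.sum_congr rfl fun j _ => Finset.sum_congr rfl fun a _ => ?_
      field_simp
    have e4 : ∑ j, ∑ a, γ.adjugate j a * weylTangential g x j l a b = γ l b * t - (γ * G * γ) l b := e
    linear_combination (-1) * e3 - e4
  -- Tracing `h1` with γ⁻¹ gives 0 = t - 3t.
  have h2 : t = 0 := by
    have e := congrArg (fun A => (γ⁻¹ * A).trace) h1
    simp only [Matrix.mul_smul, Matrix.trace_smul, Matrix.mul_sub, Matrix.trace_sub] at e
    have hE := hW.electricPart_trace h
    rw [sum_sum_mul_eq_trace hW.electricPart_isSymm] at hE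
    have e5 : (γ⁻¹ * (γ * G * γ)).trace = t := by
      rw [← Matrix.mul_assoc, ← Matrix.mul_assoc, Matrix.nonsing_inv_mul _ hu, Matrix.one_mul,
        ← sum_sum_mul_eq_trace hs]
      exact Finset.sum_congr rfl fun j _ => Finset.sum_congr rfl fun a _ => mul_comm _ _
    rw [hE, e5, Matrix.nonsing_inv_mul _ hu, Matrix.trace_one] at e
    simp at e
    linarith
  rw [h2, zero_smul, sub_zero] at h1
  have h3 : electricPart g x = γ.det⁻¹ • (γ * G * γ) := by
    rw [← h1, smul_smul, inv_mul_cancel₀ hd.ne', one_smul]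
  rw [raisedDensity, h3, Matrix.mul_smul, Matrix.smul_mul, smul_smul, Matrix.mul_assoc γ G γ,
    ← Matrix.mul_assoc, Matrix.nonsing_inv_mul _ hu, Matrix.one_mul, Matrix.mul_assoc,
    Matrix.mul_nonsing_inv _ hu, Matrix.mul_one]
  congr 1
  have : Real.sqrt γ.det ^ 2 = γ.det := Real.sq_sqrt hd.le
  have h0 := (Real.sqrt_pos.2 hd).ne'
  field_simp
  exact this

/-- The source `K × E` of the divergence of the magnetic part. -/
noncomputable def _root_.magneticSource (g : EuclideanSpace ℝ (Fin 4) → Matrix (Fin 4) (Fin 4) ℝ)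
    (j : Fin 3) (x : EuclideanSpace ℝ (Fin 3)) : ℝ :=
  - ∑ c : Fin 3, ∑ l, ∑ k, (inducedMetric g x)⁻¹ l k * extrinsicCurv g x c k *
    weylTangential g x j l (c + 1) (c + 2)

/-- The source `K × B` of the divergence of the electric part. -/
noncomputable def _root_.electricSource (g : EuclideanSpace ℝ (Fin 4) → Matrix (Fin 4) (Fin 4) ℝ)
    (j : Fin 3) (x : EuclideanSpace ℝ (Fin 3)) : ℝ :=
  (Real.sqrt (inducedMetric g x).det)⁻¹ * ∑ c, ∑ d,
    (extrinsicCurv g x c (d + 1) * mixedDual g x (d + 2) c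
      - extrinsicCurv g x c (d + 2) * mixedDual g x (d + 1) c) * inducedMetric g x d j

/-- The constraint equation for the magnetic part. -/
theorem magnetic_constraint (hWe : ∀ᶠ y in 𝓝 x, IsWeylFieldAt g (slicePt y))
    (he : ∀ᶠ y in 𝓝 x, IsSpacelikeAt g y) (j : Fin 3) :
    ∑ c, pderiv c (fun y => (raisedDensity (inducedMetric g y) (magneticPart g y)
        * inducedMetric g y) c j) x =
      (1 / 2) * ∑ c, ∑ k, raisedDensity (inducedMetric g x) (magneticPart g x) c k
        * pderiv j (fun y => inducedMetric g y c k) x + magneticSource g j x := by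
  have hW := hWe.self_of_nhds
  have h := he.self_of_nhds
  have e1 : ∀ c, pderiv c (fun y => (raisedDensity (inducedMetric g y) (magneticPart g y)
        * inducedMetric g y) c j) x = pderiv c (fun y => weylMixed g y j (c + 1) (c + 2)) x :=
    fun c => pderiv_congr c (by
      filter_upwards [hWe, he] with y hWy hy
      rw [hWy.magneticPart_density hy]
      rfl)
  have hm := h.induced_isMetricAt
  rw [← sum_christoffel_mul_symm hm (raisedDensity_isSymm hm.symm.self_of_nhds
    (hW.magneticPart_isSymm h)), hW.magneticPart_density h]
  simp only [e1]
  -- The cyclic sum over the distinct indices 0, 1, 2 is exactly the sum of ∂_c applied to the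
  -- component with pair (c+1, c+2).
  have hb := hW.mixed_bianchi h j 0 1 2
  simp only [magneticSource, mixedDual, Matrix.transpose_apply, Matrix.of_apply]
  rw [Fin.sum_univ_three, Fin.sum_univ_three, Fin.sum_univ_three (fun c : Fin 3 =>
    ∑ l, ∑ k, (inducedMetric g x)⁻¹ l k * extrinsicCurv g x c k *
    weylTangential g x j l (c + 1) (c + 2))]
  refine hb.trans ?_
  have e1 : (1 : Fin 3) + 1 = 2 := rfl
  have e2 : (2 : Fin 3) + 1 = 0 := rfl
  have e3 : (1 : Fin 3) + 2 = 0 := rfl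
  have e4 : (2 : Fin 3) + 2 = 1 := rfl
  simp only [zero_add, e1, e2, e3, e4]
  ring

/-- Differentiate s · s · det γ = 1 for s = (det γ)^{-1/2} and apply Jacobi's formula. -/
theorem pderiv_inv_sqrt_det (h : IsSpacelikeAt g x) (c : Fin 3) :
    DifferentiableAt ℝ (fun y => (Real.sqrt (inducedMetric g y).det)⁻¹) x ∧
    pderiv c (fun y => (Real.sqrt (inducedMetric g y).det)⁻¹) x =
      - (Real.sqrt (inducedMetric g x).det)⁻¹ * ∑ m, christoffel (inducedMetric g) x m c m := by
  have hm := h.induced_isMetricAt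
  have hpos := h.det_induced_pos
  have hdet := contDiffAt_matrix_det hm.contDiffAt
  have hd : DifferentiableAt ℝ (fun y => (Real.sqrt (inducedMetric g y).det)⁻¹) x :=
    ((hdet.sqrt hpos.ne').inv (sqrt_det_ne h)).differentiableAt_infty
  refine ⟨hd, ?_⟩
  have h1 : (fun y => (Real.sqrt (inducedMetric g y).det)⁻¹ * (Real.sqrt (inducedMetric g y).det)⁻¹
      * (inducedMetric g y).det) =ᶠ[𝓝 x] fun _ => 1 := by
    filter_upwards [h.posDef] with y hy
    have h2 := Real.mul_self_sqrt hy.det_pos.le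
    have h3 := (Real.sqrt_pos.2 hy.det_pos).ne'
    rw [← mul_inv, h2, inv_mul_cancel₀ hy.det_pos.ne']
  have h2 := pderiv_congr c h1
  rw [pderiv_const, pderiv_mul c (hd.fun_mul hd) hdet.differentiableAt_infty, pderiv_mul c hd hd,
    pderiv_det hm] at h2
  have h3 := sqrt_det_ne h
  have h4 := hpos.ne'
  set s := (Real.sqrt (inducedMetric g x).det)⁻¹ with hs
  have h5 : s ≠ 0 := inv_ne_zero h3
  have h6 : 2 * s * (inducedMetric g x).det ≠ 0 := by positivity
  apply mul_left_cancel₀ h6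
  linear_combination h2

/-- Bianchi identity for the pair (d+1, d+2) dualised to d. A connection term acting on an
antisymmetric pair becomes, on the dual index, its trace minus Γ^d_{cm}. -/
theorem sum_pderiv_tangentialDual (hW : IsWeylFieldAt g (slicePt x)) (h : IsSpacelikeAt g x)
    (d : Fin 3) : ∑ c, pderiv c (fun y => tangentialDual g y c d) x =
    ∑ c, ((∑ m, christoffel (inducedMetric g) x m c m) * tangentialDual g x c d
      - ∑ m, christoffel (inducedMetric g) x d c m * tangentialDual g x c m
      + (extrinsicCurv g x c (d + 1) * mixedDual g x (d + 2) c
        - extrinsicCurv g x c (d + 2) * mixedDual g x (d + 1) c)) := by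
  have hl : ∀ j l a b, weylTangential g x j l a b = - weylTangential g x l j a b :=
    fun j l a b => hW.antisymm_left j.succ l.succ a.succ b.succ
  have l0 : ∀ j a b, weylTangential g x j j a b = 0 := fun j a b => by linarith [hl j j a b]
  have l1 := hl 1 0
  have l2 := hl 0 2
  have l3 := hl 2 1
  have hb := hW.tangential_bianchi h (d + 1) (d + 2) 0 1 2
  have e1 : (1 : Fin 3) + 1 = 2 := rfl
  have e2 : (2 : Fin 3) + 1 = 0 := rfl
  have e3 : (1 : Fin 3) + 2 = 0 := rfl
  have e4 : (2 : Fin 3) + 2 = 1 := rfl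
  have hL : ∑ c, pderiv c (fun y => tangentialDual g y c d) x = _ :=
    (Fin.sum_univ_three _).trans hb
  rw [hL]
  simp only [Fin.sum_univ_three, tangentialDual, mixedDual, Matrix.of_apply]
  fin_cases d <;> simp [e1, e2, e3, e4, l0, l1, l2, l3] <;> ring

/-- The constraint equation for the electric part. -/
theorem electric_constraint (hWe : ∀ᶠ y in 𝓝 x, IsWeylFieldAt g (slicePt y))
    (he : ∀ᶠ y in 𝓝 x, IsSpacelikeAt g y) (j : Fin 3) :
    ∑ c, pderiv c (fun y => (raisedDensity (inducedMetric g y) (electricPart g y)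
        * inducedMetric g y) c j) x =
      (1 / 2) * ∑ c, ∑ k, raisedDensity (inducedMetric g x) (electricPart g x) c k
        * pderiv j (fun y => inducedMetric g y c k) x + electricSource g j x := by
  have hW := hWe.self_of_nhds
  have h := he.self_of_nhds
  have hm := h.induced_isMetricAt
  have hG : ∀ c d, DifferentiableAt ℝ (fun y => tangentialDual g y c d) x := fun c d =>
    (hW.tangential_contDiffAt (d + 1) (d + 2) (c + 1) (c + 2)).differentiableAt_infty
  have hγ := fun c d => (hm.contDiffAt c d).differentiableAt_infty
  have hGγ : ∀ c, DifferentiableAt ℝ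
      (fun y => ∑ d, tangentialDual g y c d * inducedMetric g y d j) x :=
    fun c => DifferentiableAt.fun_sum fun d _ => (hG c d).fun_mul (hγ d j)
  have e1 : ∀ c, pderiv c (fun y => (raisedDensity (inducedMetric g y) (electricPart g y)
        * inducedMetric g y) c j) x = - (Real.sqrt (inducedMetric g x).det)⁻¹
          * (∑ m, christoffel (inducedMetric g) x m c m)
          * (∑ d, tangentialDual g x c d * inducedMetric g x d j)
        + (Real.sqrt (inducedMetric g x).det)⁻¹ * ∑ d, (pderiv c (fun y => tangentialDual g y c d) x
          * inducedMetric g x d j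
          + tangentialDual g x c d * pderiv c (fun y => inducedMetric g y d j) x) := by
    intro c
    have e : (fun y => (raisedDensity (inducedMetric g y) (electricPart g y)
        * inducedMetric g y) c j) =ᶠ[𝓝 x] fun y => (Real.sqrt (inducedMetric g y).det)⁻¹
          * ∑ d, tangentialDual g y c d * inducedMetric g y d j := by
      filter_upwards [hWe, he] with y hWy hy
      rw [hWy.electricPart_density hy, Matrix.smul_mul, Matrix.smul_apply, Matrix.mul_apply,
        smul_eq_mul]
    rw [pderiv_congr c e, pderiv_mul c (pderiv_inv_sqrt_det h c).1 (hGγ c),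
      (pderiv_inv_sqrt_det h c).2, pderiv_sum _ _ fun d _ => (hG c d).fun_mul (hγ d j)]
    congr 2
    exact Finset.sum_congr rfl fun d _ => pderiv_mul c (hG c d) (hγ d j)
  rw [← sum_christoffel_mul_symm hm (raisedDensity_isSymm hm.symm.self_of_nhds
    hW.electricPart_isSymm), hW.electricPart_density h, Matrix.smul_mul]
  have hs := hm.symm.self_of_nhds.apply
  have b0 := hW.sum_pderiv_tangentialDual h 0
  have b1 := hW.sum_pderiv_tangentialDual h 1
  have b2 := hW.sum_pderiv_tangentialDual h 2
  rw [Finset.sum_congr rfl fun c _ => e1 c]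
  simp only [hm.pderiv_eq, electricSource, Matrix.smul_apply, Matrix.mul_apply, smul_eq_mul,
    fun k => hs k j]
  simp only [Fin.sum_univ_three] at b0 b1 b2 ⊢
  -- The trace of Γ in the derivative of (det γ)^{-1/2} cancels the one in the divergence of the
  -- double dual. The term -Γ^d_{cm} cancels half of ∂_c γ_{dj}, and the other half is the
  -- right-hand side.
  linear_combination (Real.sqrt (inducedMetric g x).det)⁻¹ * (inducedMetric g x 0 j * b0
    + inducedMetric g x 1 j * b1 + inducedMetric g x 2 j * b2)

end IsWeylFieldAt

end ConstraintEquations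

/-! ### Polar coordinates, the divergence theorem on annuli, and limits of fluxes. -/

section Flux

theorem norm_smul_sphere {r : ℝ} (hr : 0 < r)
    (u : Metric.sphere (0 : EuclideanSpace ℝ (Fin 3)) 1) : ‖r • u.1‖ = r := by
  rw [norm_smul, Real.norm_of_nonneg hr.le, norm_eq_of_mem_sphere u, mul_one]

theorem sum_mul_self_eq_norm_sq (x : EuclideanSpace ℝ (Fin 3)) : ∑ i, x i * x i = ‖x‖ ^ 2 := by
  rw [EuclideanSpace.norm_sq_eq]
  exact Finset.sum_congr rfl fun i _ => by rw [Real.norm_eq_abs, sq_abs, sq]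

theorem continuousOn_polar {R₀ : ℝ} (hR₀ : 0 ≤ R₀) {F : EuclideanSpace ℝ (Fin 3) → ℝ}
    (hF : ∀ x, R₀ < ‖x‖ → ContinuousAt F x) :
    ContinuousOn (fun q : ℝ × Metric.sphere (0 : EuclideanSpace ℝ (Fin 3)) 1 => F (q.1 • q.2.1))
      (Set.Ioi R₀ ×ˢ Set.univ) := by
  intro q hq
  have h1 : R₀ < q.1 := hq.1
  have h2 : ContinuousAt F (q.1 • q.2.1) :=
    hF _ (by rwa [norm_smul_sphere (hR₀.trans_lt h1)])
  exact (ContinuousAt.comp (f := fun q : ℝ × Metric.sphere (0 : EuclideanSpace ℝ (Fin 3)) 1 =>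
    q.1 • q.2.1) h2 (by fun_prop)).continuousWithinAt

theorem continuousOn_sphere_integral {R₀ : ℝ} (hR₀ : 0 ≤ R₀) {F : EuclideanSpace ℝ (Fin 3) → ℝ}
    (hF : ∀ x, R₀ < ‖x‖ → ContinuousAt F x) :
    ContinuousOn (fun r : ℝ => ∫ u, F (r • u.1)
      ∂(volume : Measure (EuclideanSpace ℝ (Fin 3))).toSphere) (Set.Ioi R₀) :=
  continuousOn_integral_of_compact_support (k := Set.univ) isCompact_univ
    (continuousOn_polar hR₀ hF) fun _ x _ hx => absurd (Set.mem_univ x) hx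

theorem integrable_sphere {R₀ : ℝ} (hR₀ : 0 ≤ R₀) {F : EuclideanSpace ℝ (Fin 3) → ℝ}
    (hF : ∀ x, R₀ < ‖x‖ → ContinuousAt F x) {r : ℝ} (hr : R₀ < r) :
    Integrable (fun u => F (r • u.1))
      (volume : Measure (EuclideanSpace ℝ (Fin 3))).toSphere := by
  have h : Continuous fun u : Metric.sphere (0 : EuclideanSpace ℝ (Fin 3)) 1 => F (r • u.1) := by
    refine continuous_iff_continuousAt.2 fun u => ?_
    exact ContinuousAt.comp (f := fun u : Metric.sphere (0 : EuclideanSpace ℝ (Fin 3)) 1 =>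
      r • u.1) (hF _ (by rwa [norm_smul_sphere (hR₀.trans_lt hr)])) (by fun_prop)
  exact h.integrable_of_hasCompactSupport (HasCompactSupport.of_compactSpace _)

/-- Integration in polar coordinates. -/
theorem integral_polar {F : EuclideanSpace ℝ (Fin 3) → ℝ} (hF : Integrable F) :
    ∫ x, F x = ∫ r in Set.Ioi (0 : ℝ), r ^ 2 * ∫ u, F (r • u.1)
      ∂(volume : Measure (EuclideanSpace ℝ (Fin 3))).toSphere := by
  set μ : Measure (EuclideanSpace ℝ (Fin 3)) := volume
  have hmp := μ.measurePreserving_homeomorphUnitSphereProd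
  have hdim : Module.finrank ℝ (EuclideanSpace ℝ (Fin 3)) - 1 = 2 := by simp
  rw [hdim] at hmp
  have hemb := Homeomorph.measurableEmbedding (homeomorphUnitSphereProd (EuclideanSpace ℝ (Fin 3)))
  set G : Metric.sphere (0 : EuclideanSpace ℝ (Fin 3)) 1 × Set.Ioi (0 : ℝ) → ℝ :=
    fun q => F (q.2.1 • q.1.1) with hG
  have hcomp : ∀ x : ({0}ᶜ : Set (EuclideanSpace ℝ (Fin 3))),
      G (homeomorphUnitSphereProd _ x) = F x.1 := by
    intro x
    have := congrArg Subtype.val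
      ((homeomorphUnitSphereProd (EuclideanSpace ℝ (Fin 3))).symm_apply_apply x)
    rw [homeomorphUnitSphereProd_symm_apply_coe] at this
    simp only [hG, this]
  have hGi : Integrable G (μ.toSphere.prod (Measure.volumeIoiPow 2)) := by
    rw [← hmp.integrable_comp_emb hemb]
    have : G ∘ homeomorphUnitSphereProd (EuclideanSpace ℝ (Fin 3)) = fun x => F x.1 :=
      funext hcomp
    rw [this]
    have h2 := hF.integrableOn (s := ({0}ᶜ : Set (EuclideanSpace ℝ (Fin 3))))
    rwa [integrableOn_iff_comap_subtypeVal (measurableSet_singleton _).compl] at h2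
  calc ∫ x, F x ∂μ = ∫ x : ({0}ᶜ : Set (EuclideanSpace ℝ (Fin 3))), F x.1 ∂(μ.comap (↑)) := by
        rw [integral_subtype_comap (measurableSet_singleton _).compl F,
          restrict_compl_singleton]
    _ = ∫ q, G q ∂μ.toSphere.prod (Measure.volumeIoiPow 2) := by
        rw [← hmp.integral_comp hemb]
        exact integral_congr_ae (Eventually.of_forall fun x => (hcomp x).symm)
    _ = ∫ r : Set.Ioi (0 : ℝ), ∫ u, F (r.1 • u.1) ∂μ.toSphere ∂(Measure.volumeIoiPow 2) :=
        integral_prod_symm _ hGi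
    _ = _ := by
        simp only [Measure.volumeIoiPow, ENNReal.ofReal]
        rw [integral_withDensity_eq_integral_smul,
          integral_subtype_comap measurableSet_Ioi fun a : ℝ =>
            Real.toNNReal (a ^ 2) • ∫ u, F (a • u.1) ∂μ.toSphere]
        · refine setIntegral_congr_fun measurableSet_Ioi fun r hr => ?_
          simp only [NNReal.smul_def, smul_eq_mul]
          rw [Real.coe_toNNReal _ (by positivity)]
        · exact (measurable_subtype_coe.pow_const _).real_toNNReal

/-- The spherical integrals of the divergence of a tangential field vanish. -/
theorem sphere_integral_div_tangential {R₀ : ℝ} (hR₀ : 0 < R₀)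
    {T : Fin 3 → EuclideanSpace ℝ (Fin 3) → ℝ}
    (hT : ∀ i x, R₀ < ‖x‖ → ContDiffAt ℝ ∞ (T i) x)
    (htan : ∀ x, R₀ < ‖x‖ → ∑ i, x i * T i x = 0) :
    ∀ᵐ r : ℝ, r ∈ Set.Ioi R₀ → r ^ 2 * ∫ u, ∑ i, pderiv i (T i) (r • u.1)
      ∂(volume : Measure (EuclideanSpace ℝ (Fin 3))).toSphere = 0 := by
  have hdiv : ∀ x, R₀ < ‖x‖ → ContinuousAt (fun x => ∑ i, pderiv i (T i) x) x := fun x hx =>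
    tendsto_finsetSum _ fun i _ => ((hT i x hx).pderiv i).continuousAt
  -- Fundamental lemma of the calculus of variations in the radius: it suffices to test against
  -- smooth ψ with compact support in (R₀, ∞). This is why the conclusion holds for almost every r.
  refine isOpen_Ioi.ae_eq_zero_of_integral_contDiff_smul_eq_zero ?_ ?_
  · refine ContinuousOn.locallyIntegrableOn ?_ measurableSet_Ioi
    exact (continuousOn_pow 2).mul (continuousOn_sphere_integral hR₀.le hdiv)
  · intro ψ hψ hψc hψs
    -- The test function as a radial function on space. It is smooth at the origin because it
    -- vanishes near it, which uses R₀ > 0.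
    set f : EuclideanSpace ℝ (Fin 3) → ℝ := fun x => ψ ‖x‖ with hf
    have hψ0 : ∀ r ≤ R₀, ψ =ᶠ[𝓝 r] 0 := fun r hr =>
      notMem_tsupport_iff_eventuallyEq.1 fun h => not_lt.2 hr (hψs h)
    have hft : tsupport f ⊆ {x | R₀ < ‖x‖} := by
      intro x hx
      by_contra hn
      refine (notMem_tsupport_iff_eventuallyEq.2 ?_) hx
      have := hψ0 ‖x‖ (not_lt.1 hn)
      exact (continuous_norm.continuousAt (x := x)).eventually this
    have hfc : HasCompactSupport f := by
      obtain ⟨R, hR⟩ := hψc.isCompact.isBounded.subset_closedBall 0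
      refine HasCompactSupport.of_support_subset_isCompact
        (isCompact_closedBall (0 : EuclideanSpace ℝ (Fin 3)) R) fun x hx => ?_
      have := hR (subset_tsupport _ (show ‖x‖ ∈ Function.support ψ from hx))
      simpa using this
    have hfd : ∀ x, x ≠ 0 → ContDiffAt ℝ ∞ f x := fun x hx =>
      hψ.contDiffAt.comp x (contDiffAt_norm ℝ hx)
    have hfz : f =ᶠ[𝓝 0] 0 := by
      refine notMem_tsupport_iff_eventuallyEq.1 fun h => ?_
      have := hft h
      simp at this
      linarith
    have hfd' : ContDiff ℝ ∞ f := contDiff_iff_contDiffAt.2 fun x => by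
      by_cases hx : x = 0
      · subst hx
        exact contDiffAt_const.congr_of_eventuallyEq hfz
      · exact hfd x hx
    have hint : ∀ G : EuclideanSpace ℝ (Fin 3) → ℝ, (∀ x, R₀ < ‖x‖ → ContinuousAt G x) →
        (Function.support G ⊆ tsupport f) → Integrable G := by
      intro G hG hs
      rw [← integrableOn_iff_integrable_of_support_subset hs]
      exact ContinuousOn.integrableOn_compact hfc.isCompact fun x hx =>
        (hG x (hft hx)).continuousWithinAt
    have hsupp : ∀ G : EuclideanSpace ℝ (Fin 3) → ℝ,
        Function.support (fun x => f x * G x) ⊆ tsupport f := fun G x hx =>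
      subset_tsupport f (left_ne_zero_of_mul hx)
    have hsupp' : ∀ i, ∀ G : EuclideanSpace ℝ (Fin 3) → ℝ,
        Function.support (fun x => pderiv i f x * G x) ⊆ tsupport f := fun i G x hx => by
      have h1 := left_ne_zero_of_mul hx
      by_contra hn
      apply h1
      rw [pderiv_congr i (notMem_tsupport_iff_eventuallyEq.1 hn)]
      exact pderiv_const i 0
    have hi1 : ∀ i, Integrable fun x => f x * pderiv i (T i) x := fun i =>
      hint _ (fun x hx => hfd'.continuous.continuousAt.mul ((hT i x hx).pderiv i).continuousAt)
        (hsupp _)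
    have hi2 : ∀ i, Integrable fun x => pderiv i f x * T i x := fun i =>
      hint _ (fun x hx => (hfd'.contDiffAt.pderiv i).continuousAt.mul (hT i x hx).continuousAt)
        (hsupp' i _)
    have hi3 : ∀ i, Integrable fun x => f x * T i x := fun i =>
      hint _ (fun x hx => hfd'.continuous.continuousAt.mul (hT i x hx).continuousAt) (hsupp _)
    have hparts : ∀ i, ∫ x, f x * pderiv i (T i) x = - ∫ x, pderiv i f x * T i x := fun i =>
      integral_mul_fderiv_eq_neg_fderiv_mul_of_integrable (v := EuclideanSpace.single i 1)
        (hi2 i) (hi1 i) (hi3 i) (fun x _ => hfd'.contDiffAt.differentiableAt_infty)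
        fun x hx => (hT i x (hft hx)).differentiableAt_infty
    -- The gradient of a radial function is radial, hence orthogonal to T; after integration by
    -- parts nothing remains.
    have hzero : ∀ x, ∑ i, pderiv i f x * T i x = 0 := by
      intro x
      by_cases hx : R₀ < ‖x‖
      · have hx0 : x ≠ 0 := by rintro rfl; simp at hx; linarith
        have hpf : ∀ i, pderiv i f x = deriv ψ ‖x‖ * (‖x‖⁻¹ * x i) := by
          intro i
          have hn : HasFDerivAt (fun y : EuclideanSpace ℝ (Fin 3) => ‖y‖)
              (fderiv ℝ (fun y : EuclideanSpace ℝ (Fin 3) => ‖y‖) x) x :=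
            ((contDiffAt_norm (n := 1) ℝ hx0).differentiableAt (by simp)).hasFDerivAt
          have hn2 : pderiv i (fun y : EuclideanSpace ℝ (Fin 3) => ‖y‖ * ‖y‖) x = 2 * x i := by
            have : (fun y : EuclideanSpace ℝ (Fin 3) => ‖y‖ * ‖y‖) = fun y => ‖y‖ ^ 2 := by
              funext y; ring
            rw [this, pderiv, (hasStrictFDerivAt_norm_sq x).hasFDerivAt.fderiv]
            simp [EuclideanSpace.inner_single_right]
          rw [pderiv_mul i hn.differentiableAt hn.differentiableAt] at hn2
          have hψd : HasDerivAt ψ (deriv ψ ‖x‖) ‖x‖ :=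
            (hψ.differentiable (by simp)).differentiableAt.hasDerivAt
          have hc := hψd.comp_hasFDerivAt x hn
          have e : pderiv i f x = deriv ψ ‖x‖ * pderiv i (fun y => ‖y‖) x := by
            unfold pderiv
            rw [show f = ψ ∘ fun y => ‖y‖ from rfl, hc.fderiv]
            simp
          rw [e]
          have hne : ‖x‖ ≠ 0 := norm_ne_zero_iff.2 hx0
          field_simp
          linear_combination deriv ψ ‖x‖ / 2 * hn2
        simp only [hpf]
        calc _ = deriv ψ ‖x‖ * ‖x‖⁻¹ * ∑ i, x i * T i x := by
              rw [Finset.mul_sum]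
              exact Finset.sum_congr rfl fun i _ => by ring
          _ = 0 := by rw [htan x hx, mul_zero]
      · refine Finset.sum_eq_zero fun i _ => ?_
        by_contra hn
        exact hx (hft (hsupp' i (T i) hn))
    have htot : ∫ x, f x * ∑ i, pderiv i (T i) x = 0 := by
      simp only [Finset.mul_sum]
      rw [integral_finsetSum _ fun i _ => hi1 i]
      simp only [hparts]
      rw [Finset.sum_neg_distrib, ← integral_finsetSum _ fun i _ => hi2 i]
      simp [hzero]
    have hitot : Integrable fun x => f x * ∑ i, pderiv i (T i) x := by
      simp only [Finset.mul_sum]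
      exact integrable_finsetSum _ fun i _ => hi1 i
    rw [integral_polar hitot] at htot
    rw [← htot, ← integral_indicator measurableSet_Ioi]
    congr 1
    funext r
    by_cases hr : 0 < r
    · rw [Set.indicator_of_mem (show r ∈ Set.Ioi (0 : ℝ) from hr)]
      simp only [hf, norm_smul_sphere hr, integral_const_mul, smul_eq_mul]
      ring
    · rw [Set.indicator_of_notMem (show r ∉ Set.Ioi (0 : ℝ) from hr),
        (hψ0 r (by linarith)).self_of_nhds]
      simp

theorem pderiv_coord {n : ℕ} (i j : Fin n) (x : EuclideanSpace ℝ (Fin n)) :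
    pderiv i (fun y => y j) x = if j = i then 1 else 0 := by
  have : HasFDerivAt (fun y : EuclideanSpace ℝ (Fin n) => y j)
      (EuclideanSpace.proj j : EuclideanSpace ℝ (Fin n) →L[ℝ] ℝ) x :=
    (EuclideanSpace.proj j : EuclideanSpace ℝ (Fin n) →L[ℝ] ℝ).hasFDerivAt
  rw [pderiv, this.fderiv]
  simp

theorem contDiff_coord {n : ℕ} (j : Fin n) :
    ContDiff ℝ ∞ (fun y : EuclideanSpace ℝ (Fin n) => y j) :=
  (EuclideanSpace.proj j : EuclideanSpace ℝ (Fin n) →L[ℝ] ℝ).contDiff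

theorem fderiv_apply_eq_sum {n : ℕ} (f : EuclideanSpace ℝ (Fin n) → ℝ)
    (x v : EuclideanSpace ℝ (Fin n)) : fderiv ℝ f x v = ∑ i, v i * pderiv i f x := by
  have hv : v = ∑ i, v i • EuclideanSpace.single i (1 : ℝ) := by
    ext j
    simp [Pi.single_apply]
  conv_lhs => rw [hv]
  simp [pderiv]

/-- The flux of the vector field `W` through the sphere of radius `r`. -/
noncomputable def sphereFlux (W : Fin 3 → EuclideanSpace ℝ (Fin 3) → ℝ) (r : ℝ) : ℝ :=
  ∫ u, (∑ i, W i (r • u.1) * u.1 i) * r ^ 2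
    ∂(volume : Measure (EuclideanSpace ℝ (Fin 3))).toSphere

/-- The divergence theorem for an annulus. -/
theorem sphereFlux_sub {R₀ : ℝ} (hR₀ : 0 < R₀) {W : Fin 3 → EuclideanSpace ℝ (Fin 3) → ℝ}
    (hW : ∀ i x, R₀ < ‖x‖ → ContDiffAt ℝ ∞ (W i) x) {a b : ℝ} (ha : R₀ < a) (hab : a ≤ b) :
    sphereFlux W b - sphereFlux W a = ∫ r in a..b, r ^ 2 * ∫ u, ∑ i, pderiv i (W i) (r • u.1)
      ∂(volume : Measure (EuclideanSpace ℝ (Fin 3))).toSphere := by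
  set σ := (volume : Measure (EuclideanSpace ℝ (Fin 3))).toSphere
  -- Decomposition W = ρx + T with T tangential to the spheres. Only ρx contributes to the flux.
  set ρ : EuclideanSpace ℝ (Fin 3) → ℝ := fun x => (∑ k, W k x * x k) / ‖x‖ ^ 2 with hρ
  have hne : ∀ x : EuclideanSpace ℝ (Fin 3), R₀ < ‖x‖ → ‖x‖ ≠ 0 := fun x hx => by linarith
  have hρs : ∀ x, R₀ < ‖x‖ → ContDiffAt ℝ ∞ ρ x := fun x hx =>
    (ContDiffAt.sum fun k _ => (hW k x hx).mul (contDiff_coord k).contDiffAt).div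
      (contDiff_norm_sq ℝ).contDiffAt (pow_ne_zero 2 (hne x hx))
  set T : Fin 3 → EuclideanSpace ℝ (Fin 3) → ℝ := fun i x => W i x - ρ x * x i with hTdef
  have hT : ∀ i x, R₀ < ‖x‖ → ContDiffAt ℝ ∞ (T i) x := fun i x hx =>
    (hW i x hx).sub ((hρs x hx).mul (contDiff_coord i).contDiffAt)
  have htan : ∀ x, R₀ < ‖x‖ → ∑ i, x i * T i x = 0 := by
    intro x hx
    have h1 : ∑ i, x i * T i x = ∑ i, W i x * x i - ρ x * ∑ i, x i * x i := by
      rw [Finset.mul_sum, ← Finset.sum_sub_distrib]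
      exact Finset.sum_congr rfl fun i _ => by simp only [hTdef]; ring
    rw [h1, sum_mul_self_eq_norm_sq, hρ]
    have := hne x hx
    field_simp
    ring
  -- The divergence of ρx. Along a ray r²Q is the derivative of r³ρ, so the radial part is settled
  -- by the fundamental theorem of calculus on each ray.
  set Q : EuclideanSpace ℝ (Fin 3) → ℝ := fun x => 3 * ρ x + ∑ i, x i * pderiv i ρ x with hQ
  have hQc : ∀ x, R₀ < ‖x‖ → ContinuousAt Q x := fun x hx =>
    (continuousAt_const.mul (hρs x hx).continuousAt).add (tendsto_finsetSum _ fun i _ =>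
      (contDiff_coord i).continuous.continuousAt.mul ((hρs x hx).pderiv i).continuousAt)
  have hdivT : ∀ x, R₀ < ‖x‖ → ∑ i, pderiv i (T i) x = ∑ i, pderiv i (W i) x - Q x := by
    intro x hx
    have h1 : ∀ i, pderiv i (T i) x = pderiv i (W i) x - (pderiv i ρ x * x i + ρ x) := by
      intro i
      have hc := (contDiff_coord (n := 3) i).contDiffAt.differentiableAt_infty (p := x)
      simp only [hTdef]
      rw [pderiv_sub i (hW i x hx).differentiableAt_infty
        ((hρs x hx).differentiableAt_infty.fun_mul hc),
        pderiv_mul i (hρs x hx).differentiableAt_infty hc, pderiv_coord]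
      simp
    simp only [h1, hQ, Fin.sum_univ_three]
    ring
  have hderiv : ∀ u : Metric.sphere (0 : EuclideanSpace ℝ (Fin 3)) 1, ∀ r, R₀ < r →
      HasDerivAt (fun s : ℝ => s ^ 3 * ρ (s • u.1)) (r ^ 2 * Q (r • u.1)) r := by
    intro u r hr
    have hx : R₀ < ‖r • u.1‖ := by rwa [norm_smul_sphere (hR₀.trans hr)]
    have h1 : HasDerivAt (fun s : ℝ => s • u.1) u.1 r := by
      simpa using (hasDerivAt_id r).smul_const u.1
    have h2 := (hρs _ hx).differentiableAt_infty.hasFDerivAt.comp_hasDerivAt r h1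
    have h3 := (hasDerivAt_pow 3 r).mul h2
    refine h3.congr_deriv ?_
    rw [fderiv_apply_eq_sum]
    simp only [hQ, PiLp.smul_apply, smul_eq_mul, Function.comp_apply, mul_add, Finset.mul_sum]
    congr 1
    · push_cast; ring
    · exact Finset.sum_congr rfl fun i _ => by ring
  have hflux : ∀ r, R₀ < r → sphereFlux W r = ∫ u, r ^ 3 * ρ (r • u.1) ∂σ := by
    intro r hr
    refine integral_congr_ae (Eventually.of_forall fun u => ?_)
    have hr0 : r ≠ 0 := by linarith
    simp only [hρ, norm_smul_sphere (hR₀.trans hr), PiLp.smul_apply, smul_eq_mul]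
    field_simp
    rw [Finset.sum_mul]
    exact Finset.sum_congr rfl fun i _ => by ring
  have hb : R₀ < b := ha.trans_le hab
  have hsub : Set.uIcc a b ⊆ Set.Ioi R₀ := fun r hr => by
    rw [Set.uIcc_of_le hab] at hr
    exact ha.trans_le hr.1
  have hρi : ∀ r, R₀ < r → Integrable (fun u => r ^ 3 * ρ (r • u.1)) σ := fun r hr =>
    (integrable_sphere hR₀.le (fun x hx => (hρs x hx).continuousAt) hr).const_mul _
  have hcont : ContinuousOn (fun q : ℝ × Metric.sphere (0 : EuclideanSpace ℝ (Fin 3)) 1 =>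
      q.1 ^ 2 * Q (q.1 • q.2.1)) (Set.Ioi R₀ ×ˢ Set.univ) :=
    (by fun_prop : Continuous fun q : ℝ × Metric.sphere (0 : EuclideanSpace ℝ (Fin 3)) 1 =>
      q.1 ^ 2).continuousOn.mul (continuousOn_polar hR₀.le hQc)
  have hFTC : ∀ u : Metric.sphere (0 : EuclideanSpace ℝ (Fin 3)) 1,
      ∫ r in a..b, r ^ 2 * Q (r • u.1) = b ^ 3 * ρ (b • u.1) - a ^ 3 * ρ (a • u.1) := by
    intro u
    refine intervalIntegral.integral_eq_sub_of_hasDerivAt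
      (fun r hr => hderiv u r (hsub hr)) (ContinuousOn.intervalIntegrable ?_)
    exact hcont.comp (f := fun r : ℝ => (r, u)) (by fun_prop) fun r hr => ⟨hsub hr, trivial⟩
  have hswap : ∫ r in a..b, ∫ u, r ^ 2 * Q (r • u.1) ∂σ =
      ∫ u, (∫ r in a..b, r ^ 2 * Q (r • u.1)) ∂σ := by
    refine intervalIntegral_integral_swap ?_
    rw [← Measure.restrict_univ (μ := σ), Measure.prod_restrict]
    have : IntegrableOn (fun q : ℝ × Metric.sphere (0 : EuclideanSpace ℝ (Fin 3)) 1 =>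
        q.1 ^ 2 * Q (q.1 • q.2.1)) (Set.uIcc a b ×ˢ Set.univ) (volume.prod σ) :=
      ContinuousOn.integrableOn_compact (isCompact_uIcc.prod isCompact_univ)
        (hcont.mono (Set.prod_mono hsub subset_rfl))
    exact this.mono_set (Set.prod_mono Set.uIoc_subset_uIcc subset_rfl)
  rw [hflux b hb, hflux a ha, ← integral_sub (hρi b hb) (hρi a ha)]
  simp only [← hFTC]
  rw [← hswap]
  -- Under the radial integral the almost-everywhere vanishing of the tangential contribution is
  -- enough.
  refine intervalIntegral.integral_congr_ae ?_
  filter_upwards [sphere_integral_div_tangential hR₀ hT htan] with r hr hrab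
  have hrR : R₀ < r := hsub (Set.uIoc_subset_uIcc hrab)
  have h0 := hr hrR
  have h1 : ∫ u, ∑ i, pderiv i (T i) (r • u.1) ∂σ =
      ∫ u, ∑ i, pderiv i (W i) (r • u.1) ∂σ - ∫ u, Q (r • u.1) ∂σ := by
    rw [← integral_sub (integrable_sphere hR₀.le (F := fun x => ∑ i, pderiv i (W i) x)
      (fun x hx => tendsto_finsetSum _ fun i _ => ((hW i x hx).pderiv i).continuousAt) hrR)
      (integrable_sphere hR₀.le hQc hrR)]
    refine integral_congr_ae (Eventually.of_forall fun u => ?_)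
    exact hdivT _ (by rwa [norm_smul_sphere (hR₀.trans hrR)])
  rw [h1] at h0
  rw [integral_const_mul]
  linarith

/-- If the divergence decays faster than `r⁻³`, the flux has a limit. -/
theorem tendsto_sphereFlux {R₀ δ : ℝ} (hR₀ : 0 < R₀) (hδ : 0 < δ)
    {W : Fin 3 → EuclideanSpace ℝ (Fin 3) → ℝ}
    (hW : ∀ i x, R₀ < ‖x‖ → ContDiffAt ℝ ∞ (W i) x)
    (hdiv : (fun x => ∑ i, pderiv i (W i) x) =O[cobounded (EuclideanSpace ℝ (Fin 3))]
      fun x => ‖x‖ ^ (-3 - δ)) :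
    ∃ q, Tendsto (sphereFlux W) atTop (𝓝 q) := by
  set σ := (volume : Measure (EuclideanSpace ℝ (Fin 3))).toSphere
  obtain ⟨C, hC⟩ := hdiv.bound
  rw [(hasBasis_cobounded_norm (E := EuclideanSpace ℝ (Fin 3))).eventually_iff] at hC
  obtain ⟨R₁, -, hR₁⟩ := hC
  -- Beyond this radius both the decay bound and the smoothness of W are available.
  set a := max R₁ (R₀ + 1) with ha
  have haR₀ : R₀ < a := lt_of_lt_of_le (by linarith) (le_max_right _ _)
  have ha0 : 0 < a := hR₀.trans haR₀
  set d : ℝ → ℝ := fun r => r ^ 2 * ∫ u, ∑ i, pderiv i (W i) (r • u.1) ∂σ with hd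
  have hbound : ∀ r, a < r → ‖d r‖ ≤ C * σ.real Set.univ * r ^ (-1 - δ) := by
    intro r hr
    have hr0 : 0 < r := ha0.trans hr
    have h1 : ‖∫ u, ∑ i, pderiv i (W i) (r • u.1) ∂σ‖ ≤ C * r ^ (-3 - δ) * σ.real Set.univ := by
      refine norm_integral_le_of_norm_le_const (Eventually.of_forall fun u => ?_)
      have h2 : R₁ ≤ ‖r • u.1‖ := by
        rw [norm_smul_sphere hr0]
        exact (le_max_left _ _).trans hr.le
      have h3 := hR₁ h2
      rwa [norm_smul_sphere hr0, Real.norm_of_nonneg (Real.rpow_nonneg hr0.le _)] at h3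
    have h4 : r ^ (-1 - δ) = r ^ 2 * r ^ (-3 - δ) := by
      rw [← Real.rpow_natCast r 2, ← Real.rpow_add hr0]
      congr 1
      push_cast
      ring
    rw [hd, norm_mul, h4, Real.norm_of_nonneg (by positivity : (0 : ℝ) ≤ r ^ 2)]
    calc _ ≤ r ^ 2 * (C * r ^ (-3 - δ) * σ.real Set.univ) := by gcongr
      _ = _ := by ring
  have hdc : ContinuousOn d (Set.Ioi R₀) :=
    (continuousOn_pow 2).mul (continuousOn_sphere_integral hR₀.le
      (F := fun x => ∑ i, pderiv i (W i) x)
      fun x hx => tendsto_finsetSum _ fun i _ => ((hW i x hx).pderiv i).continuousAt)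
  have hdi : IntegrableOn d (Set.Ioi a) := by
    have hg : IntegrableOn (fun r : ℝ => C * σ.real Set.univ * r ^ (-1 - δ)) (Set.Ioi a) :=
      (integrableOn_Ioi_rpow_of_lt (by linarith) ha0).const_mul _
    refine Integrable.mono' hg ?_ ?_
    · exact (hdc.mono (Set.Ioi_subset_Ioi haR₀.le)).aestronglyMeasurable measurableSet_Ioi
    · exact (ae_restrict_iff' measurableSet_Ioi).2 (Eventually.of_forall fun r hr => hbound r hr)
  have hlim := intervalIntegral_tendsto_integral_Ioi a hdi tendsto_id
  refine ⟨sphereFlux W a + ∫ r in Set.Ioi a, d r, (hlim.const_add _).congr' ?_⟩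
  filter_upwards [eventually_ge_atTop a] with b hb
  have := sphereFlux_sub hR₀ hW haR₀ hb
  simp only [id]
  linarith

end Flux

/-! ### Growth of conformal Killing fields of flat 3-space. -/

section ConformalKilling

theorem isOpen_exterior (R₀ : ℝ) : IsOpen {x : EuclideanSpace ℝ (Fin 3) | R₀ < ‖x‖} :=
  isOpen_lt continuous_const continuous_norm

/-- Integrating a bound for the gradient along rays. -/
theorem abs_le_of_abs_pderiv_le {R₀ R₁ A : ℝ} {m : ℕ} (hR₀ : 0 < R₀) (hR : R₀ < R₁) (hA : 0 ≤ A)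
    {f : EuclideanSpace ℝ (Fin 3) → ℝ} (hf : ∀ x, R₀ < ‖x‖ → ContDiffAt ℝ ∞ f x)
    (hd : ∀ i x, R₁ ≤ ‖x‖ → |pderiv i f x| ≤ A * ‖x‖ ^ m) :
    ∃ S, ∀ x, R₁ ≤ ‖x‖ → |f x| ≤ S + 3 * A * ‖x‖ ^ (m + 1) := by
  have hR₁ : 0 < R₁ := hR₀.trans hR
  obtain ⟨S, hS⟩ := (isCompact_sphere (0 : EuclideanSpace ℝ (Fin 3)) R₁).exists_bound_of_continuousOn
    (f := f) fun x hx => (hf x (by rw [mem_sphere_zero_iff_norm.1 hx]; exact hR)).continuousAt.continuousWithinAt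
  refine ⟨S, fun x hx => ?_⟩
  set r := ‖x‖ with hr
  have hr0 : 0 < r := hR₁.trans_le hx
  set u : EuclideanSpace ℝ (Fin 3) := r⁻¹ • x with hu
  have hun : ‖u‖ = 1 := by
    rw [hu, norm_smul, norm_inv, Real.norm_of_nonneg hr0.le, ← hr, inv_mul_cancel₀ hr0.ne']
  have hsu : ∀ s, R₁ ≤ s → ‖s • u‖ = s := fun s hs => by
    rw [norm_smul, hun, mul_one, Real.norm_of_nonneg (hR₁.le.trans hs)]
  have hcoord : ∀ i, |u i| ≤ 1 := fun i => by
    rw [← Real.norm_eq_abs, ← hun]; exact PiLp.norm_apply_le u i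
  have hderiv : ∀ s ∈ Set.Icc R₁ r, HasDerivWithinAt (fun s : ℝ => f (s • u))
      (∑ i, u i * pderiv i f (s • u)) (Set.Icc R₁ r) s := by
    intro s hs
    have h1 : HasDerivAt (fun s : ℝ => s • u) u s := by
      simpa using (hasDerivAt_id s).smul_const u
    have h2 := (hf (s • u) (by rw [hsu s hs.1]; exact hR.trans_le hs.1)).differentiableAt_infty.hasFDerivAt.comp_hasDerivAt
      s h1
    rw [fderiv_apply_eq_sum] at h2
    exact h2.hasDerivWithinAt
  -- The factor 3 counts the coordinates: each component of the unit vector u is at most 1.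
  have hbound : ∀ s ∈ Set.Icc R₁ r, ‖∑ i, u i * pderiv i f (s • u)‖ ≤ 3 * (A * r ^ m) := by
    intro s hs
    have h1 : ∀ i, ‖u i * pderiv i f (s • u)‖ ≤ A * r ^ m := by
      intro i
      rw [norm_mul, Real.norm_eq_abs, Real.norm_eq_abs]
      have h2 := hd i (s • u) (by rw [hsu s hs.1]; exact hs.1)
      rw [hsu s hs.1] at h2
      have h3 : s ^ m ≤ r ^ m := pow_le_pow_left₀ (hR₁.le.trans hs.1) hs.2 m
      calc _ ≤ 1 * (A * s ^ m) := mul_le_mul (hcoord i) h2 (abs_nonneg _) zero_le_one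
        _ ≤ A * r ^ m := by rw [one_mul]; gcongr
    calc _ ≤ ∑ i : Fin 3, ‖u i * pderiv i f (s • u)‖ := norm_sum_le _ _
      _ ≤ ∑ i : Fin 3, A * r ^ m := Finset.sum_le_sum fun i _ => h1 i
      _ = _ := by simp
  have hmv := (convex_Icc R₁ r).norm_image_sub_le_of_norm_hasDerivWithin_le hderiv hbound
    (Set.left_mem_Icc.2 hx) (Set.right_mem_Icc.2 hx)
  have hx' : r • u = x := by rw [hu, smul_smul, mul_inv_cancel₀ hr0.ne', one_smul]
  simp only [hx'] at hmv
  have h1 := hS (R₁ • u) (by rw [mem_sphere_zero_iff_norm, hsu R₁ le_rfl])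
  rw [Real.norm_of_nonneg (sub_nonneg.2 hx)] at hmv
  have h2 : |f x| ≤ ‖f x - f (R₁ • u)‖ + ‖f (R₁ • u)‖ := by
    have := norm_add_le (f x - f (R₁ • u)) (f (R₁ • u))
    rwa [sub_add_cancel] at this
  have h3 : 3 * (A * r ^ m) * (r - R₁) ≤ 3 * A * r ^ (m + 1) := by
    have h4 : 0 ≤ 3 * (A * r ^ m) := by positivity
    calc _ ≤ 3 * (A * r ^ m) * r := mul_le_mul_of_nonneg_left (by linarith) h4
      _ = _ := by ring
  linarith

theorem pderiv_const_on {R₀ : ℝ} {f : EuclideanSpace ℝ (Fin 3) → ℝ} {f' : EuclideanSpace ℝ (Fin 3) → ℝ}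
    (h : ∀ x, R₀ < ‖x‖ → f x = f' x) {x : EuclideanSpace ℝ (Fin 3)} (hx : R₀ < ‖x‖) (i : Fin 3) :
    pderiv i f x = pderiv i f' x :=
  pderiv_congr i (Filter.mem_of_superset ((isOpen_exterior R₀).mem_nhds hx) h)

variable {R₀ : ℝ} {X : EuclideanSpace ℝ (Fin 3) → EuclideanSpace ℝ (Fin 3)}

theorem IsFlatConformalKillingOn.contDiffAt (hX : IsFlatConformalKillingOn X {x | R₀ < ‖x‖})
    (j : Fin 3) {x : EuclideanSpace ℝ (Fin 3)} (hx : R₀ < ‖x‖) :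
    ContDiffAt ℝ ∞ (fun y => X y j) x :=
  (contDiff_coord j).contDiffAt.comp x (hX.1.contDiffAt ((isOpen_exterior R₀).mem_nhds hx))

/-- The third derivatives of a conformal Killing field of flat space vanish. -/
theorem IsFlatConformalKillingOn.third_pderiv (hX : IsFlatConformalKillingOn X {x | R₀ < ‖x‖})
    {x : EuclideanSpace ℝ (Fin 3)} (hx : R₀ < ‖x‖) (l k i j : Fin 3) :
    pderiv l (pderiv k (pderiv i fun y => X y j)) x = 0 := by
  have hs := fun j => fun x hx => hX.contDiffAt (R₀ := R₀) j (x := x) hx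
  obtain ⟨-, lam, hlam⟩ := hX
  set f : Fin 3 → EuclideanSpace ℝ (Fin 3) → ℝ := fun j y => X y j with hf
  -- The factor λ is an arbitrary function; replacing it by 2 ∂₀X₀, with which it agrees on the
  -- exterior, makes its smoothness visible.
  set L : EuclideanSpace ℝ (Fin 3) → ℝ := fun y => 2 * pderiv 0 (f 0) y with hL
  have e1 : ∀ i j x, R₀ < ‖x‖ → pderiv i (f j) x + pderiv j (f i) x = (if i = j then 1 else 0) * L x := by
    intro i j x hx
    have h0 := hlam x hx 0 0
    have h1 := hlam x hx i j
    rw [if_pos rfl] at h0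
    change pderiv i (f j) x + pderiv j (f i) x = _ at h1
    change pderiv 0 (f 0) x + pderiv 0 (f 0) x = _ at h0
    rw [h1, ← h0]
    split_ifs <;> simp only [hL] <;> ring
  have hLs : ∀ x, R₀ < ‖x‖ → ContDiffAt ℝ ∞ L x := fun x hx =>
    contDiffAt_const.mul ((hs 0 x hx).pderiv 0)
  have e2 : ∀ k i j x, R₀ < ‖x‖ → pderiv k (pderiv i (f j)) x + pderiv k (pderiv j (f i)) x =
      (if i = j then 1 else 0) * pderiv k L x := by
    intro k i j x hx
    rw [← pderiv_const_mul k _ (hLs x hx).differentiableAt_infty,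
      ← pderiv_add k ((hs j x hx).pderiv i).differentiableAt_infty
        ((hs i x hx).pderiv j).differentiableAt_infty]
    exact pderiv_const_on (e1 i j) hx k
  have e3 : ∀ l k i j, pderiv l (pderiv k (pderiv i (f j))) x
      + pderiv l (pderiv k (pderiv j (f i))) x =
      (if i = j then 1 else 0) * pderiv l (pderiv k L) x := by
    intro l k i j
    rw [← pderiv_const_mul l _ ((hLs x hx).pderiv k).differentiableAt_infty,
      ← pderiv_add l (((hs j x hx).pderiv i).pderiv k).differentiableAt_infty
        (((hs i x hx).pderiv j).pderiv k).differentiableAt_infty]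
    exact pderiv_const_on (e2 k i j) hx l
  set T : Fin 3 → Fin 3 → Fin 3 → Fin 3 → ℝ := fun l k i j =>
    pderiv l (pderiv k (pderiv i (f j))) x with hT
  set H : Fin 3 → Fin 3 → ℝ := fun l k => pderiv l (pderiv k L) x with hH
  have s1 : ∀ l k i j, T l k i j = T k l i j := fun l k i j => pderiv_comm ((hs j x hx).pderiv i) l k
  have s2 : ∀ l k i j, T l k i j = T l i k j := fun l k i j =>
    pderiv_const_on (fun y hy => pderiv_comm (hs j y hy) k i) hx l
  have hHs : ∀ l k, H l k = H k l := fun l k => pderiv_comm (hLs x hx) l k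
  -- The Koszul combination of three permuted equations: it isolates 2 ∂_k∂_i X_j in terms of ∂λ,
  -- here differentiated once more.
  have e4 : ∀ l k i j, 2 * T l k i j = (if i = j then 1 else 0) * H l k
      + (if j = k then 1 else 0) * H l i - (if k = i then 1 else 0) * H l j := by
    intro l k i j
    have a1 : T l k i j + T l k j i = _ := e3 l k i j
    have a2 : T l i j k + T l i k j = _ := e3 l i j k
    have a3 : T l j k i + T l j i k = _ := e3 l j k i
    linarith [s2 l k i j, s2 l k j i, s2 l i j k]
  -- Symmetry of the third derivatives in l and k is an integrability condition on the Hessian H of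
  -- λ.
  have e5 : ∀ l k i j, (if j = k then 1 else 0) * H l i - (if k = i then 1 else 0) * H l j =
      (if j = l then 1 else 0) * H k i - (if l = i then 1 else 0) * H k j := by
    intro l k i j
    have a1 := e4 l k i j
    have a2 := e4 k l i j
    rw [hHs k l] at a2
    linarith [s1 l k i j]
  -- Pairwise sums of the three diagonal entries vanish, hence so do the entries; for an
  -- off-diagonal entry the third index is used. This is where dimension three, rather than two,
  -- matters.
  have h01 : H 0 0 + H 1 1 = 0 := by have := e5 0 1 0 1; simp at this; linarith
  have h02 : H 0 0 + H 2 2 = 0 := by have := e5 0 2 0 2; simp at this; linarith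
  have h12 : H 1 1 + H 2 2 = 0 := by have := e5 1 2 1 2; simp at this; linarith
  have g01 : H 0 1 = 0 := by have := e5 0 2 1 2; simp at this; linarith
  have g02 : H 0 2 = 0 := by have := e5 0 1 2 1; simp at this; linarith
  have g12 : H 1 2 = 0 := by have := e5 1 0 2 0; simp at this; linarith
  have hH0 : ∀ l k, H l k = 0 := by
    intro l k
    fin_cases l <;> fin_cases k <;> simp only [Fin.zero_eta, Fin.mk_one, Fin.reduceFinMk] <;>
      linarith [hHs 0 1, hHs 0 2, hHs 1 2]
  have := e4 l k i j
  simp only [hH0] at this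
  change T l k i j = 0
  linarith

theorem exists_common_bound {n : ℕ} {ι : Type*} [Fintype ι] {P : ι → EuclideanSpace ℝ (Fin n) → ℝ}
    {s : Set (EuclideanSpace ℝ (Fin n))} (h : ∀ i, ∃ B, ∀ x ∈ s, |P i x| ≤ B) :
    ∃ B, 0 ≤ B ∧ ∀ i, ∀ x ∈ s, |P i x| ≤ B := by
  choose B hB using h
  refine ⟨∑ i, |B i|, Finset.sum_nonneg fun i _ => abs_nonneg _, fun i x hx => ?_⟩
  exact (hB i x hx).trans ((le_abs_self _).trans
    (Finset.single_le_sum (f := fun i => |B i|) (fun i _ => abs_nonneg _) (Finset.mem_univ i)))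

/-- A conformal Killing field of flat space grows at most quadratically, its first derivatives at
most linearly. -/
theorem IsFlatConformalKillingOn.isBigO (hR₀ : 0 < R₀)
    (hX : IsFlatConformalKillingOn X {x | R₀ < ‖x‖}) :
    (∀ j, (fun x => X x j) =O[cobounded (EuclideanSpace ℝ (Fin 3))] fun x => ‖x‖ ^ (2 : ℝ)) ∧
    ∀ i j, (fun x => pderiv i (fun y => X y j) x) =O[cobounded (EuclideanSpace ℝ (Fin 3))]
      fun x => ‖x‖ ^ (1 : ℝ) := by
  set R₁ := R₀ + 1 with hR₁
  have hR : R₀ < R₁ := by linarith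
  have h1R : 1 ≤ R₁ := by linarith
  have hs := fun j => fun x hx => hX.contDiffAt (R₀ := R₀) j (x := x) hx
  -- Three integrations along rays: zero third derivatives give bounded second ones, then linear
  -- first ones, then quadratic X. The choice R₁ ≥ 1 lets constants be absorbed into powers of r.
  have h2 : ∀ q : Fin 3 × Fin 3 × Fin 3, ∃ B, ∀ x ∈ {x : EuclideanSpace ℝ (Fin 3) | R₁ ≤ ‖x‖},
      |pderiv q.1 (pderiv q.2.1 fun y => X y q.2.2) x| ≤ B := by
    rintro ⟨k, i, j⟩
    obtain ⟨S, hS⟩ := abs_le_of_abs_pderiv_le (A := 0) (m := 0) hR₀ hR le_rfl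
      (f := pderiv k (pderiv i fun y => X y j)) (fun x hx => ((hs j x hx).pderiv i).pderiv k)
      fun l x hx => by rw [hX.third_pderiv (hR.trans_le hx)]; simp
    exact ⟨S, fun x hx => by simpa using hS x hx⟩
  obtain ⟨B₂, hB₂, h2⟩ := exists_common_bound h2
  have h1 : ∀ q : Fin 3 × Fin 3, ∃ B, ∀ x ∈ {x : EuclideanSpace ℝ (Fin 3) | R₁ ≤ ‖x‖},
      |pderiv q.1 (fun y => X y q.2) x / ‖x‖| ≤ B := by
    rintro ⟨i, j⟩
    obtain ⟨S, hS⟩ := abs_le_of_abs_pderiv_le (A := B₂) (m := 0) hR₀ hR hB₂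
      (f := pderiv i fun y => X y j) (fun x hx => (hs j x hx).pderiv i)
      fun l x hx => by simpa using h2 (l, i, j) x hx
    refine ⟨|S| + 3 * B₂, fun x hx => ?_⟩
    have hx1 : 1 ≤ ‖x‖ := h1R.trans hx
    rw [abs_div, abs_norm, div_le_iff₀ (by linarith)]
    have := hS x hx
    simp only [zero_add, pow_one] at this
    nlinarith [le_abs_self S, abs_nonneg S]
  obtain ⟨B₁, hB₁, h1⟩ := exists_common_bound h1
  have h1' : ∀ i j x, R₁ ≤ ‖x‖ → |pderiv i (fun y => X y j) x| ≤ B₁ * ‖x‖ ^ 1 := by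
    intro i j x hx
    have hx1 : 1 ≤ ‖x‖ := h1R.trans hx
    have := h1 (i, j) x hx
    rwa [abs_div, abs_norm, div_le_iff₀ (by linarith), ← pow_one ‖x‖] at this
  have hev : ∀ᶠ x in cobounded (EuclideanSpace ℝ (Fin 3)), R₁ ≤ ‖x‖ :=
    hasBasis_cobounded_norm.eventually_iff.2 ⟨R₁, trivial, fun x hx => hx⟩
  refine ⟨fun j => ?_, fun i j => ?_⟩
  · obtain ⟨S, hS⟩ := abs_le_of_abs_pderiv_le (A := B₁) (m := 1) hR₀ hR hB₁
      (f := fun y => X y j) (hs j) fun l x hx => h1' l j x hx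
    refine IsBigO.of_bound (|S| + 3 * B₁) ?_
    filter_upwards [hev] with x hx
    have hx1 : 1 ≤ ‖x‖ ^ 2 := one_le_pow₀ (h1R.trans hx)
    have := hS x hx
    rw [Real.rpow_ofNat, Real.norm_eq_abs, Real.norm_of_nonneg (by positivity)]
    norm_num at this
    nlinarith [le_abs_self S, abs_nonneg S]
  · refine IsBigO.of_bound B₁ ?_
    filter_upwards [hev] with x hx
    rw [Real.rpow_one, Real.norm_eq_abs, norm_norm]
    simpa using h1' i j x hx

end ConformalKilling

/-! ### Decay rates, and the divergence of the charge current. -/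

section Decay

theorem eventually_norm_gt (R : ℝ) : ∀ᶠ x in cobounded (EuclideanSpace ℝ (Fin 3)), R < ‖x‖ :=
  hasBasis_cobounded_norm.eventually_iff.2
    ⟨R + 1, trivial, fun x (hx : R + 1 ≤ ‖x‖) => by linarith⟩

theorem isBigO_rpow_mul {f f' : EuclideanSpace ℝ (Fin 3) → ℝ} {a b c : ℝ}
    (hf : f
        =O[cobounded (EuclideanSpace ℝ (Fin 3))] fun x => ‖x‖ ^ a)
    (hf' : f'
        =O[cobounded (EuclideanSpace ℝ (Fin 3))] fun x => ‖x‖ ^ b) (hc : a + b ≤ c) :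
    (fun x => f x * f' x) =O[cobounded (EuclideanSpace ℝ (Fin 3))] fun x => ‖x‖ ^ c := by
  refine (hf.mul hf').trans (IsBigO.of_bound 1 ?_)
  filter_upwards [eventually_norm_gt 1] with x hx
  have h0 : 0 < ‖x‖ := by linarith
  rw [← Real.rpow_add h0, Real.norm_of_nonneg (Real.rpow_nonneg h0.le _),
    Real.norm_of_nonneg (Real.rpow_nonneg h0.le _), one_mul]
  exact Real.rpow_le_rpow_of_exponent_le hx.le hc

theorem isBigO_sum {ι : Type*} [Fintype ι] {F : ι → EuclideanSpace ℝ (Fin 3) → ℝ} {c : ℝ}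
    (h : ∀ i, F i =O[cobounded (EuclideanSpace ℝ (Fin 3))] fun x => ‖x‖ ^ c) :
    (fun x => ∑ i, F i x) =O[cobounded (EuclideanSpace ℝ (Fin 3))] fun x => ‖x‖ ^ c :=
  IsBigO.fun_sum fun i _ => h i

theorem isBigO_zero_of_tendsto {f : EuclideanSpace ℝ (Fin 3) → ℝ} {c : ℝ}
    (h : Tendsto f (cobounded (EuclideanSpace ℝ (Fin 3))) (𝓝 c)) : f
        =O[cobounded (EuclideanSpace ℝ (Fin 3))] fun x => ‖x‖ ^ (0 : ℝ) := by
  simpa using h.isBigO_one ℝ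

theorem tendsto_zero_of_isBigO {f : EuclideanSpace ℝ (Fin 3) → ℝ} {a : ℝ} (ha : a < 0)
    (h : f
        =O[cobounded (EuclideanSpace ℝ (Fin 3))] fun x => ‖x‖ ^ a) :
    Tendsto f (cobounded (EuclideanSpace ℝ (Fin 3))) (𝓝 0) := by
  refine h.trans_tendsto ?_
  have := (tendsto_rpow_neg_atTop (neg_pos.2 ha)).comp (tendsto_norm_cobounded_atTop
    (E := EuclideanSpace ℝ (Fin 3)))
  simpa [Function.comp_def] using this

/-- The conformal factor `(1 + M / (2 r))^4`. -/
noncomputable def conformalFactor (M : ℝ) (x : EuclideanSpace ℝ (Fin 3)) : ℝ :=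
  (1 + M / (2 * ‖x‖)) ^ 4

theorem conformalFactor_contDiffAt (M : ℝ) {x : EuclideanSpace ℝ (Fin 3)} (hx : x ≠ 0) :
    ContDiffAt ℝ ∞ (conformalFactor M) x := by
  have h0 : 2 * ‖x‖ ≠ 0 := mul_ne_zero two_ne_zero (norm_ne_zero_iff.2 hx)
  exact (contDiffAt_const.add (contDiffAt_const.div
    (contDiffAt_const.mul (contDiffAt_norm ℝ hx)) h0)).pow 4

theorem tendsto_conformalFactor (M : ℝ) :
    Tendsto (conformalFactor M) (cobounded (EuclideanSpace ℝ (Fin 3))) (𝓝 1) := by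
  have h1 : Tendsto (fun x : EuclideanSpace ℝ (Fin 3) => M / (2 * ‖x‖))
      (cobounded (EuclideanSpace ℝ (Fin 3))) (𝓝 0) :=
    Tendsto.const_div_atTop (tendsto_norm_cobounded_atTop.const_mul_atTop two_pos) M
  have h2 := (h1.const_add 1).pow 4
  show Tendsto (fun x : EuclideanSpace ℝ (Fin 3) => (1 + M / (2 * ‖x‖)) ^ 4) _ _
  simpa using h2

/-- The divergence of `S^{ck} γ_{kj} X^j` for a symmetric trace-free tensor density `S` that
satisfies a constraint equation with source `J`, and a conformal Killing field `X`. -/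
theorem div_charge_eq {f : ℝ} {S h : Matrix (Fin 3) (Fin 3) ℝ} {df X J : Fin 3 → ℝ}
    {D : Fin 3 → Fin 3 → ℝ} {dh : Fin 3 → Fin 3 → Fin 3 → ℝ} {lam : ℝ} (hS : S.IsSymm)
    (htr : ∑ c, ∑ k, S c k * (1 + h) c k = 0)
    (hD : ∀ i j, D i j + D j i = if i = j then lam else 0) :
    ∑ j, X j * ((1 / 2) * ∑ c, ∑ k, S c k * (df j * (1 + h) c k + f * dh j c k) + J j)
      + ∑ c, ∑ j, (S * (f • (1 + h))) c j * D c j =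
    (1 / 2) * f * ∑ c, ∑ k, ∑ j, S c k * X j * dh j c k
      - f * D 0 0 * ∑ c, ∑ k, S c k * h c k
      + f * ∑ c, ∑ k, ∑ j, S c k * h k j * D c j + ∑ j, J j * X j := by
  have s1 := hS.apply 0 1
  have s2 := hS.apply 0 2
  have s3 := hS.apply 1 2
  have d0 := hD 0 0
  have d1 := hD 1 1
  have d2 := hD 2 2
  have d3 := hD 0 1
  have d4 := hD 0 2
  have d5 := hD 1 2
  simp at d0 d1 d2 d3 d4 d5
  have e1 : D 1 1 = D 0 0 := by linarith
  have e2 : D 2 2 = D 0 0 := by linarith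
  have e3 : D 1 0 = - D 0 1 := by linarith
  have e4 : D 2 0 = - D 0 2 := by linarith
  have e5 : D 2 1 = - D 1 2 := by linarith
  simp only [Fin.sum_univ_three, Matrix.mul_apply, Matrix.smul_apply, Matrix.add_apply,
    smul_eq_mul, Matrix.one_apply] at htr ⊢
  simp [s1, s2, s3, e1, e2, e3, e4, e5] at htr ⊢
  -- The matrix D is (λ/2)·1 plus an antisymmetric part, with λ/2 = D 0 0; the antisymmetric part
  -- pairs to zero with S. The gradient of the conformal factor multiplies the trace of S and drops
  -- out, and tracelessness with respect to 1 + h trades S^{cc} for -S^{ck} h_{ck}.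
  linear_combination ((1 / 2) * (X 0 * df 0 + X 1 * df 1 + X 2 * df 2) + f * D 0 0) * htr

variable {R₀ M ε : ℝ} {γ S h : EuclideanSpace ℝ (Fin 3) → Matrix (Fin 3) (Fin 3) ℝ}
  {J : Fin 3 → EuclideanSpace ℝ (Fin 3) → ℝ}
  {X : EuclideanSpace ℝ (Fin 3) → EuclideanSpace ℝ (Fin 3)}

/-- Order counting in `div_charge_eq`: S X ∂h and S h ∂X have orders -3+2-2-ε and -3-1-ε+1, both
equal to -3-ε, and J·X has order -6+2 = -4. -/
theorem exists_flux_limit (hR₀ : 0 < R₀) (hε : 0 < ε)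
    (hγ : ∀ x, R₀ < ‖x‖ → γ x = conformalFactor M x • (1 + h x))
    (hf : ∀ x, R₀ < ‖x‖ → conformalFactor M x ≠ 0)
    (hhs : ∀ x i j, R₀ < ‖x‖ → ContDiffAt ℝ ∞ (fun y => h y i j) x)
    (hh : ∀ i j, (fun x => h x i j)
        =O[cobounded (EuclideanSpace ℝ (Fin 3))] fun x => ‖x‖ ^ (-1 - ε))
    (hdh : ∀ a i j, (fun x => pderiv a (fun y => h y i j) x)
        =O[cobounded (EuclideanSpace ℝ (Fin 3))] fun x => ‖x‖ ^ (-2 - ε))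
    (hSs : ∀ x c j, R₀ < ‖x‖ → ContDiffAt ℝ ∞ (fun y => (S y * γ y) c j) x)
    (hSsymm : ∀ x, R₀ < ‖x‖ → (S x).IsSymm)
    (htr : ∀ x, R₀ < ‖x‖ → ∑ i, ∑ j, S x i j * γ x i j = 0)
    (hS : ∀ i j, (fun x => S x i j)
        =O[cobounded (EuclideanSpace ℝ (Fin 3))] fun x => ‖x‖ ^ (-3 : ℝ))
    (hJ : ∀ j, J j =O[cobounded (EuclideanSpace ℝ (Fin 3))] fun x => ‖x‖ ^ (-6 : ℝ))
    (hdiv : ∀ x j, R₀ < ‖x‖ → ∑ c, pderiv c (fun y => (S y * γ y) c j) x =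
      (1 / 2) * ∑ c, ∑ k, S x c k * pderiv j (fun y => γ y c k) x + J j x)
    (hX : IsFlatConformalKillingOn X {x | R₀ < ‖x‖}) :
    (∀ c x, R₀ < ‖x‖ → ContDiffAt ℝ ∞ (fun y => ∑ j, (S y * γ y) c j * X y j) x) ∧
    ∃ q, Tendsto (sphereFlux fun c x => ∑ j, (S x * γ x) c j * X x j) atTop (𝓝 q) := by
  have hXs := fun j => fun x hx => hX.contDiffAt (R₀ := R₀) j (x := x) hx
  obtain ⟨hXO, hDO⟩ := hX.isBigO hR₀
  obtain ⟨-, lam, hlam⟩ := hX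
  have hWs : ∀ c x, R₀ < ‖x‖ → ContDiffAt ℝ ∞ (fun y => ∑ j, (S y * γ y) c j * X y j) x :=
    fun c x hx => ContDiffAt.sum fun j _ => (hSs x c j hx).mul (hXs j x hx)
  -- The 1 in the minimum accounts for the source term of order -4 = -3 - 1.
  refine ⟨hWs, tendsto_sphereFlux (δ := min ε 1) hR₀ (lt_min hε one_pos) hWs ?_⟩
  have hx0 : ∀ x : EuclideanSpace ℝ (Fin 3), R₀ < ‖x‖ → x ≠ 0 := by
    rintro x hx rfl
    simp at hx
    linarith
  have hkey : ∀ x, R₀ < ‖x‖ → ∑ c, pderiv c (fun y => ∑ j, (S y * γ y) c j * X y j) x =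
      (1 / 2) * conformalFactor M x * ∑ c, ∑ k, ∑ j,
          S x c k * X x j * pderiv j (fun y => h y c k) x
        - conformalFactor M x * pderiv 0 (fun y => X y 0) x * ∑ c, ∑ k, S x c k * h x c k
        + conformalFactor M x * ∑ c, ∑ k, ∑ j,
          S x c k * h x k j * pderiv c (fun y => X y j) x + ∑ j, J j x * X x j := by
    intro x hx
    have hfd := (conformalFactor_contDiffAt M (hx0 x hx)).differentiableAt_infty
    have h1 : ∀ c, pderiv c (fun y => ∑ j, (S y * γ y) c j * X y j) x =
        ∑ j, (pderiv c (fun y => (S y * γ y) c j) x * X x j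
          + (S x * γ x) c j * pderiv c (fun y => X y j) x) := by
      intro c
      have a1 := fun j => (hSs x c j hx).differentiableAt_infty
      have a2 := fun j => (hXs j x hx).differentiableAt_infty
      rw [pderiv_sum _ _ fun j _ => (a1 j).fun_mul (a2 j)]
      exact Finset.sum_congr rfl fun j _ => pderiv_mul c (a1 j) (a2 j)
    have h2 : ∀ j c k, pderiv j (fun y => γ y c k) x =
        pderiv j (conformalFactor M) x * (1 + h x) c k
          + conformalFactor M x * pderiv j (fun y => h y c k) x := by
      intro j c k
      have a1 : ∀ y, R₀ < ‖y‖ → γ y c k =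
          conformalFactor M y * ((1 : Matrix (Fin 3) (Fin 3) ℝ) c k + h y c k) := fun y hy => by
        rw [hγ y hy, Matrix.smul_apply, Matrix.add_apply, smul_eq_mul]
      have a2 := (hhs x c k hx).differentiableAt_infty
      rw [pderiv_const_on a1 hx j,
        pderiv_mul j hfd ((differentiableAt_const _).fun_add a2),
        pderiv_add j (differentiableAt_const _) a2, pderiv_const, zero_add, Matrix.add_apply]
    have h3 : ∑ c, ∑ k, S x c k * (1 + h x) c k = 0 := by
      apply mul_left_cancel₀ (hf x hx)
      rw [mul_zero, ← htr x hx, hγ x hx, Finset.mul_sum]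
      refine Finset.sum_congr rfl fun c _ => ?_
      rw [Finset.mul_sum]
      refine Finset.sum_congr rfl fun k _ => ?_
      rw [Matrix.smul_apply, smul_eq_mul]
      ring
    rw [← div_charge_eq (df := fun j => pderiv j (conformalFactor M) x) (hSsymm x hx) h3
      (hlam x hx), ← hγ x hx]
    simp only [h1, Finset.sum_add_distrib]
    congr 1
    rw [Finset.sum_comm]
    refine Finset.sum_congr rfl fun j _ => ?_
    simp only [← h2]
    rw [← hdiv x j hx, mul_comm, Finset.sum_mul]
  have hfO := isBigO_zero_of_tendsto (tendsto_conformalFactor M)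
  have hmin1 : min ε 1 ≤ ε := min_le_left _ _
  have hmin2 : min ε 1 ≤ 1 := min_le_right _ _
  have t1 : (fun x => (1 / 2) * conformalFactor M x * ∑ c, ∑ k, ∑ j,
      S x c k * X x j * pderiv j (fun y => h y c k) x)
          =O[cobounded (EuclideanSpace ℝ (Fin 3))] fun x => ‖x‖ ^ (-3 - min ε 1) := by
    refine isBigO_rpow_mul (a := 0) (b := -3 - ε) (hfO.const_mul_left _) ?_ (by linarith)
    refine isBigO_sum fun c => isBigO_sum fun k => isBigO_sum fun j => ?_
    exact isBigO_rpow_mul (isBigO_rpow_mul (hS c k) (hXO j) le_rfl) (hdh j c k) (by linarith)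
  have t2 : (fun x => conformalFactor M x * pderiv 0 (fun y => X y 0) x
      * ∑ c, ∑ k, S x c k * h x c k)
          =O[cobounded (EuclideanSpace ℝ (Fin 3))] fun x => ‖x‖ ^ (-3 - min ε 1) := by
    refine isBigO_rpow_mul (b := -4 - ε) (isBigO_rpow_mul hfO (hDO 0 0) le_rfl) ?_ (by linarith)
    refine isBigO_sum fun c => isBigO_sum fun k => ?_
    exact isBigO_rpow_mul (hS c k) (hh c k) (by linarith)
  have t3 : (fun x => conformalFactor M x * ∑ c, ∑ k, ∑ j,
      S x c k * h x k j * pderiv c (fun y => X y j) x)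
          =O[cobounded (EuclideanSpace ℝ (Fin 3))] fun x => ‖x‖ ^ (-3 - min ε 1) := by
    refine isBigO_rpow_mul (b := -3 - ε) hfO ?_ (by linarith)
    refine isBigO_sum fun c => isBigO_sum fun k => isBigO_sum fun j => ?_
    exact isBigO_rpow_mul (isBigO_rpow_mul (hS c k) (hh k j) le_rfl) (hDO c j) (by linarith)
  have t4 : (fun x => ∑ j, J j x * X x j)
      =O[cobounded (EuclideanSpace ℝ (Fin 3))] fun x => ‖x‖ ^ (-3 - min ε 1) :=
    isBigO_sum fun j => isBigO_rpow_mul (hJ j) (hXO j) (by linarith)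
  refine (((t1.sub t2).add t3).add t4).congr' ?_ EventuallyEq.rfl
  filter_upwards [eventually_norm_gt R₀] with x hx using (hkey x hx).symm

end Decay

/-! ### The charge as a Euclidean flux. -/

section Charges

variable {R₀ : ℝ} {γ T : EuclideanSpace ℝ (Fin 3) → Matrix (Fin 3) (Fin 3) ℝ}
  {X : EuclideanSpace ℝ (Fin 3) → EuclideanSpace ℝ (Fin 3)}

/-- The factor √(det γ) of the surface element is absorbed into the density, leaving the flat flux
of S^c_j X^j. -/
theorem chargeIntegrand_eq {r : ℝ} {u : Metric.sphere (0 : EuclideanSpace ℝ (Fin 3)) 1}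
    (hγ : (γ (r • u.1)).det ≠ 0) : chargeIntegrand γ T X r u =
      (∑ c, (∑ j, (raisedDensity (γ (r • u.1)) (T (r • u.1)) * γ (r • u.1)) c j * X (r • u.1) j)
        * u.1 c) * r ^ 2 := by
  unfold chargeIntegrand
  rw [raisedDensity_mul hγ]
  simp only [Matrix.smul_apply, Matrix.mul_apply, smul_eq_mul, Finset.sum_mul]
  refine Finset.sum_congr rfl fun c _ => Finset.sum_congr rfl fun j _ => ?_
  simp only [Finset.mul_sum, Finset.sum_mul]
  exact Finset.sum_congr rfl fun k _ => by ring

theorem hasAsymptoticCharge_of_flux (hR₀ : 0 < R₀) (hγ : ∀ x, R₀ < ‖x‖ → (γ x).det ≠ 0)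
    (hW : ∀ c x, R₀ < ‖x‖ →
      ContDiffAt ℝ ∞ (fun y => ∑ j, (raisedDensity (γ y) (T y) * γ y) c j * X y j) x)
    (hlim : ∃ q, Tendsto (sphereFlux fun c x =>
      ∑ j, (raisedDensity (γ x) (T x) * γ x) c j * X x j) atTop (𝓝 q)) :
    HasAsymptoticCharge R₀ γ T X := by
  have hd : ∀ r, R₀ < r → ∀ u : Metric.sphere (0 : EuclideanSpace ℝ (Fin 3)) 1,
      (γ (r • u.1)).det ≠ 0 := fun r hr u =>
    hγ _ (by rwa [norm_smul_sphere (hR₀.trans hr)])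
  constructor
  · intro r hr
    -- On S(r) one has x_c ‖x‖ = r² u_c, so this function of x restricts to the integrand.
    have hF : ∀ x, R₀ < ‖x‖ → ContinuousAt (fun x => (∑ c,
        (∑ j, (raisedDensity (γ x) (T x) * γ x) c j * X x j) * x c) * ‖x‖) x := fun x hx =>
      (tendsto_finsetSum _ fun c _ => (hW c x hx).continuousAt.mul
        (contDiff_coord c).continuous.continuousAt).mul continuous_norm.continuousAt
    refine (integrable_sphere hR₀.le hF hr).congr (Eventually.of_forall fun u => ?_)
    dsimp only
    rw [chargeIntegrand_eq (hd r hr u), norm_smul_sphere (hR₀.trans hr), Finset.sum_mul,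
      Finset.sum_mul]
    refine Finset.sum_congr rfl fun c _ => ?_
    rw [PiLp.smul_apply, smul_eq_mul]
    ring
  · obtain ⟨q, hq⟩ := hlim
    refine ⟨q, hq.congr' ?_⟩
    filter_upwards [eventually_gt_atTop R₀] with r hr
    exact integral_congr_ae (Eventually.of_forall fun u => (chargeIntegrand_eq (hd r hr u)).symm)

end Charges

/-! ### Consequences of the decay hypotheses for γ, h and densities. -/

section Asymptotics

variable {R₀ M ε : ℝ} {γ T h : EuclideanSpace ℝ (Fin 3) → Matrix (Fin 3) (Fin 3) ℝ}

theorem isMetricAt_one_add (hγ : ∀ x, R₀ < ‖x‖ → γ x = conformalFactor M x • (1 + h x))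
    (hR₀ : 0 < R₀) (hf : ∀ x, R₀ < ‖x‖ → conformalFactor M x ≠ 0)
    (hm : ∀ x, R₀ < ‖x‖ → IsMetricAt γ x) {x : EuclideanSpace ℝ (Fin 3)} (hx : R₀ < ‖x‖) :
    IsMetricAt (fun y => 1 + h y) x := by
  have hev : ∀ {y : EuclideanSpace ℝ (Fin 3)}, R₀ < ‖y‖ → ∀ᶠ z in 𝓝 y, R₀ < ‖z‖ :=
    fun hy => (isOpen_exterior R₀).mem_nhds hy
  have he : ∀ y, R₀ < ‖y‖ → 1 + h y = (conformalFactor M y)⁻¹ • γ y := fun y hy => by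
    rw [hγ y hy, smul_smul, inv_mul_cancel₀ (hf y hy), one_smul]
  refine ⟨(hev hx).mono fun y hy i j => ?_, (hev hx).mono fun y hy => ?_,
    (hev hx).mono fun y hy => ?_⟩
  · have h0 : y ≠ 0 := norm_ne_zero_iff.1 (hR₀.trans hy).ne'
    refine ContDiffAt.congr_of_eventuallyEq (((conformalFactor_contDiffAt M h0).inv (hf y hy)).mul
      ((hm y hy).contDiffAt i j)) ((hev hy).mono fun z hz => ?_)
    dsimp only
    rw [he z hz, Matrix.smul_apply, smul_eq_mul, Pi.inv_apply]
  · rw [he y hy]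
    exact (hm y hy).symm.self_of_nhds.smul _
  · rw [he y hy, Matrix.det_smul]
    exact mul_ne_zero (pow_ne_zero _ (inv_ne_zero (hf y hy))) (hm y hy).det_ne.self_of_nhds

theorem contDiffAt_of_isMetricAt_one_add {x : EuclideanSpace ℝ (Fin 3)}
    (hm : IsMetricAt (fun y => 1 + h y) x) (i j : Fin 3) :
    ContDiffAt ℝ ∞ (fun y => h y i j) x := by
  have := (hm.contDiffAt i j).sub (contDiffAt_const (c := (1 : Matrix (Fin 3) (Fin 3) ℝ) i j))
  simpa only [Matrix.add_apply, add_sub_cancel_left] using this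

/-- Metric compatibility writes ∂h as (1+h)Γ plus its transpose, and 1+h is bounded; so the bound on
the Christoffel symbols bounds the derivatives of h. -/
theorem pderiv_isBigO_of_christoffel (hε : 0 < ε)
    (hm : ∀ x, R₀ < ‖x‖ → IsMetricAt (fun y => 1 + h y) x)
    (hh : ∀ i j, (fun x => h x i j) =O[cobounded (EuclideanSpace ℝ (Fin 3))]
      fun x => ‖x‖ ^ (-1 - ε))
    (hΓ : ∀ a i j, (fun x => christoffel (fun y => 1 + h y) x a i j)
      =O[cobounded (EuclideanSpace ℝ (Fin 3))] fun x => ‖x‖ ^ (-2 - ε)) (a i j : Fin 3) :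
    (fun x => pderiv a (fun y => h y i j) x) =O[cobounded (EuclideanSpace ℝ (Fin 3))]
      fun x => ‖x‖ ^ (-2 - ε) := by
  have h1 : ∀ i j, (fun x => (1 + h x) i j) =O[cobounded (EuclideanSpace ℝ (Fin 3))]
      fun x => ‖x‖ ^ (0 : ℝ) := fun i j =>
    isBigO_zero_of_tendsto ((tendsto_zero_of_isBigO (by linarith) (hh i j)).const_add _)
  have h2 : ∀ i j, (fun x => ∑ k, (1 + h x) i k * christoffel (fun y => 1 + h y) x k a j)
      =O[cobounded (EuclideanSpace ℝ (Fin 3))] fun x => ‖x‖ ^ (-2 - ε) := fun i j =>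
    isBigO_sum fun k => isBigO_rpow_mul (h1 i k) (hΓ k a j) (by linarith)
  refine ((h2 i j).add (h2 j i)).congr' ?_ EventuallyEq.rfl
  filter_upwards [eventually_norm_gt R₀] with x hx
  have e := (hm x hx).pderiv_eq a i j
  have e2 : (fun y => (1 + h y) i j) = fun y => (1 : Matrix (Fin 3) (Fin 3) ℝ) i j + h y i j := rfl
  rw [e2, pderiv_add a (differentiableAt_const _)
    (contDiffAt_of_isMetricAt_one_add (hm x hx) i j).differentiableAt_infty, pderiv_const,
    zero_add] at e
  exact e.symm

theorem tendsto_metric_one (hε : 0 < ε)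
    (hγ : ∀ x, R₀ < ‖x‖ → γ x = conformalFactor M x • (1 + h x))
    (hh : ∀ i j, (fun x => h x i j) =O[cobounded (EuclideanSpace ℝ (Fin 3))]
      fun x => ‖x‖ ^ (-1 - ε)) :
    Tendsto γ (cobounded (EuclideanSpace ℝ (Fin 3))) (𝓝 1) := by
  have h1 : Tendsto h (cobounded (EuclideanSpace ℝ (Fin 3))) (𝓝 0) :=
    tendsto_pi_nhds.2 fun i => tendsto_pi_nhds.2 fun j =>
      tendsto_zero_of_isBigO (by linarith) (hh i j)
  have h2 := (tendsto_conformalFactor M).smul (h1.const_add 1)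
  rw [add_zero, one_smul] at h2
  exact h2.congr' ((eventually_norm_gt R₀).mono fun x hx => (hγ x hx).symm)

theorem metric_isBigO (hlim : Tendsto γ (cobounded (EuclideanSpace ℝ (Fin 3))) (𝓝 1))
    (i j : Fin 3) :
    (fun x => γ x i j) =O[cobounded (EuclideanSpace ℝ (Fin 3))] fun x => ‖x‖ ^ (0 : ℝ) :=
  isBigO_zero_of_tendsto (tendsto_pi_nhds.1 (tendsto_pi_nhds.1 hlim i) j)

theorem tendsto_sqrt_det (hlim : Tendsto γ (cobounded (EuclideanSpace ℝ (Fin 3))) (𝓝 1)) :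
    Tendsto (fun x => Real.sqrt (γ x).det) (cobounded (EuclideanSpace ℝ (Fin 3))) (𝓝 1) := by
  have h1 := ((continuous_id.matrix_det (n := Fin 3) (R := ℝ)).tendsto 1).comp hlim
  have h2 := (Real.continuous_sqrt.tendsto _).comp h1
  simpa [Function.comp_def] using h2

theorem metric_inv_isBigO (hlim : Tendsto γ (cobounded (EuclideanSpace ℝ (Fin 3))) (𝓝 1))
    (i j : Fin 3) :
    (fun x => (γ x)⁻¹ i j) =O[cobounded (EuclideanSpace ℝ (Fin 3))] fun x => ‖x‖ ^ (0 : ℝ) := by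
  have h1 := ((continuous_id.matrix_det (n := Fin 3) (R := ℝ)).tendsto 1).comp hlim
  have h2 := ((continuous_id.matrix_adjugate (n := Fin 3) (R := ℝ)).tendsto 1).comp hlim
  have h3 := (h1.inv₀ (by simp)).smul h2
  simp only [Matrix.inv_def, Ring.inverse_eq_inv']
  exact isBigO_zero_of_tendsto (tendsto_pi_nhds.1 (tendsto_pi_nhds.1 h3 i) j)

theorem raisedDensity_isBigO {a : ℝ}
    (hlim : Tendsto γ (cobounded (EuclideanSpace ℝ (Fin 3))) (𝓝 1))
    (hT : ∀ i j, (fun x => T x i j) =O[cobounded (EuclideanSpace ℝ (Fin 3))] fun x => ‖x‖ ^ a)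
    (i j : Fin 3) : (fun x => raisedDensity (γ x) (T x) i j)
      =O[cobounded (EuclideanSpace ℝ (Fin 3))] fun x => ‖x‖ ^ a := by
  simp only [raisedDensity, Matrix.smul_apply, smul_eq_mul, Matrix.mul_apply]
  refine isBigO_rpow_mul (isBigO_zero_of_tendsto (tendsto_sqrt_det hlim)) ?_ (zero_add a).le
  refine isBigO_sum fun k => isBigO_rpow_mul ?_ (metric_inv_isBigO hlim k j) (add_zero a).le
  exact isBigO_sum fun l => isBigO_rpow_mul (metric_inv_isBigO hlim i l) (hT l k) (zero_add a).le

end Asymptotics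

/-! ### Decay of the Weyl components and of the constraint sources. -/

section SliceDecay

variable {R₀ : ℝ} {g : EuclideanSpace ℝ (Fin 4) → Matrix (Fin 4) (Fin 4) ℝ}

theorem mixedDual_isBigO (hW : ∀ x, R₀ < ‖x‖ → IsWeylFieldAt g (slicePt x))
    (hs : ∀ x, R₀ < ‖x‖ → IsSpacelikeAt g x)
    (hlim : Tendsto (inducedMetric g) (cobounded (EuclideanSpace ℝ (Fin 3))) (𝓝 1))
    (hB : ∀ i j, (fun x => magneticPart g x i j) =O[cobounded (EuclideanSpace ℝ (Fin 3))]
      fun x => ‖x‖ ^ (-3 : ℝ)) (i c : Fin 3) :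
    (fun x => mixedDual g x i c) =O[cobounded (EuclideanSpace ℝ (Fin 3))]
      fun x => ‖x‖ ^ (-3 : ℝ) := by
  have h1 : (fun x => ∑ k, raisedDensity (inducedMetric g x) (magneticPart g x) c k
      * inducedMetric g x k i) =O[cobounded (EuclideanSpace ℝ (Fin 3))] fun x => ‖x‖ ^ (-3 : ℝ) :=
    isBigO_sum fun k => isBigO_rpow_mul (raisedDensity_isBigO hlim hB c k)
      (metric_isBigO hlim k i) (by norm_num)
  refine h1.congr' ?_ EventuallyEq.rfl
  filter_upwards [eventually_norm_gt R₀] with x hx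
  rw [← Matrix.mul_apply, (hW x hx).magneticPart_density (hs x hx), Matrix.transpose_apply]

theorem tangentialDual_isBigO (hW : ∀ x, R₀ < ‖x‖ → IsWeylFieldAt g (slicePt x))
    (hs : ∀ x, R₀ < ‖x‖ → IsSpacelikeAt g x)
    (hlim : Tendsto (inducedMetric g) (cobounded (EuclideanSpace ℝ (Fin 3))) (𝓝 1))
    (hE : ∀ i j, (fun x => electricPart g x i j) =O[cobounded (EuclideanSpace ℝ (Fin 3))]
      fun x => ‖x‖ ^ (-3 : ℝ)) (c d : Fin 3) :
    (fun x => tangentialDual g x c d) =O[cobounded (EuclideanSpace ℝ (Fin 3))]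
      fun x => ‖x‖ ^ (-3 : ℝ) := by
  have h1 := isBigO_rpow_mul (isBigO_zero_of_tendsto (tendsto_sqrt_det hlim))
    (raisedDensity_isBigO hlim hE c d) (zero_add (-3 : ℝ)).le
  refine h1.congr' ?_ EventuallyEq.rfl
  filter_upwards [eventually_norm_gt R₀] with x hx
  rw [(hW x hx).electricPart_density (hs x hx), Matrix.smul_apply, smul_eq_mul,
    mul_inv_cancel_left₀ (IsWeylFieldAt.sqrt_det_ne (hs x hx))]

/-- In dimension three E determines all tangential components: up to order, a pair of distinct
indices is (d+1, d+2). Thus the source K × E inherits the decay of E. -/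
theorem weylTangential_isBigO (hW : ∀ x, R₀ < ‖x‖ → IsWeylFieldAt g (slicePt x))
    (hs : ∀ x, R₀ < ‖x‖ → IsSpacelikeAt g x)
    (hlim : Tendsto (inducedMetric g) (cobounded (EuclideanSpace ℝ (Fin 3))) (𝓝 1))
    (hE : ∀ i j, (fun x => electricPart g x i j) =O[cobounded (EuclideanSpace ℝ (Fin 3))]
      fun x => ‖x‖ ^ (-3 : ℝ)) (j l c : Fin 3) :
    (fun x => weylTangential g x j l (c + 1) (c + 2))
      =O[cobounded (EuclideanSpace ℝ (Fin 3))] fun x => ‖x‖ ^ (-3 : ℝ) := by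
  have h1 : ∀ d, (fun x => weylTangential g x (d + 1) (d + 2) (c + 1) (c + 2))
      =O[cobounded (EuclideanSpace ℝ (Fin 3))] fun x => ‖x‖ ^ (-3 : ℝ) :=
    tangentialDual_isBigO hW hs hlim hE c
  have h2 : ∀ d, (fun x => weylTangential g x (d + 2) (d + 1) (c + 1) (c + 2))
      =O[cobounded (EuclideanSpace ℝ (Fin 3))] fun x => ‖x‖ ^ (-3 : ℝ) := fun d => by
    refine (h1 d).neg_left.congr' ?_ EventuallyEq.rfl
    filter_upwards [eventually_norm_gt R₀] with x hx
    exact ((hW x hx).antisymm_left _ _ _ _).symm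
  have h3 : ∀ d, (fun x => weylTangential g x d d (c + 1) (c + 2))
      =O[cobounded (EuclideanSpace ℝ (Fin 3))] fun x => ‖x‖ ^ (-3 : ℝ) := fun d => by
    refine (isBigO_zero _ _).congr' ?_ EventuallyEq.rfl
    filter_upwards [eventually_norm_gt R₀] with x hx
    have := (hW x hx).antisymm_left d.succ d.succ (c + 1).succ (c + 2).succ
    unfold weylTangential
    linarith
  have key : ∀ j l : Fin 3, j = l ∨ (∃ d, j = d + 1 ∧ l = d + 2) ∨ ∃ d, j = d + 2 ∧ l = d + 1 := by
    decide
  obtain rfl | ⟨d, rfl, rfl⟩ | ⟨d, rfl, rfl⟩ := key j l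
  exacts [h3 j, h1 d, h2 d]

theorem magneticSource_isBigO (hW : ∀ x, R₀ < ‖x‖ → IsWeylFieldAt g (slicePt x))
    (hs : ∀ x, R₀ < ‖x‖ → IsSpacelikeAt g x)
    (hlim : Tendsto (inducedMetric g) (cobounded (EuclideanSpace ℝ (Fin 3))) (𝓝 1))
    (hK : ∀ i j, (fun x => extrinsicCurv g x i j) =O[cobounded (EuclideanSpace ℝ (Fin 3))]
      fun x => ‖x‖ ^ (-3 : ℝ))
    (hE : ∀ i j, (fun x => electricPart g x i j) =O[cobounded (EuclideanSpace ℝ (Fin 3))]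
      fun x => ‖x‖ ^ (-3 : ℝ)) (j : Fin 3) :
    magneticSource g j =O[cobounded (EuclideanSpace ℝ (Fin 3))] fun x => ‖x‖ ^ (-6 : ℝ) :=
  (isBigO_sum fun c => isBigO_sum fun l => isBigO_sum fun k =>
    isBigO_rpow_mul (isBigO_rpow_mul (metric_inv_isBigO hlim l k) (hK c k) le_rfl)
      (weylTangential_isBigO hW hs hlim hE j l c) (by norm_num)).neg_left

theorem electricSource_isBigO (hW : ∀ x, R₀ < ‖x‖ → IsWeylFieldAt g (slicePt x))
    (hs : ∀ x, R₀ < ‖x‖ → IsSpacelikeAt g x)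
    (hlim : Tendsto (inducedMetric g) (cobounded (EuclideanSpace ℝ (Fin 3))) (𝓝 1))
    (hK : ∀ i j, (fun x => extrinsicCurv g x i j) =O[cobounded (EuclideanSpace ℝ (Fin 3))]
      fun x => ‖x‖ ^ (-3 : ℝ))
    (hB : ∀ i j, (fun x => magneticPart g x i j) =O[cobounded (EuclideanSpace ℝ (Fin 3))]
      fun x => ‖x‖ ^ (-3 : ℝ)) (j : Fin 3) :
    electricSource g j =O[cobounded (EuclideanSpace ℝ (Fin 3))] fun x => ‖x‖ ^ (-6 : ℝ) := by
  have h1 := isBigO_zero_of_tendsto ((tendsto_sqrt_det hlim).inv₀ one_ne_zero)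
  have h2 : ∀ a b c d, (fun x => extrinsicCurv g x a b * mixedDual g x c d)
      =O[cobounded (EuclideanSpace ℝ (Fin 3))] fun x => ‖x‖ ^ (-6 : ℝ) := fun a b c d =>
    isBigO_rpow_mul (hK a b) (mixedDual_isBigO hW hs hlim hB c d) (by norm_num)
  exact isBigO_rpow_mul h1 (isBigO_sum fun c => isBigO_sum fun d =>
    isBigO_rpow_mul ((h2 _ _ _ _).sub (h2 _ _ _ _)) (metric_isBigO hlim d j) (add_zero _).le)
    (zero_add _).le

end SliceDecay

/-! ### The scaling, rotation and proper conformal fields are conformal Killing. -/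

section ConformalKillingFields

variable {V : Set (EuclideanSpace ℝ (Fin 3))}

theorem scalingField_isFlatConformalKillingOn : IsFlatConformalKillingOn scalingField V := by
  refine ⟨contDiffOn_id, fun _ => 2, fun x _ i j => ?_⟩
  simp only [scalingField, pderiv_coord, eq_comm (a := j)]
  split_ifs <;> norm_num

theorem permSymbol_swap (k i j : Fin 3) : permSymbol ![k, i, j] = - permSymbol ![k, j, i] := by
  fin_cases k <;> fin_cases i <;> fin_cases j <;> simp [permSymbol, Matrix.det_fin_three]

theorem rotationField_isFlatConformalKillingOn (k : Fin 3) :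
    IsFlatConformalKillingOn (rotationField k) V := by
  have hd : ∀ i (y : EuclideanSpace ℝ (Fin 3)),
      DifferentiableAt ℝ (fun y : EuclideanSpace ℝ (Fin 3) => y i) y := fun i y =>
    (contDiff_coord i).contDiffAt.differentiableAt_infty
  refine ⟨(contDiff_euclidean.2 fun j => ?_).contDiffOn, fun _ => 0, fun x _ i j => ?_⟩
  · exact (ContDiff.sum fun i _ => contDiff_const.mul (contDiff_coord i) :
      ContDiff ℝ ∞ fun x : EuclideanSpace ℝ (Fin 3) => ∑ i, permSymbol ![k, i, j] * x i)
  · have h1 : ∀ i j, pderiv i (fun y => rotationField k y j) x = permSymbol ![k, i, j] := by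
      intro i j
      have e : (fun y => rotationField k y j) = fun y => ∑ i, permSymbol ![k, i, j] * y i := rfl
      rw [e, pderiv_sum _ _ fun a _ => (hd a x).const_mul _]
      simp [pderiv_const_mul _ _ (hd _ x), pderiv_coord]
    rw [h1, h1, permSymbol_swap, neg_add_cancel, ite_self]

theorem properConformalField_isFlatConformalKillingOn (k : Fin 3) :
    IsFlatConformalKillingOn (properConformalField k) V := by
  have hd : ∀ i (y : EuclideanSpace ℝ (Fin 3)),
      DifferentiableAt ℝ (fun y : EuclideanSpace ℝ (Fin 3) => y i) y := fun i y =>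
    (contDiff_coord i).contDiffAt.differentiableAt_infty
  refine ⟨(((contDiff_coord k).smul contDiff_id).sub ((contDiff_const.mul
    (contDiff_norm_sq ℝ)).smul contDiff_const)).contDiffOn, fun x => 2 * x k, fun x _ i j => ?_⟩
  have h1 : ∀ i j, pderiv i (fun y => properConformalField k y j) x =
      (if k = i then 1 else 0) * x j + x k * (if j = i then 1 else 0)
        - (if j = k then 1 else 0) * x i := by
    intro i j
    have e : (fun y => properConformalField k y j) = fun y : EuclideanSpace ℝ (Fin 3) =>
        y k * y j - (1 / 2 * (if j = k then 1 else 0)) * ∑ a, y a * y a := by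
      funext y
      simp only [properConformalField, scalingField, sum_mul_self_eq_norm_sq]
      simp
    have h2 : ∀ a, DifferentiableAt ℝ (fun y : EuclideanSpace ℝ (Fin 3) => y a * y a) x :=
      fun a => (hd a x).fun_mul (hd a x)
    have h3 := DifferentiableAt.fun_sum (u := Finset.univ) fun a _ => h2 a
    rw [e, pderiv_sub i ((hd k x).fun_mul (hd j x)) (h3.const_mul _),
      pderiv_mul i (hd k x) (hd j x), pderiv_const_mul i _ h3, pderiv_sum _ _ fun a _ => h2 a]
    simp only [pderiv_mul i (hd _ x) (hd _ x), pderiv_coord]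
    rw [show ∑ a, ((if a = i then 1 else 0) * x a + x a * (if a = i then 1 else 0)) = 2 * x i by
      simp [Finset.sum_add_distrib]; ring]
    ring
  rw [h1, h1]
  fin_cases i <;> fin_cases j <;> fin_cases k <;> simp <;> ring

end ConformalKillingFields

/-! ### Smoothness of the densities, read off from their expressions by Weyl components. -/

section DensitySmooth

variable {g : EuclideanSpace ℝ (Fin 4) → Matrix (Fin 4) (Fin 4) ℝ} {x : EuclideanSpace ℝ (Fin 3)}

theorem magneticDensity_contDiffAt (hW : ∀ᶠ y in 𝓝 x, IsWeylFieldAt g (slicePt y))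
    (hs : ∀ᶠ y in 𝓝 x, IsSpacelikeAt g y) (c j : Fin 3) : ContDiffAt ℝ ∞ (fun y =>
      (raisedDensity (inducedMetric g y) (magneticPart g y) * inducedMetric g y) c j) x := by
  refine (hW.self_of_nhds.mixed_contDiffAt hs.self_of_nhds j (c + 1)
    (c + 2)).congr_of_eventuallyEq ?_
  filter_upwards [hW, hs] with y hWy hy
  rw [hWy.magneticPart_density hy]
  rfl

theorem electricDensity_contDiffAt (hW : ∀ᶠ y in 𝓝 x, IsWeylFieldAt g (slicePt y))
    (hs : ∀ᶠ y in 𝓝 x, IsSpacelikeAt g y) (c j : Fin 3) : ContDiffAt ℝ ∞ (fun y =>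
      (raisedDensity (inducedMetric g y) (electricPart g y) * inducedMetric g y) c j) x := by
  have h := hs.self_of_nhds
  have hm := h.induced_isMetricAt
  have h1 : ContDiffAt ℝ ∞ (fun y => (Real.sqrt (inducedMetric g y).det)⁻¹) x :=
    ((contDiffAt_matrix_det hm.contDiffAt).sqrt h.det_induced_pos.ne').inv
      (IsWeylFieldAt.sqrt_det_ne h)
  refine (h1.mul (ContDiffAt.sum (s := Finset.univ) fun d _ =>
    (hW.self_of_nhds.tangential_contDiffAt (d + 1) (d + 2)
    (c + 1) (c + 2)).mul (hm.contDiffAt d j))).congr_of_eventuallyEq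
    (f₁ := fun y => (raisedDensity (inducedMetric g y) (electricPart g y)
      * inducedMetric g y) c j) ?_
  filter_upwards [hW, hs] with y hWy hy
  rw [hWy.electricPart_density hy, Matrix.smul_mul, Matrix.smul_apply, Matrix.mul_apply,
    smul_eq_mul]
  rfl

end DensitySmooth

theorem inducedMetric_isSpacelikeAt {R₀ : ℝ}
    {g : EuclideanSpace ℝ (Fin 4) → Matrix (Fin 4) (Fin 4) ℝ}
    {U : Set (EuclideanSpace ℝ (Fin 4))} (hU : ∀ x, R₀ < ‖x‖ → slicePt x ∈ U)
    (hg : IsLorentzianMetricOn g U) (hs : ∀ x, R₀ < ‖x‖ → (inducedMetric g x).PosDef)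
    {x : EuclideanSpace ℝ (Fin 3)} (hx : R₀ < ‖x‖) : IsSpacelikeAt g x where
  metric := hg.isMetricAt (hU x hx)
  det_neg := (hg.lorentzian _ (hU x hx)).det_neg
  posDef := Filter.mem_of_superset ((isOpen_exterior R₀).mem_nhds hx) hs

/-! ### Assembly: from the constraint equations to the charges. -/

section ExistenceOfCharges

variable {R₀ M ε : ℝ} {g : EuclideanSpace ℝ (Fin 4) → Matrix (Fin 4) (Fin 4) ℝ}
  {h : EuclideanSpace ℝ (Fin 3) → Matrix (Fin 3) (Fin 3) ℝ}
  {X : EuclideanSpace ℝ (Fin 3) → EuclideanSpace ℝ (Fin 3)}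

/-- A symmetric trace-free tensor field on the slice that decays like `r⁻³` and satisfies a
constraint equation with a source of order `r⁻⁶` has asymptotic charges. -/
theorem hasAsymptoticCharge_of_constraint (hR₀ : 0 < R₀) (hε : 0 < ε)
    (hs : ∀ x, R₀ < ‖x‖ → IsSpacelikeAt g x)
    (hγ : ∀ x, R₀ < ‖x‖ → inducedMetric g x = conformalFactor M x • (1 + h x))
    (hh : ∀ i j, (fun x => h x i j) =O[cobounded (EuclideanSpace ℝ (Fin 3))]
      fun x => ‖x‖ ^ (-1 - ε))
    (hΓ : ∀ a i j, (fun x => christoffel (fun y => 1 + h y) x a i j)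
      =O[cobounded (EuclideanSpace ℝ (Fin 3))] fun x => ‖x‖ ^ (-2 - ε))
    {T : EuclideanSpace ℝ (Fin 3) → Matrix (Fin 3) (Fin 3) ℝ}
    {J : Fin 3 → EuclideanSpace ℝ (Fin 3) → ℝ}
    (hTO : ∀ i j, (fun x => T x i j) =O[cobounded (EuclideanSpace ℝ (Fin 3))]
      fun x => ‖x‖ ^ (-3 : ℝ))
    (hJ : ∀ j, J j =O[cobounded (EuclideanSpace ℝ (Fin 3))] fun x => ‖x‖ ^ (-6 : ℝ))
    (hTsymm : ∀ x, R₀ < ‖x‖ → (T x).IsSymm)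
    (htr : ∀ x, R₀ < ‖x‖ → ∑ i, ∑ j, (inducedMetric g x)⁻¹ i j * T x i j = 0)
    (hTs : ∀ x c j, R₀ < ‖x‖ → ContDiffAt ℝ ∞
      (fun y => (raisedDensity (inducedMetric g y) (T y) * inducedMetric g y) c j) x)
    (hdiv : ∀ x j, R₀ < ‖x‖ → ∑ c, pderiv c (fun y =>
        (raisedDensity (inducedMetric g y) (T y) * inducedMetric g y) c j) x =
      (1 / 2) * ∑ c, ∑ k, raisedDensity (inducedMetric g x) (T x) c k
        * pderiv j (fun y => inducedMetric g y c k) x + J j x)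
    (hX : IsFlatConformalKillingOn X {x | R₀ < ‖x‖}) :
    HasAsymptoticCharge R₀ (inducedMetric g) T X := by
  have hpos := fun x hx => (hs x hx).det_induced_pos
  have hsymm := fun x hx => (hs x hx).induced_isMetricAt.symm.self_of_nhds
  -- For M < 0 the factor vanishes at r = -M/2; nondegeneracy of γ excludes this radius from the
  -- exterior.
  have hf : ∀ x, R₀ < ‖x‖ → conformalFactor M x ≠ 0 := fun x hx h0 => by
    have := hpos x hx
    rw [hγ x hx, h0, zero_smul] at this
    simp at this
  have hm : ∀ x, R₀ < ‖x‖ → IsMetricAt (fun y => 1 + h y) x := fun x hx =>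
    isMetricAt_one_add hγ hR₀ hf (fun y hy => (hs y hy).induced_isMetricAt) hx
  obtain ⟨hW, hlim⟩ := exists_flux_limit (S := fun x => raisedDensity (inducedMetric g x) (T x))
    hR₀ hε hγ hf (fun x i j hx => contDiffAt_of_isMetricAt_one_add (hm x hx) i j) hh
    (pderiv_isBigO_of_christoffel hε hm hh hΓ) hTs
    (fun x hx => raisedDensity_isSymm (hsymm x hx) (hTsymm x hx))
    (fun x hx => sum_raisedDensity_mul (hsymm x hx) (hpos x hx).ne' (hTsymm x hx) (htr x hx))
    (raisedDensity_isBigO (tendsto_metric_one hε hγ hh) hTO) hJ hdiv hX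
  exact hasAsymptoticCharge_of_flux hR₀ (fun x hx => (hpos x hx).ne') hW hlim

end ExistenceOfCharges

theorem mainTheorem6
    -- a vacuum spacetime, in coordinates `(t, x)` near the hypersurface `t = 0`, `‖x‖ > R₀`
    (g : EuclideanSpace ℝ (Fin 4) → Matrix (Fin 4) (Fin 4) ℝ)
    (U : Set (EuclideanSpace ℝ (Fin 4))) (Λ R₀ : ℝ) (hR₀ : 0 < R₀)
    (hU : ∀ x : EuclideanSpace ℝ (Fin 3), R₀ < ‖x‖ → slicePt x ∈ U)
    (hg : IsLorentzianMetricOn g U) (hE : IsEinsteinVacuumOn Λ g U)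
    (hspacelike : ∀ x : EuclideanSpace ℝ (Fin 3), R₀ < ‖x‖ → (inducedMetric g x).PosDef)
    -- the form of the induced metric
    (M ε : ℝ) (hε : 0 < ε) (h : EuclideanSpace ℝ (Fin 3) → Matrix (Fin 3) (Fin 3) ℝ)
    (hγ : ∀ x : EuclideanSpace ℝ (Fin 3), R₀ < ‖x‖ →
      inducedMetric g x = (1 + M / (2 * ‖x‖)) ^ 4 • (1 + h x))
    -- the behaviour at infinity
    (hh : ∀ i j, (fun x => h x i j) =O[cobounded (EuclideanSpace ℝ (Fin 3))]
      fun x => ‖x‖ ^ (-1 - ε))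
    (hΓ : ∀ a i j, (fun x => christoffel (fun y => 1 + h y) x a i j)
      =O[cobounded (EuclideanSpace ℝ (Fin 3))] fun x => ‖x‖ ^ (-2 - ε))
    (hK : ∀ i j, (fun x => extrinsicCurv g x i j) =O[cobounded (EuclideanSpace ℝ (Fin 3))]
      fun x => ‖x‖ ^ (-3 : ℝ))
    (hEl : ∀ i j, (fun x => electricPart g x i j) =O[cobounded (EuclideanSpace ℝ (Fin 3))]
      fun x => ‖x‖ ^ (-3 : ℝ))
    (hB : ∀ i j, (fun x => magneticPart g x i j) =O[cobounded (EuclideanSpace ℝ (Fin 3))]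
      fun x => ‖x‖ ^ (-3 : ℝ)) :
    -- all electric and magnetic charges
    (∀ X : EuclideanSpace ℝ (Fin 3) → EuclideanSpace ℝ (Fin 3),
      IsFlatConformalKillingOn X {x | R₀ < ‖x‖} →
      HasAsymptoticCharge R₀ (inducedMetric g) (electricPart g) X ∧
      HasAsymptoticCharge R₀ (inducedMetric g) (magneticPart g) X) ∧
    -- in particular mass, center of mass, linear momentum, angular momentum
    HasAsymptoticCharge R₀ (inducedMetric g) (electricPart g) scalingField ∧
    (∀ k, HasAsymptoticCharge R₀ (inducedMetric g) (electricPart g) (properConformalField k)) ∧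
    (∀ k, HasAsymptoticCharge R₀ (inducedMetric g) (magneticPart g) (rotationField k)) ∧
    (∀ k, HasAsymptoticCharge R₀ (inducedMetric g) (magneticPart g) (properConformalField k)) := by
  have hs : ∀ x, R₀ < ‖x‖ → IsSpacelikeAt g x := fun x hx =>
    inducedMetric_isSpacelikeAt hU hg hspacelike hx
  have hW : ∀ x, R₀ < ‖x‖ → IsWeylFieldAt g (slicePt x) := fun x hx =>
    hg.isWeylFieldAt hE (hU x hx)
  have hev : ∀ {P : EuclideanSpace ℝ (Fin 3) → Prop}, (∀ x, R₀ < ‖x‖ → P x) →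
      ∀ x, R₀ < ‖x‖ → ∀ᶠ y in 𝓝 x, P y := fun hP x hx =>
    Filter.mem_of_superset ((isOpen_exterior R₀).mem_nhds hx) hP
  have hlim := tendsto_metric_one hε hγ hh
  -- The two cases are coupled through their sources: the electric one also needs the decay of B,
  -- the magnetic one that of E.
  have hel : ∀ X : EuclideanSpace ℝ (Fin 3) → EuclideanSpace ℝ (Fin 3),
      IsFlatConformalKillingOn X {x | R₀ < ‖x‖} →
      HasAsymptoticCharge R₀ (inducedMetric g) (electricPart g) X := fun X hX =>
    hasAsymptoticCharge_of_constraint hR₀ hε hs hγ hh hΓ hEl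
      (electricSource_isBigO hW hs hlim hK hB) (fun x hx => (hW x hx).electricPart_isSymm)
      (fun x hx => (hW x hx).electricPart_trace (hs x hx))
      (fun x c j hx => electricDensity_contDiffAt (hev hW x hx) (hev hs x hx) c j)
      (fun x j hx => IsWeylFieldAt.electric_constraint (hev hW x hx) (hev hs x hx) j) hX
  have hma : ∀ X : EuclideanSpace ℝ (Fin 3) → EuclideanSpace ℝ (Fin 3),
      IsFlatConformalKillingOn X {x | R₀ < ‖x‖} →
      HasAsymptoticCharge R₀ (inducedMetric g) (magneticPart g) X := fun X hX =>
    hasAsymptoticCharge_of_constraint hR₀ hε hs hγ hh hΓ hB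
      (magneticSource_isBigO hW hs hlim hK hEl)
      (fun x hx => (hW x hx).magneticPart_isSymm (hs x hx))
      (fun x hx => (hW x hx).magneticPart_trace (hs x hx))
      (fun x c j hx => magneticDensity_contDiffAt (hev hW x hx) (hev hs x hx) c j)
      (fun x j hx => IsWeylFieldAt.magnetic_constraint (hev hW x hx) (hev hs x hx) j) hX
  exact ⟨fun X hX => ⟨hel X hX, hma X hX⟩, hel _ scalingField_isFlatConformalKillingOn,
    fun k => hel _ (properConformalField_isFlatConformalKillingOn k),
    fun k => hma _ (rotationField_isFlatConformalKillingOn k),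
    fun k => hma _ (properConformalField_isFlatConformalKillingOn k)⟩
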